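/- Let $\Omega=(-1,1)$. For real $r\ge 0$ with $k=\lfloor r\rfloor$ and $s=r-k$, let $H^r(\Omega)$ be the Sobolev space of real functions with weak derivatives through order $k$ in $L^2(\Omega)$ and, if $s>0$, with finite Slobodeckij seminorm $[u^{(k)}]_s$, where $[g]_s^2=\int_\Omega\int_\Omega |g(x)-g(y)|^2|x-y|^{-1-2s}\,dy\,dx$. Its norm is given by $\|u\|_{H^r(\Omega)}^2=\sum_{j=0}^k\|u^{(j)}\|_{L^2(\Omega)}^2$, plus $[u^{(k)}]_s^2$ if $s>0$. Let $|u|_{H^1(\Omega)}=\|u'\|_{L^2(\Omega)}$. Let $\mathcal P_N$ be the space of real polynomials of degree at most $N$, let $\tau_0=-1$, and let $\tau_1,\dots,\tau_N$ be the Gauss points, that is, the roots of the Legendre polynomial of degree $N$. **Lemma 3.1.** There is a constant $c>0$ such that the following holds for every integer $N>0$, every real $\eta\ge 1$ and every $u\in H^\eta(\Omega)$ (where $u$ denotes the representative that is continuous on $[-1,1]$). There is exactly one polynomial $u^I\in\mathcal P_N$ with $u^I(\tau_i)=u(\tau_i)$ for $0\le i\le N$, and with $p=\min\{\eta,N+1\}$,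 $$|u-u^I|_{H^1(\Omega)}\le c\left(\frac cN\right)^{p-3/2}\|u\|_{H^p(\Omega)}.$$ Moreover, if $\eta\ge 2$, then $$|u-u^I|_{H^1(\Omega)}\le \left(\frac cN\right)^{p-3/2}\|u\|_{H^p(\Omega)}.$$ -/

import Mathlib

open MeasureTheory Polynomial
open scoped ENNReal ContDiff

noncomputable section

namespace GaussInterp

/-- The open interval `Ω = (-1, 1)`. -/
def Omega : Set ℝ := Set.Ioo (-1) 1

/-- Test functions on `Ω`: smooth functions with compact support contained in `Ω`. -/
def IsTestFunction (φ : ℝ → ℝ) : Prop :=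
  ContDiff ℝ ∞ φ ∧ HasCompactSupport φ ∧ tsupport φ ⊆ Omega

/-- `v` is a weak (distributional) derivative of order `k` of `u` on `Ω`. -/
def HasWeakDeriv (k : ℕ) (u v : ℝ → ℝ) : Prop :=
  LocallyIntegrableOn u Omega ∧ LocallyIntegrableOn v Omega ∧
    ∀ φ : ℝ → ℝ, IsTestFunction φ →
      ∫ x in Omega, u x * iteratedDeriv k φ x = (-1) ^ k * ∫ x in Omega, v x * φ x

open Classical in
/-- The weak derivative of order `k` of `u` on `Ω` (determined up to a null set of `Ω`);
it is `0` when `u` has no weak derivative of order `k`. -/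
def weakDeriv (k : ℕ) (u : ℝ → ℝ) : ℝ → ℝ :=
  if h : ∃ v, HasWeakDeriv k u v then h.choose else 0

/-- The `L²(Ω)` norm. -/
def l2Norm (g : ℝ → ℝ) : ℝ≥0∞ := eLpNorm g 2 (volume.restrict Omega)

/-- The square of the Gagliardo–Slobodeckij seminorm of order `s ∈ (0, 1)` on `Ω`:
`∫_Ω ∫_Ω |g x - g y|² / |x - y|^(1 + 2 s) dy dx`. -/
def slobodeckijSq (s : ℝ) (g : ℝ → ℝ) : ℝ≥0∞ :=
  ∫⁻ x in Omega, ∫⁻ y in Omega, ENNReal.ofReal (|g x - g y| ^ 2 / |x - y| ^ (1 + 2 * s))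

/-- The norm of `H^r(Ω)`, `r ≥ 0` real, as an extended number. With `k = ⌊r⌋` it is the square
root of `∑_{j ≤ k} ‖u⁽ʲ⁾‖²`, plus, if `r` is not an integer, the squared Slobodeckij seminorm
of order `r - k` of `u⁽ᵏ⁾`. -/
def sobolevNorm (r : ℝ) (u : ℝ → ℝ) : ℝ≥0∞ :=
  ((∑ j ∈ Finset.range (⌊r⌋₊ + 1), l2Norm (weakDeriv j u) ^ 2) +
    if Int.fract r = 0 then 0 else slobodeckijSq (Int.fract r) (weakDeriv ⌊r⌋₊ u)) ^ (1 / 2 : ℝ)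

/-- `u ∈ H^r(Ω)`, `r ≥ 0` real: the weak derivatives through order `⌊r⌋` exist, and the norm
(in particular the `L²(Ω)` norm of each of these derivatives) is finite. -/
def MemSobolev (r : ℝ) (u : ℝ → ℝ) : Prop :=
  (∀ j ≤ ⌊r⌋₊, ∃ v, HasWeakDeriv j u v) ∧ sobolevNorm r u < ⊤

/-- The seminorm of `H¹(Ω)`: the `L²(Ω)` norm of the first derivative. -/
def h1Seminorm (u : ℝ → ℝ) : ℝ≥0∞ := l2Norm (weakDeriv 1 u)

/-- The Legendre polynomial of degree `N` (Rodrigues' formula). -/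
def legendre (N : ℕ) : ℝ[X] :=
  C (1 / (2 ^ N * (N.factorial : ℝ))) * derivative^[N] ((X ^ 2 - 1) ^ N)

/-- `q` is a polynomial of degree at most `N` that interpolates `u` at `-1` and at the Gauss
points, which are the roots of the Legendre polynomial of degree `N`. -/
def IsGaussInterpolant (N : ℕ) (u : ℝ → ℝ) (q : ℝ[X]) : Prop :=
  q ∈ degreeLE ℝ (N : WithBot ℕ) ∧ q.eval (-1) = u (-1) ∧
    ∀ τ : ℝ, (legendre N).IsRoot τ → q.eval τ = u τ

end GaussInterp

end

/-!
The first derivative of the interpolation error is estimated by the stability of the interpolation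
operator in the `H¹` seminorm, with norm `O(√N)`, times the distance in `L²(Ω)` of `u'` to the
polynomials of degree less than `N`, since the operator reproduces polynomials of degree at most `N`
(`HasL2Deriv.l2Norm_sub_derivative_gaussInterp_le`).

*Stability.* By density it suffices to interpolate polynomials
(`HasL2Deriv.l2Norm_derivative_gaussInterp_le`, `integ_derivative_interpolant_sq_le`). After
subtracting a primitive of the `L²` projection of the derivative, the function `z` to interpolate
vanishes at `±1` and `z'` is orthogonal to the polynomials of degree less than `N`. If `e`
interpolates `z` and `v` has degree less than `N`, Gauss quadrature turns `∫ e' v` into a sum over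
the Gauss points of values of `z` against derivatives of `v - v(1) L_N`. The latter are bounded by
inverse inequalities; the endpoint value `v(1)` is responsible for the loss of `√N`. The sum of the
weighted values `z(τ)²` is bounded by a discrete Sobolev inequality (`sum_nodes_eval_sq_div_le`):
the quadrature weight at `τ` is `2 (1 - τ²) / A(τ)²` with `A = (1 - x²) L_N'`, and
`z² A² / D²`, where `D` is the squared amplitude `A² + (N (N + 1) (1 - x²) + 1) L_N²`, equals
`z² / A²` at the Gauss points and vanishes at the zeros of `A`, which separate them. Integrating its
derivative uses `D² ≥ c (N (N + 1) (1 - x²) + 1)` (`amplitude_sq_ge`), which follows from the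
monotonicity of a Sonin-type energy of Legendre's equation. Finally, the orthogonality of `z'` gains
a factor `N` for `z` against `z'` in the weighted norm that appears (`exists_factor_of_orthogonal`).

*Rate.* Truncation of Legendre expansions gives the `L²` Jackson inequality
`(n + 1) E_{n + 1}(f) ≤ E_n(f')` with constant one (`HasL2Deriv.bestApprox_succ_le`), where `E_n` is
the distance to the polynomials of degree less than `n`. Its iteration yields
`N (N - 1) ⋯ (N - m + 1)` in the denominator, hence a constant that grows only geometrically with
the order. A remaining fractional order `s` is treated by smoothing at scale `1 / n`
(`bestApprox_le_slobodeckij`).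
-/

noncomputable section

namespace GaussInterp

/-! ### Integrals of polynomials over `[-1, 1]` -/

/-- The integral over `[-1, 1]`, as a linear functional on polynomials. -/
def integ : ℝ[X] →ₗ[ℝ] ℝ where
  toFun p := ∫ x in (-1 : ℝ)..1, p.eval x
  map_add' p q := by
    simp only [eval_add]
    exact intervalIntegral.integral_add (p.continuous.intervalIntegrable _ _)
      (q.continuous.intervalIntegrable _ _)
  map_smul' c p := by simp

theorem integ_apply (p : ℝ[X]) : integ p = ∫ x in (-1 : ℝ)..1, p.eval x := rfl

theorem integ_C_mul (c : ℝ) (p : ℝ[X]) : integ (C c * p) = c * integ p := by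
  rw [← smul_eq_C_mul, map_smul, smul_eq_mul]

theorem integ_derivative (p : ℝ[X]) : integ (derivative p) = p.eval 1 - p.eval (-1) := by
  rw [integ_apply]
  exact intervalIntegral.integral_eq_sub_of_hasDerivAt (fun x _ => p.hasDerivAt x)
    ((derivative p).continuous.intervalIntegrable _ _)

theorem integ_mono {p q : ℝ[X]} (h : ∀ x ∈ Set.Icc (-1 : ℝ) 1, p.eval x ≤ q.eval x) :
    integ p ≤ integ q :=
  intervalIntegral.integral_mono_on (by norm_num) (p.continuous.intervalIntegrable _ _)
    (q.continuous.intervalIntegrable _ _) h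

theorem integ_nonneg {p : ℝ[X]} (h : ∀ x ∈ Set.Icc (-1 : ℝ) 1, 0 ≤ p.eval x) : 0 ≤ integ p := by
  simpa using integ_mono (p := 0) (q := p) (by simpa using h)

theorem integ_pos {p : ℝ[X]} (h : ∀ x ∈ Set.Icc (-1 : ℝ) 1, 0 ≤ p.eval x) (hp : p ≠ 0) :
    0 < integ p := by
  have hfin : {x : ℝ | p.eval x = 0}.Finite := by
    refine (p.roots.toFinset.finite_toSet).subset fun x hx => ?_
    simpa [hp] using hx
  obtain ⟨c, hc, hc0⟩ : ∃ c ∈ Set.Ioo (-1 : ℝ) 1, p.eval c ≠ 0 := by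
    by_contra! hcon
    exact (Set.Ioo_infinite (by norm_num : (-1 : ℝ) < 1)) (hfin.subset hcon)
  exact intervalIntegral.integral_pos (by norm_num) p.continuous.continuousOn
    (fun x hx => h x ⟨hx.1.le, hx.2⟩)
    ⟨c, ⟨hc.1.le, hc.2.le⟩, lt_of_le_of_ne (h c ⟨hc.1.le, hc.2.le⟩) (Ne.symm hc0)⟩

theorem integ_mul_self_nonneg (p : ℝ[X]) : 0 ≤ integ (p * p) :=
  integ_nonneg fun x _ => by rw [eval_mul]; exact mul_self_nonneg _

theorem integ_mul_self_pos {p : ℝ[X]} (hp : p ≠ 0) : 0 < integ (p * p) :=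
  integ_pos (fun x _ => by rw [eval_mul]; exact mul_self_nonneg _) (mul_ne_zero hp hp)

theorem integ_mul_sq_le (p q : ℝ[X]) : integ (p * q) ^ 2 ≤ integ (p * p) * integ (q * q) := by
  have key : ∀ t : ℝ, 0 ≤ integ (p * p) * (t * t) + (2 * integ (p * q)) * t + integ (q * q) := by
    intro t
    have h := integ_mul_self_nonneg (C t * p + q)
    have e : (C t * p + q) * (C t * p + q) =
        C (t * t) * (p * p) + C (2 * t) * (p * q) + q * q := by
      simp only [C_mul, map_ofNat]; ring
    rw [e, map_add, map_add, integ_C_mul, integ_C_mul] at h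
    linarith
  have := discrim_le_zero key
  rw [discrim] at this
  nlinarith

/-! ### Legendre polynomials -/

/-- The Legendre eigenvalue `n (n + 1)`. -/
def eig (n : ℕ) : ℝ := n * (n + 1)

theorem eig_nonneg (n : ℕ) : 0 ≤ eig n := by unfold eig; positivity

theorem eig_pos {n : ℕ} (hn : 0 < n) : 0 < eig n := by
  have : (0 : ℝ) < n := by exact_mod_cast hn
  unfold eig; positivity

theorem eig_le_eig {m n : ℕ} (h : m ≤ n) : eig m ≤ eig n := by
  have : (m : ℝ) ≤ n := by exact_mod_cast h
  unfold eig
  gcongr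

/-- The recursion obtained by differentiating `(X² - 1) w' = 2 n X w`, `w = (X² - 1)ⁿ`,
repeatedly. -/
theorem iterate_derivative_rodrigues (n k : ℕ) :
    (X ^ 2 - 1 : ℝ[X]) * derivative^[k + 2] ((X ^ 2 - 1) ^ n) =
      C (2 * n - 2 * (k + 1) : ℝ) * X * derivative^[k + 1] ((X ^ 2 - 1) ^ n) +
        C ((k + 1) * (2 * n - k) : ℝ) * derivative^[k] ((X ^ 2 - 1) ^ n) := by
  induction k with
  | zero =>
    have h0 : (X ^ 2 - 1 : ℝ[X]) * derivative ((X ^ 2 - 1) ^ n) =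
        C (2 * n : ℝ) * X * (X ^ 2 - 1) ^ n := by
      rcases n with _ | n
      · simp
      · rw [derivative_pow_succ]
        simp only [derivative_sub, derivative_X_pow, derivative_one, map_mul, map_add]
        simp
        ring
    have h1 := congrArg derivative h0
    simp only [derivative_mul, derivative_sub, derivative_X_pow, derivative_one, derivative_C,
      derivative_X] at h1
    simp only [Function.iterate_succ', Function.iterate_zero, Function.comp, id]
    simp only [map_sub, map_mul, map_add, Nat.cast_zero, map_zero, map_one, map_ofNat,
      map_natCast] at h1 ⊢
    simp at h1
    linear_combination h1
  | succ k ih =>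
    have h1 := congrArg derivative ih
    have e (j : ℕ) : derivative (derivative^[j] ((X ^ 2 - 1 : ℝ[X]) ^ n)) =
      derivative^[j + 1] ((X ^ 2 - 1) ^ n) := (Function.iterate_succ_apply' _ _ _).symm
    simp only [derivative_mul, derivative_add, derivative_sub, derivative_X_pow, derivative_one,
      derivative_C, derivative_X, e] at h1
    rw [show k + 2 + 1 = k + 1 + 2 from rfl] at h1
    rw [show k + 2 = k + 1 + 1 from rfl] at h1
    generalize derivative^[k + 1 + 2] ((X ^ 2 - 1 : ℝ[X]) ^ n) = w3 at h1 ⊢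
    generalize derivative^[k + 1 + 1] ((X ^ 2 - 1 : ℝ[X]) ^ n) = w2 at h1 ⊢
    generalize derivative^[k + 1] ((X ^ 2 - 1 : ℝ[X]) ^ n) = w1 at h1 ⊢
    generalize derivative^[k] ((X ^ 2 - 1 : ℝ[X]) ^ n) = w0 at h1 ⊢
    simp only [map_sub, map_mul, map_add, map_one, map_ofNat, Nat.cast_add, Nat.cast_one,
      map_natCast] at h1 ⊢
    simp at h1
    linear_combination h1

/-- Legendre's differential equation. -/
theorem legendre_ode (n : ℕ) :
    derivative ((1 - X ^ 2) * derivative (legendre n)) = -(C (eig n) * legendre n) := by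
  have h := iterate_derivative_rodrigues n n
  have h1 : derivative (legendre n) =
      C (1 / (2 ^ n * (n.factorial : ℝ))) * derivative^[n + 1] ((X ^ 2 - 1) ^ n) := by
    rw [legendre, derivative_mul, derivative_C, Function.iterate_succ_apply']; simp
  have h2 : derivative (derivative (legendre n)) =
      C (1 / (2 ^ n * (n.factorial : ℝ))) * derivative^[n + 2] ((X ^ 2 - 1) ^ n) := by
    rw [h1, derivative_mul, derivative_C, Function.iterate_succ_apply' derivative (n + 1)]; simp
  rw [derivative_mul, h2, h1]
  simp only [legendre, eig]
  generalize derivative^[n + 2] ((X ^ 2 - 1 : ℝ[X]) ^ n) = w2 at h ⊢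
  generalize derivative^[n + 1] ((X ^ 2 - 1 : ℝ[X]) ^ n) = w1 at h ⊢
  generalize derivative^[n] ((X ^ 2 - 1 : ℝ[X]) ^ n) = w0 at h ⊢
  generalize C (1 / (2 ^ n * (n.factorial : ℝ))) = c
  simp only [derivative_X_pow, derivative_one, map_mul, map_add, map_sub, map_one,
    map_ofNat, map_natCast, Nat.cast_ofNat, Nat.add_one_sub_one, pow_one] at h ⊢
  linear_combination (-c) * h

theorem eval_iterate_derivative_X_sub_C_pow_mul (n : ℕ) (a : ℝ) (q : ℝ[X]) :
    (derivative^[n] ((X - C a) ^ n * q)).eval a = n.factorial * q.eval a := by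
  have := aeval_iterate_derivative_self (A := ℝ) ((X - C a) ^ n * q) n a (p' := q) (by simp)
  simpa using this

theorem legendre_eval_one (n : ℕ) : (legendre n).eval 1 = 1 := by
  have e : (X ^ 2 - 1 : ℝ[X]) ^ n = (X - C 1) ^ n * (X + 1) ^ n := by
    rw [← mul_pow]; congr 1; simp; ring
  rw [legendre, e, eval_mul, eval_iterate_derivative_X_sub_C_pow_mul]
  have : (n.factorial : ℝ) ≠ 0 := by exact_mod_cast n.factorial_ne_zero
  simp
  norm_num
  field_simp

theorem legendre_eval_neg_one (n : ℕ) : (legendre n).eval (-1) = (-1) ^ n := by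
  have e : (X ^ 2 - 1 : ℝ[X]) ^ n = (X - C (-1)) ^ n * (X - 1) ^ n := by
    rw [← mul_pow]; congr 1; simp; ring
  rw [legendre, e, eval_mul, eval_iterate_derivative_X_sub_C_pow_mul]
  have : (n.factorial : ℝ) ≠ 0 := by exact_mod_cast n.factorial_ne_zero
  simp
  norm_num
  rw [show (-2 : ℝ) = (-1) * 2 by norm_num, mul_pow]
  field_simp

theorem natDegree_X_sq_sub_one_pow (n : ℕ) : ((X ^ 2 - 1 : ℝ[X]) ^ n).natDegree = 2 * n := by
  rw [natDegree_pow, show (X ^ 2 - 1 : ℝ[X]) = X ^ 2 - C 1 by simp, natDegree_X_pow_sub_C,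
    mul_comm]

theorem natDegree_legendre (n : ℕ) : (legendre n).natDegree = n := by
  have hc : (1 / (2 ^ n * (n.factorial : ℝ))) ≠ 0 := by positivity
  rw [legendre, natDegree_C_mul hc]
  refine le_antisymm ((natDegree_iterate_derivative _ _).trans ?_)
    (le_natDegree_of_ne_zero ?_)
  · rw [natDegree_X_sq_sub_one_pow]; omega
  · have hm : ((X ^ 2 - 1 : ℝ[X]) ^ n).Monic := by
      rw [show (X ^ 2 - 1 : ℝ[X]) = X ^ 2 - C 1 by simp]
      exact (monic_X_pow_sub_C 1 two_ne_zero).pow n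
    have h1 := hm.coeff_natDegree
    rw [natDegree_X_sq_sub_one_pow, two_mul] at h1
    rw [coeff_iterate_derivative, h1]
    simp [Nat.descFactorial_eq_zero_iff_lt]

theorem legendre_ne_zero (n : ℕ) : legendre n ≠ 0 := fun h => by
  simpa [h] using legendre_eval_one n

theorem degree_legendre (n : ℕ) : (legendre n).degree = n := by
  rw [degree_eq_natDegree (legendre_ne_zero n), natDegree_legendre]

/-- Symmetry of the Legendre operator: integrating by parts moves a derivative onto `p`. -/
theorem integ_derivative_legendre_mul (n : ℕ) (p : ℝ[X]) :
    integ ((1 - X ^ 2) * derivative (legendre n) * derivative p) =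
      eig n * integ (legendre n * p) := by
  have h := integ_derivative ((1 - X ^ 2) * derivative (legendre n) * p)
  rw [derivative_mul, legendre_ode, map_add,
    show -(C (eig n) * legendre n) * p = C (-eig n) * (legendre n * p) by simp; ring,
    integ_C_mul] at h
  simp at h
  linarith

theorem eig_injective {m n : ℕ} (h : eig m = eig n) : m = n := by
  simp only [eig] at h
  have : m * (m + 1) = n * (n + 1) := by exact_mod_cast h
  nlinarith

theorem integ_legendre_mul_legendre {m n : ℕ} (h : m ≠ n) :
    integ (legendre m * legendre n) = 0 := by
  have h1 := integ_derivative_legendre_mul m (legendre n)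
  have h2 := integ_derivative_legendre_mul n (legendre m)
  rw [mul_right_comm, h2, mul_comm (legendre n)] at h1
  by_contra h0
  exact h (eig_injective (mul_right_cancel₀ h0 h1)).symm

theorem exists_legendre_expansion (n : ℕ) (p : ℝ[X]) (hp : p.degree < n) :
    ∃ a : ℕ → ℝ, p = ∑ k ∈ Finset.range n, C (a k) * legendre k := by
  induction n generalizing p with
  | zero => exact ⟨0, by simpa using hp⟩
  | succ n ih =>
    have hl : (legendre n).coeff n ≠ 0 := by
      have := leadingCoeff_ne_zero.2 (legendre_ne_zero n)
      rwa [leadingCoeff, natDegree_legendre] at this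
    obtain ⟨a, ha⟩ := ih (p - C (p.coeff n / (legendre n).coeff n) * legendre n) (by
      rw [degree_lt_iff_coeff_zero] at hp ⊢
      intro m hm
      rcases hm.eq_or_lt with rfl | hm
      · simp [hl]
      · rw [coeff_sub, coeff_C_mul, hp m hm,
          coeff_eq_zero_of_natDegree_lt (p := legendre n) (n := m)
          (by rwa [natDegree_legendre])]
        simp)
    refine ⟨fun k => if k < n then a k else p.coeff n / (legendre n).coeff n, ?_⟩
    rw [Finset.sum_range_succ]
    simp only [lt_irrefl, if_false]
    rw [← sub_eq_iff_eq_add, ha]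
    refine Finset.sum_congr rfl fun k hk => ?_
    simp [Finset.mem_range.1 hk]

theorem integ_legendre_mul {n : ℕ} {p : ℝ[X]} (hp : p.degree < n) :
    integ (legendre n * p) = 0 := by
  obtain ⟨a, rfl⟩ := exists_legendre_expansion n p hp
  rw [Finset.mul_sum, map_sum]
  refine Finset.sum_eq_zero fun k hk => ?_
  rw [show legendre n * (C (a k) * legendre k) = C (a k) * (legendre n * legendre k) by ring,
    integ_C_mul, integ_legendre_mul_legendre (Finset.mem_range.1 hk).ne', mul_zero]

theorem integ_expansion_mul_legendre (a : ℕ → ℝ) {n k : ℕ} (hk : k < n) :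
    integ ((∑ j ∈ Finset.range n, C (a j) * legendre j) * legendre k) =
      a k * integ (legendre k * legendre k) := by
  rw [Finset.sum_mul, map_sum, Finset.sum_eq_single k]
  · rw [mul_assoc, integ_C_mul]
  · intro j _ hjk
    rw [mul_assoc, integ_C_mul, integ_legendre_mul_legendre hjk, mul_zero]
  · intro h; exact absurd (Finset.mem_range.2 hk) h

/-- Parseval's identity for a finite Legendre expansion. -/
theorem integ_expansion_sq (a : ℕ → ℝ) (n : ℕ) :
    integ ((∑ k ∈ Finset.range n, C (a k) * legendre k) *
      (∑ k ∈ Finset.range n, C (a k) * legendre k)) =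
      ∑ k ∈ Finset.range n, a k ^ 2 * integ (legendre k * legendre k) := by
  conv_lhs => rw [Finset.mul_sum, map_sum]
  refine Finset.sum_congr rfl fun k hk => ?_
  rw [mul_left_comm, integ_C_mul, integ_expansion_mul_legendre a (Finset.mem_range.1 hk)]
  ring

/-- Derivatives of Legendre polynomials are orthogonal for the weight `1 - x²`. -/
theorem integ_weighted_derivative_expansion_sq (a : ℕ → ℝ) (n : ℕ) :
    integ ((1 - X ^ 2) * (derivative (∑ k ∈ Finset.range n, C (a k) * legendre k) *
      derivative (∑ k ∈ Finset.range n, C (a k) * legendre k))) =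
      ∑ k ∈ Finset.range n, eig k * (a k ^ 2 * integ (legendre k * legendre k)) := by
  set p := ∑ k ∈ Finset.range n, C (a k) * legendre k with hp
  have e : (1 - X ^ 2) * (derivative p * derivative p) =
      ∑ k ∈ Finset.range n, C (a k) * ((1 - X ^ 2) * derivative (legendre k) * derivative p) := by
    have : derivative p = ∑ k ∈ Finset.range n, C (a k) * derivative (legendre k) := by
      rw [hp, derivative_sum]; simp
    conv_lhs => rw [← mul_assoc, mul_comm (1 - X ^ 2), mul_assoc]
    nth_rw 1 [this]
    rw [Finset.sum_mul]
    refine Finset.sum_congr rfl fun k _ => ?_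
    ring
  rw [e, map_sum]
  refine Finset.sum_congr rfl fun k hk => ?_
  rw [integ_C_mul, integ_derivative_legendre_mul, mul_comm (legendre k) p,
    integ_expansion_mul_legendre a (Finset.mem_range.1 hk)]
  ring

theorem degree_expansion_lt (a : ℕ → ℝ) (n : ℕ) :
    (∑ k ∈ Finset.range n, C (a k) * legendre k).degree < n := by
  rw [← mem_degreeLT]
  refine Submodule.sum_mem _ fun k hk => ?_
  rw [← smul_eq_C_mul]
  refine Submodule.smul_mem _ _ (mem_degreeLT.2 ?_)
  rw [degree_legendre]
  exact_mod_cast Finset.mem_range.1 hk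

/-- Jackson's inequality in `L²`, for polynomials: truncating the Legendre expansion of `p` at
degree `n` leaves an error of at most `‖p'‖ / (n + 1)`. -/
theorem exists_poly_approx (n : ℕ) (p : ℝ[X]) :
    ∃ q : ℝ[X], q.degree < (n + 1 : ℕ) ∧
      (n + 1 : ℝ) ^ 2 * integ ((p - q) * (p - q)) ≤ integ (derivative p * derivative p) := by
  obtain ⟨a, ha⟩ := exists_legendre_expansion (p.natDegree + 1) p
    (by rw [degree_lt_iff_coeff_zero]; intro m hm; exact coeff_eq_zero_of_natDegree_lt hm)
  set M := p.natDegree + 1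
  refine ⟨∑ k ∈ Finset.range (n + 1), C (if k < M then a k else 0) * legendre k,
    degree_expansion_lt _ _, ?_⟩
  have e : p - ∑ k ∈ Finset.range (n + 1), C (if k < M then a k else 0) * legendre k =
      ∑ k ∈ Finset.range M, C (if k < n + 1 then 0 else a k) * legendre k := by
    rw [sub_eq_iff_eq_add]
    have e1 : ∑ k ∈ Finset.range (n + 1), C (if k < M then a k else 0) * legendre k =
        ∑ k ∈ Finset.range M, C (if k < n + 1 then a k else 0) * legendre k := by
      rw [← Finset.sum_filter_add_sum_filter_not (Finset.range (n + 1)) (fun k => k < M),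
        ← Finset.sum_filter_add_sum_filter_not (Finset.range M) (fun k => k < n + 1)]
      congr 1
      · refine Finset.sum_congr (by ext; simp [and_comm]) fun k hk => ?_
        simp only [Finset.mem_filter, Finset.mem_range] at hk
        simp [hk.1, hk.2]
      · rw [Finset.sum_eq_zero, Finset.sum_eq_zero] <;>
        · intro k hk
          simp only [Finset.mem_filter, Finset.mem_range] at hk
          simp [hk.2]
    rw [e1, ← Finset.sum_add_distrib]
    conv_lhs => rw [ha]
    refine Finset.sum_congr rfl fun k _ => ?_
    split_ifs <;> simp
  rw [e, integ_expansion_sq]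
  have h2 : integ ((1 - X ^ 2) * (derivative p * derivative p)) ≤
      integ (derivative p * derivative p) := integ_mono fun x _ => by
    simp only [eval_mul, eval_sub, eval_one, eval_pow, eval_X]
    nlinarith [mul_nonneg (sq_nonneg x) (mul_self_nonneg ((derivative p).eval x))]
  refine le_trans ?_ h2
  conv_rhs => rw [ha]
  rw [integ_weighted_derivative_expansion_sq, Finset.mul_sum]
  refine Finset.sum_le_sum fun k _ => ?_
  have hk := integ_mul_self_nonneg (legendre k)
  split_ifs with h
  · have := eig_nonneg k
    simp only [ne_eq, OfNat.ofNat_ne_zero, not_false_eq_true, zero_pow, zero_mul, mul_zero]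
    positivity
  · have : (n + 1 : ℝ) ≤ k := by exact_mod_cast not_lt.1 h
    refine mul_le_mul_of_nonneg_right ?_ (by positivity)
    unfold eig; nlinarith

/-- A weighted inverse inequality. -/
theorem integ_weighted_derivative_sq_le {N : ℕ} {v : ℝ[X]} (hv : v.degree < N) :
    integ ((1 - X ^ 2) * (derivative v * derivative v)) ≤ N ^ 2 * integ (v * v) := by
  obtain ⟨a, rfl⟩ := exists_legendre_expansion N v hv
  rw [integ_weighted_derivative_expansion_sq, integ_expansion_sq, Finset.mul_sum]
  refine Finset.sum_le_sum fun k hk => ?_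
  have h := integ_mul_self_nonneg (legendre k)
  refine mul_le_mul_of_nonneg_right ?_ (by positivity)
  have : (k + 1 : ℝ) ≤ N := by exact_mod_cast Finset.mem_range.1 hk
  unfold eig; nlinarith

theorem integ_derivative_legendre_sq (N : ℕ) :
    integ (derivative (legendre N) * derivative (legendre N)) = eig N := by
  have hd1 : (2 : ℝ) * (derivative (legendre N)).eval 1 = eig N := by
    have := congrArg (eval 1) (legendre_ode N)
    simp [derivative_mul, legendre_eval_one] at this
    linarith
  have hd2 : (2 : ℝ) * (derivative (legendre N)).eval (-1) = -eig N * (-1) ^ N := by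
    have := congrArg (eval (-1)) (legendre_ode N)
    simp [derivative_mul, legendre_eval_neg_one] at this
    linarith
  have hz : integ (legendre N * derivative (derivative (legendre N))) = 0 := by
    refine integ_legendre_mul ?_
    refine lt_of_le_of_lt degree_derivative_le ?_
    exact lt_of_lt_of_le (degree_derivative_lt (legendre_ne_zero N)) (degree_legendre N).le
  have h := integ_derivative (legendre N * derivative (legendre N))
  rw [derivative_mul, map_add, hz, eval_mul, eval_mul, legendre_eval_one,
    legendre_eval_neg_one] at h
  have hs : ((-1 : ℝ) ^ N) * (-1) ^ N = 1 := by rw [← mul_pow]; norm_num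
  linear_combination h + hd1 / 2 - (-1) ^ N * hd2 / 2 + eig N * hs / 2

/-- An inverse inequality for the value at the right endpoint. The functional `v ↦ v 1` on
polynomials of degree less than `N` is represented by `(L_N' + L_{N-1}') / 2`. -/
theorem eval_one_sq_le {N : ℕ} (hN : 0 < N) {v : ℝ[X]} (hv : v.degree < N) :
    v.eval 1 ^ 2 ≤ N ^ 2 * integ (v * v) := by
  obtain ⟨n, rfl⟩ : ∃ n, N = n + 1 := ⟨N - 1, by omega⟩
  have hv' : (derivative v).degree < n := by
    by_cases h0 : v = 0
    · simp [h0]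
    have h1 := degree_derivative_lt h0
    rw [degree_eq_natDegree h0] at hv h1
    have : v.natDegree < n + 1 := by exact_mod_cast hv
    exact lt_of_lt_of_le h1 (by exact_mod_cast Nat.lt_succ_iff.1 this)
  have h1 := integ_derivative (legendre (n + 1) * v)
  have h2 := integ_derivative (legendre n * v)
  rw [derivative_mul, map_add, integ_legendre_mul (hv'.trans (by exact_mod_cast n.lt_succ_self)),
    eval_mul, eval_mul, legendre_eval_one, legendre_eval_neg_one] at h1
  rw [derivative_mul, map_add, integ_legendre_mul hv',
    eval_mul, eval_mul, legendre_eval_one, legendre_eval_neg_one] at h2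
  have c1 := integ_mul_sq_le (derivative (legendre (n + 1))) v
  have c2 := integ_mul_sq_le (derivative (legendre n)) v
  rw [integ_derivative_legendre_sq] at c1 c2
  have hvv := integ_mul_self_nonneg v
  set i1 := integ (derivative (legendre (n + 1)) * v)
  set i2 := integ (derivative (legendre n) * v)
  have e : v.eval 1 = (i1 + i2) / 2 := by
    rw [pow_succ] at h1; linarith
  rw [e]
  unfold eig at c1 c2
  push_cast at c1 c2 ⊢
  nlinarith [sq_nonneg (i1 - i2)]

theorem eq_of_derivative_eq {p q : ℝ[X]} (h : derivative p = derivative q)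
    {a : ℝ} (ha : p.eval a = q.eval a) : p = q := by
  have h1 : derivative (p - q) = 0 := by rw [derivative_sub, h, sub_self]
  have h2 := eq_C_of_natDegree_eq_zero (derivative_eq_zero.1 h1)
  have h3 : (p - q).coeff 0 = 0 := by
    have := congrArg (eval a) h2
    simpa [ha] using this.symm
  rw [h3, C_0] at h2
  exact sub_eq_zero.1 h2

/-- If `z` vanishes at `±1` and `z'` is orthogonal to all polynomials of degree less than `N`,
then `z = (1 - X²) y` and `∫ z² / (1 - x²) ≤ N⁻² ∫ z'²`: the primitive gains a factor `N`. -/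
theorem exists_factor_of_orthogonal {N : ℕ} (hN : 0 < N) {z : ℝ[X]} (h1 : z.eval 1 = 0)
    (horth : ∀ v : ℝ[X], v.degree < N → integ (derivative z * v) = 0) :
    ∃ y : ℝ[X], z = (1 - X ^ 2) * y ∧
      eig N * integ ((1 - X ^ 2) * (y * y)) ≤ integ (derivative z * derivative z) := by
  obtain ⟨a, ha⟩ := exists_legendre_expansion ((derivative z).natDegree + 1) (derivative z)
    (by rw [degree_lt_iff_coeff_zero]; intro m hm; exact coeff_eq_zero_of_natDegree_lt hm)
  set M := (derivative z).natDegree + 1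
  have ha0 : ∀ k < M, k < N → a k = 0 := by
    intro k hkM hkN
    have := horth (legendre k) (by rw [degree_legendre]; exact_mod_cast hkN)
    rw [ha, integ_expansion_mul_legendre a hkM] at this
    exact (mul_eq_zero.1 this).resolve_right (integ_mul_self_pos (legendre_ne_zero k)).ne'
  set Y := ∑ k ∈ Finset.range M, C (-(a k / eig k)) * legendre k with hY
  refine ⟨derivative Y, ?_, ?_⟩
  · refine eq_of_derivative_eq ?_ (a := 1) (by simp [h1])
    rw [ha, hY, derivative_sum, Finset.mul_sum, derivative_sum]
    refine Finset.sum_congr rfl fun k hk => ?_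
    rw [derivative_C_mul, mul_left_comm, derivative_C_mul, legendre_ode, ← neg_mul, ← C_neg,
      ← mul_assoc, ← C_mul]
    by_cases hkN : k < N
    · rw [ha0 k (Finset.mem_range.1 hk) hkN]; simp
    · have := (eig_pos (lt_of_lt_of_le hN (not_lt.1 hkN))).ne'
      congr 2; field_simp
  · rw [hY, integ_weighted_derivative_expansion_sq]
    conv_rhs => rw [ha]
    rw [integ_expansion_sq, Finset.mul_sum]
    refine Finset.sum_le_sum fun k hk => ?_
    by_cases hkN : k < N
    · rw [ha0 k (Finset.mem_range.1 hk) hkN]; simp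
    · have hp := eig_pos (lt_of_lt_of_le hN (not_lt.1 hkN))
      have hle := eig_le_eig (not_lt.1 hkN)
      have hh := integ_mul_self_nonneg (legendre k)
      have : eig N * (eig k * ((-(a k / eig k)) ^ 2 * integ (legendre k * legendre k))) =
          (eig N / eig k) * (a k ^ 2 * integ (legendre k * legendre k)) := by
        field_simp
      rw [this]
      exact mul_le_of_le_one_left (by positivity) ((div_le_one hp).2 hle)

/-! ### Gauss points and Gauss quadrature -/

/-- The Gauss points: the finite set of roots of the Legendre polynomial of degree `N`. -/
def nodes (N : ℕ) : Finset ℝ := (legendre N).roots.toFinset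

theorem mem_nodes {N : ℕ} {τ : ℝ} : τ ∈ nodes N ↔ (legendre N).eval τ = 0 := by
  simp [nodes, legendre_ne_zero]

theorem card_roots_le_iterate_derivative (p : ℝ[X]) (k : ℕ) :
    p.roots.card ≤ (derivative^[k] p).roots.card + k := by
  induction k with
  | zero => simp
  | succ k ih =>
    have := card_roots_le_derivative (derivative^[k] p)
    rw [Function.iterate_succ_apply']
    omega

theorem card_roots_legendre (N : ℕ) : (legendre N).roots.card = N := by
  refine le_antisymm ((card_roots' _).trans (natDegree_legendre N).le) ?_
  have hc : (1 / (2 ^ N * (N.factorial : ℝ))) ≠ 0 := by positivity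
  rw [legendre, roots_C_mul _ hc]
  have h := card_roots_le_iterate_derivative ((X ^ 2 - 1 : ℝ[X]) ^ N) N
  have h2 : ((X ^ 2 - 1 : ℝ[X]) ^ N).roots.card = 2 * N := by
    have e : (X ^ 2 - 1 : ℝ[X]) = (X - C 1) * (X - C (-1)) := by simp; ring
    rw [roots_pow, e, roots_mul (mul_ne_zero (X_sub_C_ne_zero _) (X_sub_C_ne_zero _)),
      roots_X_sub_C, roots_X_sub_C]
    simp [mul_comm]
  omega

theorem not_sq_dvd_legendre (N : ℕ) (τ : ℝ) : ¬ (X - C τ) ^ 2 ∣ legendre N := by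
  rintro ⟨g, hg⟩
  have hg0 : g ≠ 0 := by rintro rfl; simp [legendre_ne_zero] at hg
  have hdeg : g.degree < N := by
    have := congrArg degree hg
    rw [degree_legendre, degree_mul, degree_pow, degree_X_sub_C,
      degree_eq_natDegree hg0] at this
    rw [degree_eq_natDegree hg0]
    rw [two_nsmul, one_add_one_eq_two] at this
    have h2 : N = 2 + g.natDegree := by exact_mod_cast this
    exact_mod_cast (by omega : g.natDegree < N)
  have h1 := integ_legendre_mul hdeg
  rw [hg, show (X - C τ) ^ 2 * g * g = ((X - C τ) * g) * ((X - C τ) * g) by ring] at h1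
  exact (integ_mul_self_pos (mul_ne_zero (X_sub_C_ne_zero τ) hg0)).ne' h1

theorem nodup_roots_legendre (N : ℕ) : (legendre N).roots.Nodup := by
  rw [Multiset.nodup_iff_count_le_one]
  intro τ
  rw [count_roots]
  by_contra! h
  exact not_sq_dvd_legendre N τ ((le_rootMultiplicity_iff (legendre_ne_zero N)).1 h)

theorem card_nodes (N : ℕ) : (nodes N).card = N := by
  rw [nodes, Multiset.toFinset_card_of_nodup (nodup_roots_legendre N), card_roots_legendre]

theorem exists_factor_of_mem_nodes {N : ℕ} {τ : ℝ} (h : τ ∈ nodes N) :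
    ∃ g : ℝ[X], legendre N = (X - C τ) * g ∧ g ≠ 0 ∧ g.degree < N := by
  obtain ⟨g, hg⟩ := dvd_iff_isRoot.2 (mem_nodes.1 h)
  have hg0 : g ≠ 0 := by rintro rfl; simp [legendre_ne_zero] at hg
  refine ⟨g, hg, hg0, ?_⟩
  have := congrArg degree hg
  rw [degree_legendre, degree_mul, degree_X_sub_C, degree_eq_natDegree hg0] at this
  rw [degree_eq_natDegree hg0]
  have h2 : N = 1 + g.natDegree := by exact_mod_cast this
  exact_mod_cast (by omega : g.natDegree < N)

theorem nodes_mem_Ioo {N : ℕ} {τ : ℝ} (h : τ ∈ nodes N) : τ ∈ Set.Ioo (-1 : ℝ) 1 := by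
  obtain ⟨g, hg, hg0, hdeg⟩ := exists_factor_of_mem_nodes h
  have h1 := integ_legendre_mul hdeg
  rw [hg, mul_assoc] at h1
  by_contra hτ
  rw [Set.mem_Ioo, not_and_or, not_lt, not_lt] at hτ
  have hne : (X - C τ) * (g * g) ≠ 0 := mul_ne_zero (X_sub_C_ne_zero τ) (mul_ne_zero hg0 hg0)
  rcases hτ with hτ | hτ
  · refine (integ_pos (fun x hx => ?_) hne).ne' h1
    simp only [eval_mul, eval_sub, eval_X, eval_C]
    exact mul_nonneg (by linarith [hx.1]) (mul_self_nonneg _)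
  · refine (integ_pos (p := -((X - C τ) * (g * g))) (fun x hx => ?_) (neg_ne_zero.2 hne)).ne'
      (by rw [map_neg, h1, neg_zero])
    simp only [eval_mul, eval_sub, eval_X, eval_C, eval_neg]
    have := mul_nonneg (by linarith [hx.2] : 0 ≤ τ - x) (mul_self_nonneg (eval x g))
    linarith

theorem derivative_legendre_eval_ne_zero {N : ℕ} {τ : ℝ} (h : τ ∈ nodes N) :
    (derivative (legendre N)).eval τ ≠ 0 := by
  intro h0
  obtain ⟨g, hg, -, -⟩ := exists_factor_of_mem_nodes h
  rw [hg, derivative_mul] at h0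
  simp at h0
  obtain ⟨f, hf⟩ := dvd_iff_isRoot.2 h0
  exact not_sq_dvd_legendre N τ ⟨f, by rw [hg, hf]; ring⟩

/-- The weights of Gauss quadrature. -/
def gaussWeight (N : ℕ) (τ : ℝ) : ℝ :=
  2 / ((1 - τ ^ 2) * (derivative (legendre N)).eval τ ^ 2)

theorem gaussWeight_nonneg {N : ℕ} {τ : ℝ} (h : τ ∈ nodes N) : 0 ≤ gaussWeight N τ := by
  have h1 := nodes_mem_Ioo h
  have : 0 < 1 - τ ^ 2 := by nlinarith [h1.1, h1.2]
  unfold gaussWeight; positivity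

/-- Interpolatory quadrature at the Gauss points is exact up to degree `2 N - 1`, because the
quotient by `L_N` is orthogonal to `L_N`. -/
theorem integ_eq_sum_basis {N : ℕ} {f : ℝ[X]} (hf : f.degree < (2 * N : ℕ)) :
    integ f = ∑ τ ∈ nodes N, integ (Lagrange.basis (nodes N) id τ) * f.eval τ := by
  have hL := legendre_ne_zero N
  have hdm : legendre N * (f / legendre N) + f % legendre N = f := EuclideanDomain.div_add_mod _ _
  have hr : (f % legendre N).degree < N := by
    have := EuclideanDomain.mod_lt f hL
    exact lt_of_lt_of_le this (degree_legendre N).le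
  have hq : (f / legendre N).degree < N := by
    by_cases hlt : f.degree < (legendre N).degree
    · rw [(Polynomial.div_eq_zero_iff hL).2 hlt, degree_zero]; exact WithBot.bot_lt_coe _
    · have h1 := degree_add_div hL (not_lt.1 hlt)
      have h0 : f / legendre N ≠ 0 := fun h => hlt ((Polynomial.div_eq_zero_iff hL).1 h)
      have hf0 : f ≠ 0 := by
        rintro rfl; simp at h0
      rw [degree_legendre, degree_eq_natDegree h0, degree_eq_natDegree hf0] at h1
      rw [degree_eq_natDegree hf0] at hf
      rw [degree_eq_natDegree h0]
      have h2 : N + (f / legendre N).natDegree = f.natDegree := by exact_mod_cast h1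
      have h3 : f.natDegree < 2 * N := by exact_mod_cast hf
      exact_mod_cast (by omega : (f / legendre N).natDegree < N)
  have hi : integ f = integ (f % legendre N) := by
    conv_lhs => rw [← hdm]
    rw [map_add, integ_legendre_mul hq, zero_add]
  have hev : ∀ τ ∈ nodes N, (f % legendre N).eval τ = f.eval τ := by
    intro τ hτ
    conv_rhs => rw [← hdm]
    simp [mem_nodes.1 hτ]
  have hint := Lagrange.eq_interpolate (s := nodes N) (v := id) (f := f % legendre N)
    (Set.injOn_id _) (by rw [card_nodes]; exact hr)
  rw [hi, hint, Lagrange.interpolate_apply, map_sum]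
  refine Finset.sum_congr rfl fun τ hτ => ?_
  rw [integ_C_mul, mul_comm, id, hev τ hτ]

theorem integ_basis {N : ℕ} {τ : ℝ} (hτ : τ ∈ nodes N) :
    integ (Lagrange.basis (nodes N) id τ) = gaussWeight N τ := by
  obtain ⟨g, hg, hg0, hdeg⟩ := exists_factor_of_mem_nodes hτ
  have hgt : g.eval τ = (derivative (legendre N)).eval τ := by
    rw [hg, derivative_mul]; simp
  have hgz : ∀ σ ∈ nodes N, σ ≠ τ → g.eval σ = 0 := by
    intro σ hσ hne
    have := mem_nodes.1 hσ
    rw [hg] at this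
    simp only [eval_mul, eval_sub, eval_X, eval_C] at this
    exact (mul_eq_zero.1 this).resolve_left (sub_ne_zero.2 hne)
  have hL' : (derivative (legendre N)).degree < N :=
    lt_of_lt_of_le (degree_derivative_lt (legendre_ne_zero N)) (degree_legendre N).le
  have hL0 : derivative (legendre N) ≠ 0 := fun h => by
    simpa [h] using derivative_legendre_eval_ne_zero hτ
  have hd : (g * derivative (legendre N)).degree < (2 * N : ℕ) := by
    rw [degree_mul]
    rw [degree_eq_natDegree hg0] at hdeg ⊢
    rw [degree_eq_natDegree hL0] at hL' ⊢
    have h1 : g.natDegree < N := by exact_mod_cast hdeg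
    have h2 : (derivative (legendre N)).natDegree < N := by exact_mod_cast hL'
    exact_mod_cast (by omega : g.natDegree + (derivative (legendre N)).natDegree < 2 * N)
  have hq := integ_eq_sum_basis hd
  rw [Finset.sum_eq_single τ] at hq
  rotate_left
  · intro σ hσ hne
    rw [eval_mul, hgz σ hσ hne]; ring
  · intro h; exact absurd hτ h
  have hp := integ_derivative (g * legendre N)
  have hz : integ (derivative g * legendre N) = 0 := by
    rw [mul_comm]
    exact integ_legendre_mul (lt_of_le_of_lt degree_derivative_le hdeg)
  rw [derivative_mul, map_add, hz, hq, eval_mul, eval_mul, eval_mul, hgt] at hp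
  have h1 := legendre_eval_one N
  have h2 := legendre_eval_neg_one N
  have h3 := h1
  have h4 := h2
  rw [hg] at h3 h4
  simp only [eval_mul, eval_sub, eval_X, eval_C] at h3 h4
  have hI := nodes_mem_Ioo hτ
  have hne := derivative_legendre_eval_ne_zero hτ
  have a1 : 0 < 1 - τ := by linarith [hI.2]
  have a2 : 0 < 1 + τ := by linarith [hI.1]
  have hs : ((-1 : ℝ) ^ N) * (-1) ^ N = 1 := by rw [← mul_pow]; norm_num
  rw [h1, h2] at hp
  rw [gaussWeight, eq_div_iff (by rw [show 1 - τ ^ 2 = (1 - τ) * (1 + τ) by ring]; positivity)]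
  set W := integ (Lagrange.basis (nodes N) id τ)
  set d := (derivative (legendre N)).eval τ
  set s : ℝ := (-1) ^ N
  linear_combination (1 - τ ^ 2) * hp + (1 + τ) * h3 + (1 - τ) * s * h4 + (1 - τ) * hs

/-- Gauss quadrature. -/
theorem integ_eq_sum_gaussWeight {N : ℕ} {f : ℝ[X]} (hf : f.degree < (2 * N : ℕ)) :
    integ f = ∑ τ ∈ nodes N, gaussWeight N τ * f.eval τ := by
  rw [integ_eq_sum_basis hf]
  exact Finset.sum_congr rfl fun τ hτ => by rw [integ_basis hτ]

/-! ### Lower bounds for the amplitude of a Legendre polynomial -/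

/-- The polynomial `(1 - X²) L_N'`. -/
def legendreFlux (N : ℕ) : ℝ[X] := (1 - X ^ 2) * derivative (legendre N)

/-- A squared amplitude of `L_N`. At the Gauss points it equals the square of `(1 - x²) L_N'`. The
summand `1` keeps it away from `0` up to the endpoints. -/
def amplitude (N : ℕ) : ℝ[X] :=
  legendreFlux N ^ 2 + (C (eig N) * (1 - X ^ 2) + 1) * legendre N ^ 2

/-- The Sonin-type energy of `L_N`: in the variable `φ = arccos x` and for
`y = (sin φ)^(1/2) L_N (cos φ)`, which solves `y'' + q y = 0`, it is `sin φ (y'² + q y²)`. -/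
def energy (N : ℕ) : ℝ[X] :=
  legendreFlux N ^ 2 - X * legendre N * legendreFlux N +
    (C (eig N) * (1 - X ^ 2) + C (1 / 2)) * legendre N ^ 2

theorem derivative_legendreFlux (N : ℕ) :
    derivative (legendreFlux N) = -(C (eig N) * legendre N) := legendre_ode N

theorem energy_ode (N : ℕ) :
    (1 - X ^ 2) * derivative (energy N) = -X * (energy N - C (1 / 2) * legendre N ^ 2) := by
  have h : (1 - X ^ 2) * derivative (legendre N) = legendreFlux N := rfl
  have h2 : (2 : ℝ[X]) * C (1 / 2) = 1 := by rw [← map_ofNat C 2, ← C_mul]; norm_num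
  simp only [energy, derivative_add, derivative_sub, derivative_mul, derivative_pow,
    derivative_legendreFlux, derivative_X, derivative_C, derivative_one]
  simp only [Nat.cast_ofNat, map_ofNat, Nat.add_one_sub_one, pow_one]
  linear_combination (2 * (C (eig N) * (1 - X ^ 2) + C (1 / 2)) * legendre N -
    X * legendreFlux N) * h + legendreFlux N * legendre N * h2

theorem energy_eval_nonneg (N : ℕ) {x : ℝ} (hx : x ∈ Set.Icc (-1 : ℝ) 1) :
    0 ≤ (energy N).eval x := by
  have h := eig_nonneg N
  have h1 : 0 ≤ 1 - x ^ 2 := by nlinarith [hx.1, hx.2]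
  simp only [energy, eval_add, eval_sub, eval_mul, eval_pow, eval_X, eval_C, eval_one]
  set L := (legendre N).eval x
  set A := (legendreFlux N).eval x
  nlinarith [sq_nonneg (A - x * L / 2), mul_nonneg (mul_nonneg h h1) (sq_nonneg L),
    mul_nonneg h1 (sq_nonneg L), sq_nonneg L]

/-- `energy² / (1 - x²)` has its minimum at the origin. -/
theorem energy_sq_ge (N : ℕ) {x : ℝ} (hx : x ∈ Set.Icc (-1 : ℝ) 1) :
    (1 - x ^ 2) * (energy N).eval 0 ^ 2 ≤ (energy N).eval x ^ 2 := by
  have hpos : ∀ y ∈ Set.Ioo (-1 : ℝ) 1, 0 < 1 - y ^ 2 := fun y hy => by nlinarith [hy.1, hy.2]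
  have hder : ∀ y ∈ Set.Ioo (-1 : ℝ) 1,
      HasDerivAt (fun y => (energy N).eval y ^ 2 / (1 - y ^ 2))
        (y * ((energy N).eval y * (legendre N).eval y ^ 2 / (1 - y ^ 2) ^ 2)) y := by
    intro y hy
    have h0 := hpos y hy
    have h1 := ((energy N).hasDerivAt y).pow 2
    have h2 := ((hasDerivAt_id y).pow 2).const_sub 1
    have h3 : HasDerivAt (fun y => (energy N).eval y ^ 2 / (1 - y ^ 2)) _ y := h1.div h2 h0.ne'
    refine h3.congr_deriv ?_
    have h4 := congrArg (eval y) (energy_ode N)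
    simp only [eval_mul, eval_sub, eval_one, eval_pow, eval_X, eval_C, eval_neg] at h4
    simp
    field_simp
    linear_combination (2 * (energy N).eval y) * h4
  have hnn : ∀ y ∈ Set.Ioo (-1 : ℝ) 1,
      0 ≤ (energy N).eval y * (legendre N).eval y ^ 2 / (1 - y ^ 2) ^ 2 := by
    intro y hy
    have := energy_eval_nonneg N (Set.Ioo_subset_Icc_self hy)
    positivity
  by_cases hx' : x ∈ Set.Ioo (-1 : ℝ) 1
  · have key : (energy N).eval 0 ^ 2 / (1 - 0 ^ 2) ≤ (energy N).eval x ^ 2 / (1 - x ^ 2) := by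
      rcases le_total 0 x with h | h
      · refine monotoneOn_of_hasDerivWithinAt_nonneg (D := Set.Icc 0 x) (convex_Icc 0 x)
          (f := fun y => (energy N).eval y ^ 2 / (1 - y ^ 2))
          (f' := fun y => y * ((energy N).eval y * (legendre N).eval y ^ 2 / (1 - y ^ 2) ^ 2))
          (fun y hy =>
            (hder y ⟨by linarith [hy.1], by linarith [hy.2, hx'.2]⟩).continuousAt.continuousWithinAt)
          (fun y hy => ?_) (fun y hy => ?_) (Set.left_mem_Icc.2 h) (Set.right_mem_Icc.2 h) h
        · rw [interior_Icc] at hy ⊢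
          exact (hder y ⟨by linarith [hy.1], by linarith [hy.2, hx'.2]⟩).hasDerivWithinAt
        · rw [interior_Icc] at hy
          exact mul_nonneg hy.1.le (hnn y ⟨by linarith [hy.1], by linarith [hy.2, hx'.2]⟩)
      · refine antitoneOn_of_hasDerivWithinAt_nonpos (D := Set.Icc x 0) (convex_Icc x 0)
          (f := fun y => (energy N).eval y ^ 2 / (1 - y ^ 2))
          (f' := fun y => y * ((energy N).eval y * (legendre N).eval y ^ 2 / (1 - y ^ 2) ^ 2))
          (fun y hy =>
            (hder y ⟨by linarith [hy.1, hx'.1], by linarith [hy.2]⟩).continuousAt.continuousWithinAt)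
          (fun y hy => ?_) (fun y hy => ?_) (Set.left_mem_Icc.2 h) (Set.right_mem_Icc.2 h) h
        · rw [interior_Icc] at hy ⊢
          exact (hder y ⟨by linarith [hy.1, hx'.1], by linarith [hy.2]⟩).hasDerivWithinAt
        · rw [interior_Icc] at hy
          exact mul_nonpos_of_nonpos_of_nonneg hy.2.le
            (hnn y ⟨by linarith [hy.1, hx'.1], by linarith [hy.2]⟩)
    have h0 := hpos x hx'
    rw [le_div_iff₀ h0] at key
    simp at key
    linarith
  · have : x ^ 2 = 1 := by
      rw [Set.mem_Ioo, not_and_or, not_lt, not_lt] at hx'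
      rcases hx' with h | h
      · rw [le_antisymm h hx.1]; norm_num
      · rw [le_antisymm hx.2 h]; norm_num
    rw [this]; nlinarith [sq_nonneg ((energy N).eval x)]

theorem four_mul_add_one_mul_centralBinom_sq (m : ℕ) :
    16 ^ m ≤ (4 * m + 1) * m.centralBinom ^ 2 := by
  induction m with
  | zero => simp
  | succ m ih =>
    have h := Nat.succ_mul_centralBinom_succ m
    set c := m.centralBinom
    set d := (m + 1).centralBinom
    have h2 : (m + 1) ^ 2 * d ^ 2 = 4 * (2 * m + 1) ^ 2 * c ^ 2 := by
      rw [← mul_pow, h]; ring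
    have hp : 0 < (m + 1) ^ 2 * (4 * m + 1) := by positivity
    refine le_of_mul_le_mul_left ?_ hp
    calc (m + 1) ^ 2 * (4 * m + 1) * 16 ^ (m + 1)
        = 4 * (4 * (m + 1) ^ 2 * (4 * m + 1)) * 16 ^ m := by ring
      _ ≤ 4 * ((2 * m + 1) ^ 2 * (4 * m + 5)) * ((4 * m + 1) * c ^ 2) := by
          gcongr 4 * ?_ * ?_
          nlinarith
      _ = (4 * m + 5) * (4 * m + 1) * (4 * (2 * m + 1) ^ 2 * c ^ 2) := by ring
      _ = (4 * m + 5) * (4 * m + 1) * ((m + 1) ^ 2 * d ^ 2) := by rw [h2]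
      _ = (m + 1) ^ 2 * (4 * m + 1) * ((4 * (m + 1) + 1) * d ^ 2) := by ring

theorem coeff_X_sq_sub_one_pow (n k : ℕ) :
    ((X ^ 2 - 1 : ℝ[X]) ^ n).coeff (k * 2) = (-1) ^ (n - k) * n.choose k := by
  have e : (X ^ 2 - 1 : ℝ[X]) ^ n = expand ℝ 2 ((X - C 1) ^ n) := by simp
  rw [e, coeff_expand_mul (by norm_num), sub_eq_add_neg, ← C_neg, coeff_X_add_C_pow]

theorem one_le_legendre_eval_zero_sq (m : ℕ) :
    1 ≤ (4 * m + 1) * (legendre (2 * m)).eval 0 ^ 2 := by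
  have h1 : (legendre (2 * m)).eval 0 ^ 2 = (m.centralBinom : ℝ) ^ 2 / 16 ^ m := by
    rw [legendre, eval_mul, eval_C, ← coeff_zero_eq_eval_zero, coeff_iterate_derivative, zero_add,
      Nat.descFactorial_self, mul_comm 2 m, coeff_X_sq_sub_one_pow, Nat.centralBinom, mul_comm 2 m]
    have hf : ((m * 2).factorial : ℝ) ≠ 0 := by exact_mod_cast (m * 2).factorial_ne_zero
    rw [nsmul_eq_mul, show (16 : ℝ) ^ m = (2 ^ (m * 2)) ^ 2 by
      rw [← pow_mul, mul_assoc, mul_comm, pow_mul]; norm_num]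
    rw [mul_pow, mul_pow, mul_pow, ← pow_mul, mul_comm (m * 2 - m) 2, pow_mul]
    field_simp
    norm_num
  have h2 : ((16 : ℝ) ^ m) ≤ (4 * m + 1) * (m.centralBinom : ℝ) ^ 2 := by
    exact_mod_cast four_mul_add_one_mul_centralBinom_sq m
  rw [h1, ← mul_div_assoc, le_div_iff₀ (by positivity), one_mul]
  exact h2

theorem sq_le_derivative_legendre_eval_zero_sq (m : ℕ) :
    (2 * m + 2 : ℝ) ^ 2 ≤ (4 * m + 5) * (derivative (legendre (2 * m + 1))).eval 0 ^ 2 := by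
  have hcb : (2 * (2 * m + 1).choose (m + 1) : ℕ) = (m + 1).centralBinom := by
    rw [Nat.centralBinom, show 2 * (m + 1) = 2 * m + 1 + 1 by ring,
      Nat.choose_succ_succ' (2 * m + 1) m,
      Nat.choose_symm_half m]
    ring
  have hcb' : (2 : ℝ) * (2 * m + 1).choose (m + 1) = (m + 1).centralBinom := by
    exact_mod_cast hcb
  have h1 : (derivative (legendre (2 * m + 1))).eval 0 ^ 2 =
      (2 * m + 2 : ℝ) ^ 2 * ((m + 1).centralBinom : ℝ) ^ 2 / 16 ^ (m + 1) := by
    rw [legendre, derivative_C_mul, eval_mul, eval_C, ← coeff_zero_eq_eval_zero,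
      ← Function.iterate_succ_apply' derivative, coeff_iterate_derivative, zero_add,
      Nat.descFactorial_self, show (2 * m + 1).succ = (m + 1) * 2 by ring_nf; simp; ring,
      coeff_X_sq_sub_one_pow,
      ← hcb']
    have hf : ((2 * m + 1).factorial : ℝ) ≠ 0 := by exact_mod_cast (2 * m + 1).factorial_ne_zero
    rw [show (m + 1) * 2 = (2 * m + 1) + 1 by ring, Nat.factorial_succ (2 * m + 1)]
    rw [nsmul_eq_mul, show (16 : ℝ) ^ (m + 1) = (2 ^ (2 * m + 1)) ^ 2 * 4 by
      rw [← pow_mul, show (16 : ℝ) = 2 ^ 4 by norm_num, ← pow_mul]; ring]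
    rw [mul_pow, mul_pow, mul_pow, ← pow_mul, mul_comm (2 * m + 1 - (m + 1)) 2, pow_mul]
    rw [Nat.cast_mul]
    generalize ((2 * m + 1).factorial : ℝ) = f at hf ⊢
    push_cast
    field_simp
    norm_num
    ring
  have h2 : ((16 : ℝ) ^ (m + 1)) ≤ (4 * (m + 1 : ℕ) + 1) * ((m + 1).centralBinom : ℝ) ^ 2 := by
    exact_mod_cast four_mul_add_one_mul_centralBinom_sq (m + 1)
  rw [h1, ← mul_div_assoc, le_div_iff₀ (by positivity)]
  push_cast at h2
  nlinarith [mul_le_mul_of_nonneg_left h2 (sq_nonneg (2 * m + 2 : ℝ))]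

/-- The values of `L_N` and `L_N'` at the origin are central binomial coefficients, up to powers
of `2`. -/
theorem energy_eval_zero_ge (N : ℕ) : (N : ℝ) / 3 ≤ (energy N).eval 0 := by
  have e : (energy N).eval 0 =
      (derivative (legendre N)).eval 0 ^ 2 + (eig N + 1 / 2) * (legendre N).eval 0 ^ 2 := by
    simp [energy, legendreFlux]
  rw [e]
  unfold eig
  obtain ⟨m, rfl | rfl⟩ := Nat.even_or_odd' N
  · have h := one_le_legendre_eval_zero_sq m
    set d := (derivative (legendre (2 * m))).eval 0
    set l := (legendre (2 * m)).eval 0 ^ 2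
    push_cast
    have hm : (0 : ℝ) ≤ m := by positivity
    have hl : 0 ≤ l := sq_nonneg _
    nlinarith [sq_nonneg d, mul_nonneg hm hl]
  · have h := sq_le_derivative_legendre_eval_zero_sq m
    set d := (derivative (legendre (2 * m + 1))).eval 0 ^ 2
    set l := (legendre (2 * m + 1)).eval 0
    push_cast
    have hm : (0 : ℝ) ≤ m := by positivity
    have h2 : (2 * m + 1 : ℝ) / 3 ≤ d := by
      refine le_of_mul_le_mul_left ?_ (by positivity : (0 : ℝ) < 4 * m + 5)
      nlinarith
    have : 0 ≤ ((2 * m + 1 : ℝ) * (2 * m + 1 + 1) + 1 / 2) * l ^ 2 := by positivity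
    linarith

theorem energy_le_amplitude (N : ℕ) {x : ℝ} (hx : x ∈ Set.Icc (-1 : ℝ) 1) :
    (energy N).eval x ≤ 3 / 2 * (amplitude N).eval x := by
  have h := eig_nonneg N
  have h1 : 0 ≤ 1 - x ^ 2 := by nlinarith [hx.1, hx.2]
  simp only [energy, amplitude, eval_add, eval_sub, eval_mul, eval_pow, eval_X, eval_C, eval_one]
  set L := (legendre N).eval x
  set A := (legendreFlux N).eval x
  nlinarith [sq_nonneg (A + x * L), mul_nonneg (mul_nonneg h h1) (sq_nonneg L),
    mul_nonneg h1 (sq_nonneg L), sq_nonneg L]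

/-- `|L_N| ≤ 1` on `[-1, 1]`, since `L_N² + (1 - x²) L_N'² / (N (N + 1))` increases with `|x|`. -/
theorem abs_legendre_le_one {N : ℕ} (hN : 0 < N) {x : ℝ} (hx : x ∈ Set.Icc (-1 : ℝ) 1) :
    |(legendre N).eval x| ≤ 1 := by
  have he := eig_pos hN
  set P : ℝ[X] := C (eig N) * legendre N ^ 2 +
    (1 - X ^ 2) * derivative (legendre N) ^ 2 with hP
  have hder : derivative P = X * (2 * derivative (legendre N) ^ 2) := by
    have h := legendre_ode N
    rw [derivative_mul] at h
    simp only [hP, derivative_add, derivative_mul, derivative_pow, derivative_C] at h ⊢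
    simp only [derivative_sub, derivative_one, derivative_X_pow, Nat.cast_ofNat, map_ofNat,
      Nat.add_one_sub_one, pow_one] at h ⊢
    linear_combination (2 * derivative (legendre N)) * h
  have hle : P.eval x ≤ eig N := by
    rcases le_total 0 x with h | h
    · have := monotoneOn_of_hasDerivWithinAt_nonneg (D := Set.Icc 0 1) (convex_Icc 0 1)
        (f := fun y => P.eval y) (f' := fun y => (derivative P).eval y)
        P.continuous.continuousOn (fun y _ => (P.hasDerivAt y).hasDerivWithinAt)
        (fun y hy => by
          rw [interior_Icc] at hy
          simp only [hder, eval_mul, eval_X, eval_pow, eval_ofNat]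
          have := hy.1; positivity)
        ⟨h, hx.2⟩ (Set.right_mem_Icc.2 zero_le_one) hx.2
      simpa [hP, legendre_eval_one] using this
    · have := antitoneOn_of_hasDerivWithinAt_nonpos (D := Set.Icc (-1) 0) (convex_Icc (-1) 0)
        (f := fun y => P.eval y) (f' := fun y => (derivative P).eval y)
        P.continuous.continuousOn (fun y _ => (P.hasDerivAt y).hasDerivWithinAt)
        (fun y hy => by
          rw [interior_Icc] at hy
          simp only [hder, eval_mul, eval_X, eval_pow, eval_ofNat]
          exact mul_nonpos_of_nonpos_of_nonneg hy.2.le (by positivity))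
        (Set.left_mem_Icc.2 (by norm_num)) ⟨hx.1, h⟩ hx.1
      have h1 : ((-1 : ℝ) ^ N) ^ 2 = 1 := by rw [← pow_mul, mul_comm, pow_mul]; norm_num
      simpa [hP, legendre_eval_neg_one, h1] using this
  have h1 : 0 ≤ 1 - x ^ 2 := by nlinarith [hx.1, hx.2]
  simp only [hP, eval_add, eval_mul, eval_C, eval_pow, eval_sub, eval_one, eval_X] at hle
  rw [← sq_le_one_iff_abs_le_one]
  have h2 := mul_nonneg h1 (sq_nonneg ((derivative (legendre N)).eval x))
  have h3 : eig N * (legendre N).eval x ^ 2 ≤ eig N * 1 := by linarith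
  exact le_of_mul_le_mul_left h3 he

/-- Near the endpoints `|L_N|` stays close to `1`. -/
theorem legendre_sq_ge_of_near_end {N : ℕ} (hN : 0 < N) {x : ℝ} (hx : x ∈ Set.Icc (-1 : ℝ) 1)
    (ht : eig N * (1 - x ^ 2) ≤ 1 / 2) : 1 / 4 ≤ (legendre N).eval x ^ 2 := by
  have he := eig_pos hN
  have hA : ∀ y, HasDerivAt (fun y => (legendreFlux N).eval y)
      (-(eig N * (legendre N).eval y)) y := by
    intro y
    have := (legendreFlux N).hasDerivAt y
    rw [derivative_legendreFlux] at this
    simpa using this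
  have hAe : ∀ y, (legendreFlux N).eval y = (1 - y ^ 2) * (derivative (legendre N)).eval y := by
    intro y; simp [legendreFlux]
  rcases le_total 0 x with h | h
  · rcases hx.2.eq_or_lt with rfl | hx1
    · rw [legendre_eval_one]; norm_num
    obtain ⟨y, hy, hy'⟩ := exists_hasDerivAt_eq_slope (fun y => (legendre N).eval y) _ hx1
      (legendre N).continuous.continuousOn (fun y _ => (legendre N).hasDerivAt y)
    obtain ⟨w, hw, hw'⟩ := exists_hasDerivAt_eq_slope (fun y => (legendreFlux N).eval y) _ hy.2
      (legendreFlux N).continuous.continuousOn (fun y _ => hA y)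
    have hLw := abs_legendre_le_one hN (x := w) ⟨by linarith [hy.1, hw.1], hw.2.le⟩
    rw [hAe, hAe] at hw'
    have p1 : 0 < 1 - x := by linarith
    have p2 : 0 < 1 - y := by linarith [hy.2]
    have p3 : 0 < 1 + y := by linarith [hy.1]
    rw [eq_div_iff p2.ne'] at hw'
    rw [legendre_eval_one, eq_div_iff p1.ne'] at hy'
    have e1 : eig N * (legendre N).eval w = (1 + y) * (derivative (legendre N)).eval y := by
      refine mul_right_cancel₀ p2.ne' ?_
      linear_combination -hw'
    have hd : (derivative (legendre N)).eval y ≤ eig N := by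
      by_contra! hc
      have : eig N * (legendre N).eval w ≤ eig N * 1 :=
        mul_le_mul_of_nonneg_left (abs_le.1 hLw).2 he.le
      nlinarith [hy.1]
    have h3 : 1 - (legendre N).eval x ≤ eig N * (1 - x) := by
      rw [← hy']; exact mul_le_mul_of_nonneg_right hd p1.le
    have h4 : eig N * (1 - x) ≤ eig N * (1 - x ^ 2) := by
      refine mul_le_mul_of_nonneg_left ?_ he.le
      nlinarith
    have : 1 / 2 ≤ (legendre N).eval x := by linarith
    nlinarith
  · rcases hx.1.eq_or_lt with rfl | hx1
    · rw [legendre_eval_neg_one, ← pow_mul, mul_comm, pow_mul]; norm_num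
    obtain ⟨y, hy, hy'⟩ := exists_hasDerivAt_eq_slope (fun y => (legendre N).eval y) _ hx1
      (legendre N).continuous.continuousOn (fun y _ => (legendre N).hasDerivAt y)
    obtain ⟨w, hw, hw'⟩ := exists_hasDerivAt_eq_slope (fun y => (legendreFlux N).eval y) _ hy.1
      (legendreFlux N).continuous.continuousOn (fun y _ => hA y)
    have hLw := abs_legendre_le_one hN (x := w) ⟨hw.1.le, by linarith [hy.2, hw.2]⟩
    rw [hAe, hAe] at hw'
    have p1 : 0 < x - -1 := by linarith
    have p2 : 0 < y - -1 := by linarith [hy.1]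
    have p3 : 0 < 1 - y := by linarith [hy.2]
    rw [eq_div_iff p2.ne'] at hw'
    rw [legendre_eval_neg_one, eq_div_iff p1.ne'] at hy'
    have e1 : -(eig N * (legendre N).eval w) = (1 - y) * (derivative (legendre N)).eval y := by
      refine mul_right_cancel₀ p2.ne' ?_
      linear_combination hw'
    have hd : |(derivative (legendre N)).eval y| ≤ eig N := by
      have h5 : |eig N * (legendre N).eval w| ≤ eig N * 1 := by
        rw [abs_mul, abs_of_pos he]
        exact mul_le_mul_of_nonneg_left hLw he.le
      rw [← abs_neg, e1, abs_mul, abs_of_pos p3] at h5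
      nlinarith [hy.2, abs_nonneg ((derivative (legendre N)).eval y)]
    have h3 : |(legendre N).eval x - (-1) ^ N| ≤ eig N * (x - -1) := by
      rw [← hy', abs_mul, abs_of_pos p1]; exact mul_le_mul_of_nonneg_right hd p1.le
    have h4 : eig N * (x - -1) ≤ eig N * (1 - x ^ 2) := by
      refine mul_le_mul_of_nonneg_left ?_ he.le
      nlinarith
    have h6 : |(legendre N).eval x - (-1) ^ N| ≤ 1 / 2 := by linarith
    rcases neg_one_pow_eq_or ℝ N with h7 | h7 <;> rw [h7, abs_le] at h6 <;> nlinarith [h6.1, h6.2]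

/-- Away from the endpoints this comes from the lower bound of `energy`; within a distance of order
`N⁻²` of them it comes from the size of `L_N` itself. -/
theorem amplitude_sq_ge {N : ℕ} (hN : 0 < N) {x : ℝ} (hx : x ∈ Set.Icc (-1 : ℝ) 1) :
    eig N * (1 - x ^ 2) + 1 ≤ 144 * (amplitude N).eval x ^ 2 := by
  have he := eig_nonneg N
  have h1 : 0 ≤ 1 - x ^ 2 := by nlinarith [hx.1, hx.2]
  have hN1 : (1 : ℝ) ≤ N := by exact_mod_cast hN
  rcases le_total (eig N * (1 - x ^ 2)) (1 / 2) with ht | ht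
  · have h2 := legendre_sq_ge_of_near_end hN hx ht
    have h3 : 1 / 4 ≤ (amplitude N).eval x := by
      simp only [amplitude, eval_add, eval_sub, eval_mul, eval_pow, eval_X, eval_C, eval_one]
      nlinarith [mul_nonneg (mul_nonneg he h1) (sq_nonneg ((legendre N).eval x)),
        sq_nonneg ((legendreFlux N).eval x)]
    nlinarith
  · have h2 := energy_sq_ge N hx
    have h3 := energy_eval_zero_ge N
    have h4 := energy_le_amplitude N hx
    have h5 := energy_eval_nonneg N hx
    have h6 : (energy N).eval x ^ 2 ≤ (3 / 2 * (amplitude N).eval x) ^ 2 := by gcongr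
    have h7 : (N / 3 : ℝ) ^ 2 ≤ (energy N).eval 0 ^ 2 := by gcongr
    have h8 : (1 - x ^ 2) * (N / 3 : ℝ) ^ 2 ≤ (1 - x ^ 2) * (energy N).eval 0 ^ 2 :=
      mul_le_mul_of_nonneg_left h7 h1
    have h9 : eig N * (1 - x ^ 2) ≤ (2 * N ^ 2) * (1 - x ^ 2) := by
      refine mul_le_mul_of_nonneg_right ?_ h1
      unfold eig; nlinarith
    nlinarith

theorem amplitude_pos {N : ℕ} (hN : 0 < N) {x : ℝ} (hx : x ∈ Set.Icc (-1 : ℝ) 1) :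
    0 < (amplitude N).eval x := by
  have he := eig_nonneg N
  have h1 : 0 ≤ 1 - x ^ 2 := by nlinarith [hx.1, hx.2]
  have h2 := amplitude_sq_ge hN hx
  have h3 : 0 ≤ (amplitude N).eval x := by
    simp only [amplitude, eval_add, eval_sub, eval_mul, eval_pow, eval_X, eval_C, eval_one]
    positivity
  refine lt_of_le_of_ne h3 fun h => ?_
  rw [← h] at h2
  nlinarith [mul_nonneg he h1]

/-! ### A discrete Sobolev inequality at the Gauss points -/

theorem derivative_amplitude (N : ℕ) :
    (1 - X ^ 2) * derivative (amplitude N) =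
      -(2 * X * (C (eig N) * (1 - X ^ 2)) * legendre N ^ 2) +
        2 * (legendre N * legendreFlux N) := by
  have h : (1 - X ^ 2) * derivative (legendre N) = legendreFlux N := rfl
  simp only [amplitude, derivative_add, derivative_sub, derivative_mul, derivative_pow,
    derivative_legendreFlux, derivative_X, derivative_C, derivative_one]
  simp only [Nat.cast_ofNat, map_ofNat, Nat.add_one_sub_one, pow_one]
  linear_combination (2 * (C (eig N) * (1 - X ^ 2) + 1) * legendre N) * h

/-- The pointwise estimate behind the discrete Sobolev inequality. In the notation
`A = legendreFlux`, `L = legendre`, `D = amplitude`, `t = N (N + 1) (1 - x²)`, the derivative of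
`z² A² / D²` for `z = (1 - x²) y` is `2 z z' A² / D² + z² (-2 λ A L / D² - 2 A² D' / D³)`. -/
theorem neg_two_mul_le {t w x A L D D' y z' lam : ℝ} (hlam : 0 < lam) (hw : 0 ≤ w)
    (ht : t = lam * w) (hx : |x| ≤ 1)
    (hD : D = A ^ 2 + (t + 1) * L ^ 2) (hDpos : 0 < D) (hDt : t + 1 ≤ 144 * D ^ 2)
    (hD' : w * D' = -(2 * x * t * L ^ 2) + 2 * (L * A)) :
    -(2 * (w * y) * z' * (A ^ 2 / D ^ 2) +
      (w * y) ^ 2 * (-(2 * lam * A * L) / D ^ 2 - 2 * A ^ 2 * D' / D ^ 3)) ≤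
      96 * (w * y ^ 2) + 12 / lam * z' ^ 2 := by
  have ht0 : 0 ≤ t := by rw [ht]; positivity
  obtain ⟨s, hs, hs2⟩ : ∃ s : ℝ, 1 ≤ s ∧ s ^ 2 = t + 1 :=
    ⟨√(t + 1), by rw [Real.one_le_sqrt]; linarith, Real.sq_sqrt (by linarith)⟩
  have hsD : s ≤ 12 * D := by
    refine le_of_sq_le_sq (a := s) ?_ (by positivity)
    nlinarith
  have hA : A ^ 2 ≤ D := by rw [hD]; nlinarith [mul_nonneg (by linarith : 0 ≤ t + 1) (sq_nonneg L)]
  have htL : t * L ^ 2 ≤ D := by rw [hD]; nlinarith [sq_nonneg A, sq_nonneg L]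
  have hAL : 2 * s * |A * L| ≤ D := by
    rw [hD, ← hs2, abs_mul]
    nlinarith [sq_nonneg (|A| - s * |L|), sq_abs A, sq_abs L]
  have hAL0 := abs_nonneg (A * L)
  -- the first summand is controlled because `A² ≤ D` and `√(t + 1) ≤ 12 D`
  have b1 : |2 * (w * y) * z' * (A ^ 2 / D ^ 2)| ≤ 12 * (w * y ^ 2) + 12 / lam * z' ^ 2 := by
    have hr : A ^ 2 / D ^ 2 ≤ 12 / s := by
      rw [div_le_div_iff₀ (by positivity) (by linarith)]
      nlinarith
    have hr0 : 0 ≤ A ^ 2 / D ^ 2 := by positivity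
    rw [abs_mul, abs_of_nonneg hr0]
    refine (mul_le_mul_of_nonneg_left hr (abs_nonneg _)).trans ?_
    rw [mul_div_assoc', div_le_iff₀ (by linarith)]
    have e : |2 * (w * y) * z'| = 2 * w * (|y| * |z'|) := by
      rw [abs_mul, abs_mul, abs_mul, abs_of_nonneg hw, abs_two]; ring
    rw [e]
    have hws : lam * w ≤ s ^ 2 := by rw [hs2, ← ht]; linarith
    have e1 : (12 * (w * y ^ 2) + 12 / lam * z' ^ 2) * s =
        12 / lam * (lam * w * s * |y| ^ 2 + s * |z'| ^ 2) := by
      rw [sq_abs, sq_abs]; field_simp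
    have e2 : 2 * w * (|y| * |z'|) * 12 = 12 / lam * (2 * (lam * w) * (|y| * |z'|)) := by
      field_simp
    rw [e1, e2]
    refine mul_le_mul_of_nonneg_left ?_ (by positivity)
    have hs0 : 0 < s := by linarith
    have hu : 0 ≤ lam * w := by positivity
    refine le_of_mul_le_mul_left ?_ hs0
    nlinarith [mul_nonneg hu (sq_nonneg (s * |y| - |z'|)), mul_nonneg (sub_nonneg.2 hws)
      (sq_nonneg |z'|)]
  have b2 : |w * (-(2 * lam * A * L) / D ^ 2)| ≤ 12 := by
    have e : w * (-(2 * lam * A * L) / D ^ 2) = -(2 * t * (A * L)) / D ^ 2 := by rw [ht]; ring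
    rw [e, abs_div, abs_neg, abs_mul, abs_of_nonneg (by linarith : 0 ≤ 2 * t),
      abs_of_pos (by positivity : 0 < D ^ 2), div_le_iff₀ (by positivity)]
    have h1 : t * (2 * |A * L|) ≤ s * D := by
      refine (mul_le_mul_of_nonneg_right (by linarith : t ≤ s * s) (by positivity)).trans ?_
      nlinarith
    nlinarith
  have b3 : |w * (2 * A ^ 2 * D' / D ^ 3)| ≤ 72 := by
    have h1 : |w * D'| ≤ 3 * D := by
      rw [hD']
      refine (abs_add_le _ _).trans ?_
      have h2 : |-(2 * x * t * L ^ 2)| ≤ 2 * D := by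
        rw [abs_neg, show 2 * x * t * L ^ 2 = x * (2 * (t * L ^ 2)) by ring, abs_mul,
          abs_of_nonneg (by positivity : 0 ≤ 2 * (t * L ^ 2))]
        nlinarith [mul_nonneg ht0 (sq_nonneg L)]
      have h3 : |2 * (L * A)| ≤ D := by
        rw [abs_mul, abs_two, mul_comm L A]; nlinarith
      linarith
    have e : w * (2 * A ^ 2 * D' / D ^ 3) = 2 * A ^ 2 * (w * D') / D ^ 3 := by ring
    rw [e, abs_div, abs_mul, abs_of_nonneg (by positivity : 0 ≤ 2 * A ^ 2),
      abs_of_pos (by positivity : 0 < D ^ 3), div_le_iff₀ (by positivity)]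
    calc 2 * A ^ 2 * |w * D'| ≤ 2 * D * (3 * D) := by gcongr
      _ = 6 * D ^ 2 * 1 := by ring
      _ ≤ 6 * D ^ 2 * (12 * D) := by gcongr; linarith
      _ = 72 * D ^ 3 := by ring
  have e : (w * y) ^ 2 * (-(2 * lam * A * L) / D ^ 2 - 2 * A ^ 2 * D' / D ^ 3) =
      w * y ^ 2 * (w * (-(2 * lam * A * L) / D ^ 2) - w * (2 * A ^ 2 * D' / D ^ 3)) := by ring
  rw [e]
  have hwy : 0 ≤ w * y ^ 2 := by positivity
  have b4 : -84 ≤ w * (-(2 * lam * A * L) / D ^ 2) - w * (2 * A ^ 2 * D' / D ^ 3) := by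
    linarith [(abs_le.1 b2).1, (abs_le.1 b3).2]
  have b5 := mul_le_mul_of_nonneg_left b4 hwy
  linarith [(abs_le.1 b1).1]

/-- The contribution of a single Gauss point, estimated on an interval from that point to a zero
`σ` of `(1 - x²) L_N'` at its right. -/
theorem eval_sq_div_le {N : ℕ} (hN : 0 < N) (y : ℝ[X]) {τ σ : ℝ} (hτ : τ ∈ nodes N) (hτσ : τ ≤ σ)
    (hσ1 : σ ≤ 1) (hσ : (legendreFlux N).eval σ = 0) :
    ((1 - X ^ 2) * y).eval τ ^ 2 / (legendreFlux N).eval τ ^ 2 ≤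
      ∫ x in τ..σ, (C 96 * ((1 - X ^ 2) * (y * y)) + C (12 / eig N) *
        (derivative ((1 - X ^ 2) * y) * derivative ((1 - X ^ 2) * y))).eval x := by
  set z := (1 - X ^ 2) * y with hz
  set B := C 96 * ((1 - X ^ 2) * (y * y)) + C (12 / eig N) * (derivative z * derivative z) with hB
  have hI : ∀ x ∈ Set.Icc τ σ, x ∈ Set.Icc (-1 : ℝ) 1 := fun x hx =>
    ⟨by linarith [(nodes_mem_Ioo hτ).1, hx.1], by linarith [hx.2]⟩
  have hder : ∀ x ∈ Set.Icc τ σ, HasDerivAt (fun x => z.eval x ^ 2 *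
      ((legendreFlux N).eval x ^ 2 / (amplitude N).eval x ^ 2) + ∫ u in τ..x, B.eval u)
      (2 * z.eval x * (derivative z).eval x *
        ((legendreFlux N).eval x ^ 2 / (amplitude N).eval x ^ 2) + z.eval x ^ 2 *
        (-(2 * eig N * (legendreFlux N).eval x * (legendre N).eval x) / (amplitude N).eval x ^ 2 -
          2 * (legendreFlux N).eval x ^ 2 * (derivative (amplitude N)).eval x /
          (amplitude N).eval x ^ 3) + B.eval x) x := by
    intro x hx
    have hpos := amplitude_pos hN (hI x hx)
    have h1 := (z.hasDerivAt x).pow 2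
    have h2 := ((legendreFlux N).hasDerivAt x).pow 2
    have h3 := ((amplitude N).hasDerivAt x).pow 2
    have h4 : HasDerivAt (fun x => ∫ u in τ..x, B.eval u) (B.eval x) x :=
      intervalIntegral.integral_hasDerivAt_right (B.continuous.intervalIntegrable _ _)
        (B.continuous.stronglyMeasurableAtFilter _ _) B.continuous.continuousAt
    have h5 := (h1.mul (h2.div h3 (pow_ne_zero 2 hpos.ne'))).add h4
    refine HasDerivAt.congr_deriv (f := fun x => z.eval x ^ 2 *
      ((legendreFlux N).eval x ^ 2 / (amplitude N).eval x ^ 2) + ∫ u in τ..x, B.eval u) h5 ?_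
    rw [derivative_legendreFlux]
    simp only [Pi.pow_apply, Pi.div_apply, eval_neg, eval_mul, eval_C, Nat.cast_ofNat,
      Nat.add_one_sub_one, pow_one]
    field_simp
  have hmono := monotoneOn_of_hasDerivWithinAt_nonneg (convex_Icc τ σ)
    (fun x hx => (hder x hx).continuousAt.continuousWithinAt)
    (fun x hx => (hder x (interior_subset hx)).hasDerivWithinAt) (fun x hx => by
      have hx' := hI x (interior_subset hx)
      have hw : 0 ≤ 1 - x ^ 2 := by nlinarith [hx'.1, hx'.2]
      have hd := congrArg (eval x) (derivative_amplitude N)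
      simp only [eval_mul, eval_sub, eval_one, eval_pow, eval_X, eval_C, eval_neg, eval_add,
        eval_ofNat] at hd
      have key := neg_two_mul_le (t := eig N * (1 - x ^ 2)) (w := 1 - x ^ 2) (x := x)
        (A := (legendreFlux N).eval x) (L := (legendre N).eval x) (D := (amplitude N).eval x)
        (D' := (derivative (amplitude N)).eval x) (y := y.eval x) (z' := (derivative z).eval x)
        (eig_pos hN) hw rfl (abs_le.2 hx') (by simp [amplitude]) (amplitude_pos hN hx')
        (amplitude_sq_ge hN hx') hd
      have e : z.eval x = (1 - x ^ 2) * y.eval x := by simp [hz]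
      have e2 : B.eval x = 96 * ((1 - x ^ 2) * y.eval x ^ 2) +
        12 / eig N * (derivative z).eval x ^ 2 := by simp [hB]; ring
      rw [e, e2]
      linarith)
  have h := hmono (Set.left_mem_Icc.2 hτσ) (Set.right_mem_Icc.2 hτσ) hτσ
  have e1 : (amplitude N).eval τ = (legendreFlux N).eval τ ^ 2 := by
    simp [amplitude, mem_nodes.1 hτ]
  have hne : (legendreFlux N).eval τ ≠ 0 := by
    have h1 := nodes_mem_Ioo hτ
    have : 1 - τ ^ 2 ≠ 0 := by nlinarith [h1.1, h1.2]
    simp [legendreFlux, derivative_legendre_eval_ne_zero hτ, this]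
  simp only [hσ, e1, intervalIntegral.integral_same] at h
  have e2 : z.eval τ ^ 2 * ((legendreFlux N).eval τ ^ 2 / ((legendreFlux N).eval τ ^ 2) ^ 2) =
      z.eval τ ^ 2 / (legendreFlux N).eval τ ^ 2 := by field_simp
  rw [e2] at h
  simpa using h

/-- The discrete Sobolev inequality at the Gauss points, for polynomials that vanish at `±1`. By
Rolle's theorem `(1 - x²) L_N'` vanishes between consecutive Gauss points and at the endpoint `1`,
so the intervals that carry the contributions of the single points do not overlap. -/
theorem sum_nodes_eval_sq_div_le {N : ℕ} (hN : 0 < N) (y : ℝ[X]) :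
    ∑ τ ∈ nodes N, ((1 - X ^ 2) * y).eval τ ^ 2 / (legendreFlux N).eval τ ^ 2 ≤
      96 * integ ((1 - X ^ 2) * (y * y)) + 12 / eig N *
        integ (derivative ((1 - X ^ 2) * y) * derivative ((1 - X ^ 2) * y)) := by
  rw [← integ_C_mul, ← integ_C_mul, ← map_add]
  set B := C 96 * ((1 - X ^ 2) * (y * y)) + C (12 / eig N) *
    (derivative ((1 - X ^ 2) * y) * derivative ((1 - X ^ 2) * y)) with hB
  have hBnn : ∀ x ∈ Set.Icc (-1 : ℝ) 1, 0 ≤ B.eval x := by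
    intro x hx
    have hw : 0 ≤ 1 - x ^ 2 := by nlinarith [hx.1, hx.2]
    have he := eig_pos hN
    rw [hB]
    simp only [eval_mul, eval_sub, eval_one, eval_pow, eval_X, eval_C, eval_add]
    have := mul_self_nonneg (y.eval x)
    have := mul_self_nonneg ((derivative ((1 - X ^ 2) * y)).eval x)
    positivity
  set e := (nodes N).orderEmbOfFin (card_nodes N) with he
  -- the Gauss points in increasing order, followed by the endpoint `1`
  set t : ℕ → ℝ := fun j => if h : j < N then e ⟨j, h⟩ else 1 with ht
  have htj : ∀ j (h : j < N), t j = e ⟨j, h⟩ := fun j h => by simp [ht, h]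
  have htmem : ∀ j, j < N → t j ∈ nodes N := fun j h => by
    rw [htj j h]; exact Finset.orderEmbOfFin_mem _ _ _
  have htN : t N = 1 := by simp [ht]
  have hlt : ∀ j, j < N → t j < t (j + 1) := by
    intro j h
    by_cases h' : j + 1 < N
    · rw [htj j h, htj _ h']; exact e.strictMono (by simp)
    · obtain rfl : j + 1 = N := by omega
      rw [htN]; exact (nodes_mem_Ioo (htmem j h)).2
  have hsum : ∀ F : ℝ → ℝ, ∑ τ ∈ nodes N, F τ = ∑ j ∈ Finset.range N, F (t j) := by
    intro F
    rw [Finset.sum_range, ← Finset.map_orderEmbOfFin_univ (nodes N) (card_nodes N),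
      Finset.sum_map]
    refine Finset.sum_congr rfl fun j _ => ?_
    rw [htj j j.2]; rfl
  have hii : ∀ a b, IntervalIntegrable (fun x => B.eval x) volume a b :=
    fun a b => B.continuous.intervalIntegrable _ _
  have hle1 : ∀ j, j ≤ N → t j ≤ 1 := by
    intro j hj
    rcases hj.eq_or_lt with rfl | hj
    · exact htN.le
    · exact (nodes_mem_Ioo (htmem j hj)).2.le
  have hstep : ∀ j ∈ Finset.range N, ((1 - X ^ 2) * y).eval (t j) ^ 2 /
      (legendreFlux N).eval (t j) ^ 2 ≤ ∫ x in t j..t (j + 1), B.eval x := by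
    intro j hj
    rw [Finset.mem_range] at hj
    have hlo := (nodes_mem_Ioo (htmem j hj)).1
    obtain ⟨σ, hσ, hσ0⟩ : ∃ σ ∈ Set.Icc (t j) (t (j + 1)), (legendreFlux N).eval σ = 0 := by
      by_cases h' : j + 1 < N
      · obtain ⟨σ, hσ, hd⟩ := exists_hasDerivAt_eq_zero (hlt j hj)
          (legendre N).continuous.continuousOn
          (by rw [mem_nodes.1 (htmem j hj), mem_nodes.1 (htmem _ h')])
          (fun x _ => (legendre N).hasDerivAt x)
        exact ⟨σ, Set.Ioo_subset_Icc_self hσ, by simp [legendreFlux, hd]⟩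
      · obtain rfl : j + 1 = N := by omega
        exact ⟨1, ⟨hle1 j hj.le, htN.ge⟩, by simp [legendreFlux]⟩
    refine (eval_sq_div_le hN y (htmem j hj) hσ.1 (hσ.2.trans (hle1 _ hj)) hσ0).trans ?_
    refine intervalIntegral.integral_mono_interval le_rfl hσ.1 hσ.2 ?_ (hii _ _)
    refine (ae_restrict_iff' measurableSet_Ioc).2 (Filter.Eventually.of_forall fun x hx => ?_)
    exact hBnn x ⟨by linarith [hx.1], hx.2.trans (hle1 _ hj)⟩
  refine (hsum fun τ => ((1 - X ^ 2) * y).eval τ ^ 2 / (legendreFlux N).eval τ ^ 2).trans_le ?_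
  refine (Finset.sum_le_sum hstep).trans ?_
  rw [intervalIntegral.sum_integral_adjacent_intervals (fun j _ => hii _ _), htN, integ_apply]
  refine intervalIntegral.integral_mono_interval (nodes_mem_Ioo (htmem 0 hN)).1.le
    (nodes_mem_Ioo (htmem 0 hN)).2.le le_rfl ?_ (hii _ _)
  refine (ae_restrict_iff' measurableSet_Ioc).2 (Filter.Eventually.of_forall fun x hx => ?_)
  exact hBnn x ⟨hx.1.le, hx.2⟩

/-! ### Stability of the interpolation, for polynomials -/

/-- The derivative of the interpolant of `z`, when `z'` is orthogonal to the polynomials of degree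
less than `N`. By quadrature `∫ e' v = -∑ w_τ z(τ) V'(τ)`, where `V = v - v(1) L_N`; the factor
`√N` comes from the size of `v(1) L_N'`. -/
theorem integ_derivative_interpolant_sq_le_of_orthogonal {N : ℕ} (hN : 0 < N) {z e : ℝ[X]}
    (h1 : z.eval 1 = 0) (hm1 : z.eval (-1) = 0)
    (horth : ∀ v : ℝ[X], v.degree < N → integ (derivative z * v) = 0)
    (hdeg : e.degree ≤ N) (he1 : e.eval (-1) = z.eval (-1))
    (hen : ∀ τ ∈ nodes N, e.eval τ = z.eval τ) :
    integ (derivative e * derivative e) ≤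
      1300 * N * integ (derivative z * derivative z) := by
  have hlam := eig_pos hN
  have hN0 : (0 : ℝ) < N := by exact_mod_cast hN
  obtain ⟨y, rfl, hy⟩ := exists_factor_of_orthogonal hN h1 horth
  have hQ := sum_nodes_eval_sq_div_le hN y
  set z := (1 - X ^ 2) * y with hz
  set Z := integ (derivative z * derivative z) with hZ
  set v := derivative e with hv
  have hvdeg : v.degree < N := by
    by_cases h0 : e = 0
    · rw [hv, h0, derivative_zero, degree_zero]; exact WithBot.bot_lt_coe _
    · exact lt_of_lt_of_le (degree_derivative_lt h0) hdeg
  set V := v - C (v.eval 1) * legendre N with hV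
  have hV1 : V.eval 1 = 0 := by simp [hV, legendre_eval_one]
  have hLd : (derivative (legendre N)).degree < N :=
    lt_of_lt_of_le (degree_derivative_lt (legendre_ne_zero N)) (degree_legendre N).le
  have hV'deg : (derivative V).degree < N := by
    rw [hV, derivative_sub, derivative_C_mul]
    refine lt_of_le_of_lt (degree_sub_le _ _)
      (max_lt (lt_of_le_of_lt degree_derivative_le hvdeg) ?_)
    exact lt_of_le_of_lt (by rw [← smul_eq_C_mul]; exact degree_smul_le _ _) hLd
  have hquad : integ (v * v) =
      -∑ τ ∈ nodes N, gaussWeight N τ * (z.eval τ * (derivative V).eval τ) := by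
    have hd : (e * derivative V).degree < (2 * N : ℕ) := by
      by_cases h0 : e * derivative V = 0
      · rw [h0, degree_zero]; exact WithBot.bot_lt_coe _
      have he0 := left_ne_zero_of_mul h0
      have hV0 := right_ne_zero_of_mul h0
      rw [degree_mul, degree_eq_natDegree he0, degree_eq_natDegree hV0]
      rw [degree_eq_natDegree he0] at hdeg
      rw [degree_eq_natDegree hV0] at hV'deg
      have a1 : e.natDegree ≤ N := by exact_mod_cast hdeg
      have a2 : (derivative V).natDegree < N := by exact_mod_cast hV'deg
      exact_mod_cast (by omega : e.natDegree + (derivative V).natDegree < 2 * N)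
    have hq := integ_eq_sum_gaussWeight hd
    have hp := integ_derivative (e * V)
    rw [derivative_mul, map_add, hq, eval_mul, eval_mul, hV1, he1, hm1] at hp
    have hs : integ (derivative e * V) = integ (v * v) := by
      rw [hV, mul_sub, map_sub, ← hv, mul_left_comm, integ_C_mul, mul_comm v (legendre N),
        integ_legendre_mul hvdeg]
      ring
    rw [hs] at hp
    have e2 : ∑ τ ∈ nodes N, gaussWeight N τ * (e * derivative V).eval τ =
        ∑ τ ∈ nodes N, gaussWeight N τ * (z.eval τ * (derivative V).eval τ) :=
      Finset.sum_congr rfl fun τ hτ => by rw [eval_mul, hen τ hτ]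
    rw [e2] at hp
    linarith
  have hwf : ∀ τ ∈ nodes N, 0 < 1 - τ ^ 2 := fun τ hτ => by
    have := nodes_mem_Ioo hτ; nlinarith [this.1, this.2]
  -- the values of `z` and of `V'` are separated by the Cauchy-Schwarz inequality
  have hcs : integ (v * v) ^ 2 ≤ (∑ τ ∈ nodes N, gaussWeight N τ / (1 - τ ^ 2) * z.eval τ ^ 2) *
      (∑ τ ∈ nodes N, gaussWeight N τ * (1 - τ ^ 2) * (derivative V).eval τ ^ 2) := by
    rw [hquad, neg_sq]
    refine Finset.sum_sq_le_sum_mul_sum_of_sq_le_mul _ (fun τ hτ => ?_) (fun τ hτ => ?_)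
      (fun τ hτ => ?_)
    · have := gaussWeight_nonneg hτ; have := hwf τ hτ; positivity
    · have := gaussWeight_nonneg hτ; have := hwf τ hτ; positivity
    · have := (hwf τ hτ).ne'
      refine le_of_eq ?_
      field_simp
  have hb1 : ∑ τ ∈ nodes N, gaussWeight N τ / (1 - τ ^ 2) * z.eval τ ^ 2 ≤ 216 / eig N * Z := by
    have e3 : ∑ τ ∈ nodes N, gaussWeight N τ / (1 - τ ^ 2) * z.eval τ ^ 2 =
        2 * ∑ τ ∈ nodes N, z.eval τ ^ 2 / (legendreFlux N).eval τ ^ 2 := by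
      rw [Finset.mul_sum]
      refine Finset.sum_congr rfl fun τ hτ => ?_
      have a1 := (hwf τ hτ).ne'
      have a2 := derivative_legendre_eval_ne_zero hτ
      simp only [gaussWeight, legendreFlux, eval_mul, eval_sub, eval_one, eval_pow, eval_X]
      field_simp
    have a3 : integ ((1 - X ^ 2) * (y * y)) ≤ 1 / eig N * Z := by
      rw [one_div, inv_mul_eq_div, le_div_iff₀ hlam]; linarith
    rw [e3]
    have : 216 / eig N * Z = 2 * (96 * (1 / eig N * Z) + 12 / eig N * Z) := by ring
    linarith
  have hb2 : ∑ τ ∈ nodes N, gaussWeight N τ * (1 - τ ^ 2) * (derivative V).eval τ ^ 2 ≤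
      2 * (N ^ 2 * integ (v * v)) + 4 * N * (N ^ 2 * integ (v * v)) := by
    have c1 : ∑ τ ∈ nodes N, gaussWeight N τ * ((1 - X ^ 2) * (derivative v * derivative v)).eval τ
        ≤ N ^ 2 * integ (v * v) := by
      rw [← integ_eq_sum_gaussWeight]
      · exact integ_weighted_derivative_sq_le hvdeg
      · by_cases h0 : derivative v = 0
        · rw [h0, mul_zero, mul_zero, degree_zero]; exact WithBot.bot_lt_coe _
        have hv0 : v ≠ 0 := fun h => h0 (by rw [h, derivative_zero])
        have a1 := degree_derivative_lt hv0
        have a3 : (1 - X ^ 2 : ℝ[X]).degree ≤ (2 : ℕ) := by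
          refine (degree_sub_le _ _).trans (max_le ?_ (by simp))
          rw [degree_one]; exact_mod_cast Nat.zero_le 2
        rw [degree_eq_natDegree hv0] at hvdeg a1
        rw [degree_eq_natDegree h0] at a1
        have a2 : (derivative v).natDegree < v.natDegree := by exact_mod_cast a1
        have a4 : v.natDegree < N := by exact_mod_cast hvdeg
        rw [degree_mul, degree_mul, degree_eq_natDegree h0]
        refine lt_of_le_of_lt (add_le_add_left a3 _) ?_
        exact_mod_cast (by omega :
          2 + ((derivative v).natDegree + (derivative v).natDegree) < 2 * N)
    have c2 : ∑ τ ∈ nodes N, gaussWeight N τ * (1 - τ ^ 2) * (derivative (legendre N)).eval τ ^ 2 =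
        2 * (N : ℝ) := by
      have c : ∑ _τ ∈ nodes N, (2 : ℝ) = 2 * (N : ℝ) := by
        rw [Finset.sum_const, card_nodes, nsmul_eq_mul, mul_comm]
      rw [← c]
      refine Finset.sum_congr rfl fun τ hτ => ?_
      have a1 := (hwf τ hτ).ne'
      have a2 := derivative_legendre_eval_ne_zero hτ
      simp only [gaussWeight]
      field_simp
    have c3 := eval_one_sq_le hN hvdeg
    calc ∑ τ ∈ nodes N, gaussWeight N τ * (1 - τ ^ 2) * (derivative V).eval τ ^ 2
        ≤ ∑ τ ∈ nodes N, (2 * (gaussWeight N τ *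
            ((1 - X ^ 2) * (derivative v * derivative v)).eval τ) + 2 * v.eval 1 ^ 2 *
            (gaussWeight N τ * (1 - τ ^ 2) * (derivative (legendre N)).eval τ ^ 2)) := by
          refine Finset.sum_le_sum fun τ hτ => ?_
          have a1 := hwf τ hτ
          have a2 := gaussWeight_nonneg hτ
          have a3 : (derivative V).eval τ = (derivative v).eval τ -
            v.eval 1 * (derivative (legendre N)).eval τ := by simp [hV]
          rw [a3]
          simp only [eval_mul, eval_sub, eval_one, eval_pow, eval_X]
          have a4 : 0 ≤ gaussWeight N τ * (1 - τ ^ 2) := by positivity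
          nlinarith [mul_nonneg a4 (sq_nonneg ((derivative v).eval τ +
            v.eval 1 * (derivative (legendre N)).eval τ))]
      _ = 2 * (∑ τ ∈ nodes N, gaussWeight N τ *
            ((1 - X ^ 2) * (derivative v * derivative v)).eval τ) + 2 * v.eval 1 ^ 2 *
            (2 * N) := by rw [Finset.sum_add_distrib, ← Finset.mul_sum, ← Finset.mul_sum, c2]
      _ ≤ 2 * (N ^ 2 * integ (v * v)) + 2 * (N ^ 2 * integ (v * v)) * (2 * N) := by gcongr
      _ = _ := by ring
  have hvv := integ_mul_self_nonneg v
  have hZ0 : 0 ≤ Z := integ_mul_self_nonneg _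
  set I := integ (v * v)
  have hfin : I ^ 2 ≤ (216 / eig N * Z) * (6 * N ^ 3 * I) := by
    refine hcs.trans ?_
    have hN1 : (1 : ℝ) ≤ N := by exact_mod_cast hN
    have a1 : 2 * (N ^ 2 * I) + 4 * N * (N ^ 2 * I) ≤ 6 * N ^ 3 * I := by
      have : 0 ≤ (N : ℝ) ^ 2 * I := by positivity
      nlinarith
    refine mul_le_mul hb1 (hb2.trans a1) ?_ (by positivity)
    exact Finset.sum_nonneg fun τ hτ => by
      have := gaussWeight_nonneg hτ; have := hwf τ hτ; positivity
  have hfin2 : (216 / eig N * Z) * (6 * N ^ 3 * I) ≤ (1300 * N * Z) * I := by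
    have : (216 / eig N * Z) * (6 * N ^ 3 * I) = (1296 * N ^ 3 / eig N) * (Z * I) := by ring
    rw [this]
    have a2 : 1296 * (N : ℝ) ^ 3 / eig N ≤ 1300 * N := by
      rw [div_le_iff₀ hlam]; unfold eig; nlinarith [pow_pos hN0 3, pow_pos hN0 2]
    calc 1296 * (N : ℝ) ^ 3 / eig N * (Z * I) ≤ 1300 * N * (Z * I) := by gcongr
      _ = _ := by ring
  rcases hvv.eq_or_lt with h0 | h0
  · rw [← h0]; positivity
  · refine le_of_mul_le_mul_right ?_ h0
    nlinarith

/-- Every polynomial has a primitive vanishing at `-1`. -/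
theorem exists_primitive (p : ℝ[X]) : ∃ q : ℝ[X], derivative q = p ∧ q.eval (-1) = 0 := by
  obtain ⟨a, rfl⟩ : ∃ q : ℝ[X], derivative q = p := by
    induction p using Polynomial.induction_on' with
    | add p q hp hq =>
      obtain ⟨a, rfl⟩ := hp
      obtain ⟨b, rfl⟩ := hq
      exact ⟨a + b, derivative_add⟩
    | monomial n c =>
      refine ⟨monomial (n + 1) (c / (n + 1)), ?_⟩
      rw [derivative_monomial]
      have : (n + 1 : ℝ) ≠ 0 := by positivity
      congr 1
      push_cast
      field_simp
  exact ⟨a - C (a.eval (-1)), by simp, by simp⟩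

theorem degree_le_of_derivative {q : ℝ[X]} {N : ℕ} (h : (derivative q).degree < N) :
    q.degree ≤ N := by
  rw [degree_lt_iff_coeff_zero] at h
  rw [degree_le_iff_coeff_zero]
  intro m hm
  have hm' : N < m := by exact_mod_cast hm
  obtain ⟨k, rfl⟩ : ∃ k, m = k + 1 := ⟨m - 1, by omega⟩
  have := h k (by omega)
  rw [coeff_derivative] at this
  exact (mul_eq_zero.1 this).resolve_right (by positivity)

/-- Stability of the interpolation operator in the `H¹` seminorm, with the loss `√N`. -/
theorem integ_derivative_interpolant_sq_le {N : ℕ} (hN : 0 < N) {w e : ℝ[X]}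
    (hdeg : e.degree ≤ N) (he1 : e.eval (-1) = w.eval (-1))
    (hen : ∀ τ ∈ nodes N, e.eval τ = w.eval τ) :
    integ (derivative e * derivative e) ≤
      3000 * N * integ (derivative w * derivative w) := by
  -- `P'` is the orthogonal projection of `w'` onto the polynomials of degree less than `N`
  obtain ⟨a, ha⟩ := exists_legendre_expansion (max N ((derivative w).natDegree + 1)) (derivative w)
    (by
      rw [degree_lt_iff_coeff_zero]; intro m hm
      exact coeff_eq_zero_of_natDegree_lt (lt_of_lt_of_le (Nat.lt_succ_self _)
        ((le_max_right _ _).trans hm)))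
  set M := max N ((derivative w).natDegree + 1)
  set g := ∑ k ∈ Finset.range N, C (a k) * legendre k with hg
  have hgdeg : g.degree < N := degree_expansion_lt a N
  have horth : ∀ v : ℝ[X], v.degree < N → integ ((derivative w - g) * v) = 0 := by
    intro v hv
    obtain ⟨b, rfl⟩ := exists_legendre_expansion N v hv
    rw [Finset.mul_sum, map_sum]
    refine Finset.sum_eq_zero fun k hk => ?_
    have hk' := Finset.mem_range.1 hk
    rw [mul_left_comm, integ_C_mul, sub_mul, map_sub, hg, integ_expansion_mul_legendre a hk', ha,
      integ_expansion_mul_legendre a (lt_of_lt_of_le hk' (le_max_left _ _)), sub_self, mul_zero]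
  obtain ⟨P, hP, hP1⟩ := exists_primitive g
  set z := w - C (w.eval (-1)) - P with hz
  have hz' : derivative z = derivative w - g := by simp [hz, hP]
  have hzm : z.eval (-1) = 0 := by simp [hz, hP1]
  have hz1 : z.eval 1 = 0 := by
    have h1 := integ_derivative z
    have h2 := horth 1 (by rw [degree_one]; exact_mod_cast hN)
    rw [mul_one, ← hz', h1, hzm] at h2
    simpa using h2
  have hPdeg : P.degree ≤ N := degree_le_of_derivative (by rw [hP]; exact hgdeg)
  have key := integ_derivative_interpolant_sq_le_of_orthogonal hN (z := z)
    (e := e - C (w.eval (-1)) - P)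
    hz1 hzm (by rw [hz']; exact horth)
    (by
      refine (degree_sub_le _ _).trans (max_le ((degree_sub_le _ _).trans (max_le hdeg ?_)) hPdeg)
      exact degree_C_le.trans (by exact_mod_cast Nat.zero_le N))
    (by simp [hz, he1]) (fun τ hτ => by simp [hz, hen τ hτ])
  have hN1 : (1 : ℝ) ≤ N := by exact_mod_cast hN
  have e1 : derivative (e - C (w.eval (-1)) - P) = derivative e - g := by simp [hP]
  rw [e1, hz'] at key
  have hpyth : integ (derivative w * derivative w) =
      integ ((derivative w - g) * (derivative w - g)) + integ (g * g) := by
    have h3 := horth g hgdeg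
    have : derivative w * derivative w = (derivative w - g) * (derivative w - g) +
      C 2 * ((derivative w - g) * g) + g * g := by rw [map_ofNat]; ring
    rw [this, map_add, map_add, integ_C_mul, h3]; ring
  have hpar : integ (derivative e * derivative e) ≤
      2 * integ ((derivative e - g) * (derivative e - g)) + 2 * integ (g * g) := by
    have h4 := integ_mul_self_nonneg (derivative e - C 2 * g)
    have : C 2 * ((derivative e - g) * (derivative e - g)) + C 2 * (g * g) =
      derivative e * derivative e + (derivative e - C 2 * g) * (derivative e - C 2 * g) := by
        rw [map_ofNat]; ring
    rw [← integ_C_mul, ← integ_C_mul, ← map_add, this, map_add]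
    linarith
  have h5 := integ_mul_self_nonneg (derivative w - g)
  have h6 := integ_mul_self_nonneg g
  nlinarith [mul_le_mul_of_nonneg_right hN1 h5, mul_le_mul_of_nonneg_right hN1 h6]

/-! ### Weak derivatives on the interval -/

theorem measurableSet_Omega : MeasurableSet Omega := measurableSet_Ioo

theorem isOpen_Omega : IsOpen Omega := isOpen_Ioo

instance : IsFiniteMeasure (volume.restrict Omega) := ⟨by simp [Omega]⟩

theorem setIntegral_Omega (f : ℝ → ℝ) : ∫ x in Omega, f x = ∫ x in (-1 : ℝ)..1, f x := by
  rw [intervalIntegral.integral_of_le (by norm_num), integral_Ioc_eq_integral_Ioo, Omega]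

theorem intervalIntegrable_of_integrableOn {g : ℝ → ℝ} (hg : IntegrableOn g Omega) :
    IntervalIntegrable g volume (-1) 1 :=
  (intervalIntegrable_iff_integrableOn_Ioo_of_le (by norm_num)).2 hg

theorem intervalIntegrable_of_mem {g : ℝ → ℝ} (hg : IntegrableOn g Omega) {x y : ℝ}
    (hx : x ∈ Set.Icc (-1 : ℝ) 1) (hy : y ∈ Set.Icc (-1 : ℝ) 1) :
    IntervalIntegrable g volume x y :=
  (intervalIntegrable_of_integrableOn hg).mono_set (by
    rw [Set.uIcc_of_le (by norm_num : (-1 : ℝ) ≤ 1)]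
    exact Set.uIcc_subset_Icc hx hy)

theorem continuousOn_primitive {g : ℝ → ℝ} (hg : IntegrableOn g Omega) :
    ContinuousOn (fun x => ∫ t in (-1 : ℝ)..x, g t) (Set.Icc (-1) 1) := by
  have := intervalIntegral.continuousOn_primitive_interval (a := (-1 : ℝ)) (b := 1) (f := g)
    (μ := volume) (by
      rw [← intervalIntegrable_iff']
      exact intervalIntegrable_of_integrableOn hg)
  rwa [Set.uIcc_of_le (by norm_num : (-1 : ℝ) ≤ 1)] at this

theorem IsTestFunction.eq_zero_of_notMem {φ : ℝ → ℝ} (hφ : IsTestFunction φ) {x : ℝ}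
    (hx : x ∉ Omega) : φ x = 0 := by
  by_contra h
  exact hx (hφ.2.2 (subset_tsupport _ h))

theorem IsTestFunction.deriv_mem {φ : ℝ → ℝ} (hφ : IsTestFunction φ) : IsTestFunction (deriv φ) :=
  ⟨(contDiff_infty_iff_deriv.1 hφ.1).2, hφ.2.1.deriv,
    (tsupport_deriv_subset (𝕜 := ℝ) (f := φ)).trans hφ.2.2⟩

theorem integrable_mul_testFunction {v φ : ℝ → ℝ} (hv : LocallyIntegrableOn v Omega)
    (hφ : IsTestFunction φ) : Integrable (fun x => v x * φ x) := by
  have h1 : IntegrableOn v (tsupport φ) := hv.integrableOn_compact_subset hφ.2.2 hφ.2.1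
  have h2 : IntegrableOn (fun x => v x * φ x) (tsupport φ) :=
    h1.mul_continuousOn hφ.1.continuous.continuousOn hφ.2.1
  refine (integrableOn_iff_integrable_of_support_subset ?_).1 h2
  intro x hx
  exact subset_tsupport _ (right_ne_zero_of_mul hx)

/-- The fundamental lemma of the calculus of variations on `Ω`. -/
theorem ae_eq_zero_of_integral_mul_testFunction {d : ℝ → ℝ} (hd : LocallyIntegrableOn d Omega)
    (h : ∀ φ, IsTestFunction φ → ∫ x in Omega, d x * φ x = 0) :
    d =ᵐ[volume.restrict Omega] 0 := by
  have := isOpen_Omega.ae_eq_zero_of_integral_contDiff_smul_eq_zero hd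
    (fun φ h1 h2 h3 => by
      have hφ : IsTestFunction φ := ⟨h1, h2, h3⟩
      rw [← h φ hφ, setIntegral_eq_integral_of_forall_compl_eq_zero]
      · simp [mul_comm]
      · intro x hx
        rw [hφ.eq_zero_of_notMem hx, mul_zero])
  exact (ae_restrict_iff' measurableSet_Omega).2 this

theorem HasWeakDeriv.ae_eq {k : ℕ} {u v w : ℝ → ℝ} (hv : HasWeakDeriv k u v)
    (hw : HasWeakDeriv k u w) : v =ᵐ[volume.restrict Omega] w := by
  have h := ae_eq_zero_of_integral_mul_testFunction (d := fun x => v x - w x)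
    (hv.2.1.sub hw.2.1) (fun φ hφ => by
      have h1 := (hv.2.2 φ hφ).symm.trans (hw.2.2 φ hφ)
      have h2 := mul_left_cancel₀ (pow_ne_zero k (by norm_num : (-1 : ℝ) ≠ 0)) h1
      simp only [sub_mul]
      rw [integral_sub (integrable_mul_testFunction hv.2.1 hφ).restrict
        (integrable_mul_testFunction hw.2.1 hφ).restrict, h2, sub_self])
  filter_upwards [h] with x hx
  exact sub_eq_zero.1 hx

theorem hasWeakDeriv_weakDeriv {k : ℕ} {u : ℝ → ℝ} (h : ∃ v, HasWeakDeriv k u v) :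
    HasWeakDeriv k u (weakDeriv k u) := by
  rw [weakDeriv, dif_pos h]; exact h.choose_spec

theorem HasWeakDeriv.weakDeriv_ae_eq {k : ℕ} {u v : ℝ → ℝ} (h : HasWeakDeriv k u v) :
    weakDeriv k u =ᵐ[volume.restrict Omega] v :=
  (hasWeakDeriv_weakDeriv ⟨v, h⟩).ae_eq h

theorem HasWeakDeriv.succ {k : ℕ} {u v w : ℝ → ℝ} (hv : HasWeakDeriv k u v)
    (hw : HasWeakDeriv (k + 1) u w) : HasWeakDeriv 1 v w := by
  refine ⟨hv.2.1, hw.2.1, fun φ hφ => ?_⟩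
  have h1 := hv.2.2 _ hφ.deriv_mem
  have h2 := hw.2.2 φ hφ
  rw [iteratedDeriv_succ', h1, pow_succ, mul_assoc] at h2
  rw [iteratedDeriv_one, pow_one]
  exact mul_left_cancel₀ (pow_ne_zero k (by norm_num : (-1 : ℝ) ≠ 0)) h2

/-- `f` is absolutely continuous on `[-1, 1]`, with an almost everywhere derivative `g ∈ L²(Ω)`. -/
structure HasL2Deriv (f g : ℝ → ℝ) : Prop where
  memLp : MemLp g 2 (volume.restrict Omega)
  eq_add_integral : ∀ x ∈ Set.Icc (-1 : ℝ) 1, f x = f (-1) + ∫ t in (-1 : ℝ)..x, g t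

theorem integrableOn_of_memLp {g : ℝ → ℝ} (hg : MemLp g 2 (volume.restrict Omega)) :
    IntegrableOn g Omega := hg.integrable (by norm_num)

/-- A primitive of an integrable function has that function as its weak derivative. -/
theorem hasWeakDeriv_of_eq_add_integral {f g : ℝ → ℝ} (hg : IntegrableOn g Omega) {c : ℝ}
    (hf : ∀ x ∈ Omega, f x = c + ∫ t in (-1 : ℝ)..x, g t) : HasWeakDeriv 1 f g := by
  have hii := intervalIntegrable_of_integrableOn hg
  set F : ℝ → ℝ := fun x => c + ∫ t in (-1 : ℝ)..x, g t with hF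
  have hFc : ContinuousOn F (Set.Icc (-1) 1) := continuousOn_const.add (continuousOn_primitive hg)
  have hFi : IntegrableOn F Omega :=
    (hFc.integrableOn_compact isCompact_Icc).mono_set Set.Ioo_subset_Icc_self
  have hfF : Set.EqOn F f Omega := fun x hx => (hf x hx).symm
  refine ⟨(hFi.congr_fun hfF measurableSet_Omega).locallyIntegrableOn, hg.locallyIntegrableOn,
    fun φ hφ => ?_⟩
  have hφd : ∀ x, DifferentiableAt ℝ φ x := fun x => (contDiff_infty_iff_deriv.1 hφ.1).1 x
  have hG : AbsolutelyContinuousOnInterval (fun x => ∫ t in (-1 : ℝ)..x, g t) (-1) 1 :=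
    hii.absolutelyContinuousOnInterval_intervalIntegral (by simp)
  have hφac : AbsolutelyContinuousOnInterval φ (-1) 1 :=
    (hφ.1.of_le (by exact_mod_cast le_top)).contDiffOn.absolutelyContinuousOnInterval
  have hz1 : φ 1 = 0 := hφ.eq_zero_of_notMem (by simp [Omega])
  have hz2 : φ (-1) = 0 := hφ.eq_zero_of_notMem (by simp [Omega])
  have hparts := hG.integral_mul_deriv_eq_deriv_mul hφac
  have hconst : ∫ x in (-1 : ℝ)..1, deriv φ x = 0 := by
    rw [intervalIntegral.integral_deriv_eq_sub (fun x _ => hφd x)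
      (hφ.deriv_mem.1.continuous.intervalIntegrable _ _), hz1, hz2, sub_zero]
  have hder : ∫ x in (-1 : ℝ)..1, deriv (fun x => ∫ t in (-1 : ℝ)..x, g t) x * φ x =
      ∫ x in (-1 : ℝ)..1, g x * φ x := by
    refine intervalIntegral.integral_congr_ae ?_
    filter_upwards [hii.ae_hasDerivAt_integral] with x hx hx'
    rw [(hx (Set.uIoc_subset_uIcc hx') (-1) (by simp)).deriv]
  rw [hder, hz1, hz2] at hparts
  rw [iteratedDeriv_one, pow_one, setIntegral_congr_fun measurableSet_Omega
    (g := fun x => F x * deriv φ x) (fun x hx => by simp only [hF, hf x hx]), setIntegral_Omega,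
    setIntegral_Omega]
  simp only [hF, add_mul]
  rw [intervalIntegral.integral_add, intervalIntegral.integral_const_mul, hconst, hparts]
  · ring
  · exact (hφ.deriv_mem.1.continuous.intervalIntegrable _ _).const_mul _
  · refine ContinuousOn.intervalIntegrable ?_
    rw [Set.uIcc_of_le (by norm_num : (-1 : ℝ) ≤ 1)]
    exact (continuousOn_primitive hg).mul hφ.deriv_mem.1.continuous.continuousOn

theorem HasL2Deriv.hasWeakDeriv {f g : ℝ → ℝ} (h : HasL2Deriv f g) : HasWeakDeriv 1 f g :=
  hasWeakDeriv_of_eq_add_integral (integrableOn_of_memLp h.memLp)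
    (fun x hx => h.eq_add_integral x (Set.Ioo_subset_Icc_self hx))

/-- A test function of mean zero is the derivative of a test function. -/
theorem IsTestFunction.exists_deriv_eq {η : ℝ → ℝ} (hη : IsTestFunction η)
    (h0 : ∫ x in (-1 : ℝ)..1, η x = 0) : ∃ φ, IsTestFunction φ ∧ deriv φ = η := by
  have hc := hη.1.continuous
  have hder : ∀ x, HasDerivAt (fun x => ∫ t in (-1 : ℝ)..x, η t) (η x) x := fun x =>
    intervalIntegral.integral_hasDerivAt_right (hc.intervalIntegrable _ _)
      (hc.stronglyMeasurableAtFilter _ _) hc.continuousAt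
  have hd : deriv (fun x => ∫ t in (-1 : ℝ)..x, η t) = η := funext fun x => (hder x).deriv
  obtain ⟨a, b, ha, hb, hab⟩ : ∃ a b : ℝ, -1 < a ∧ b < 1 ∧ tsupport η ⊆ Set.Icc a b := by
    rcases (tsupport η).eq_empty_or_nonempty with he | hne
    · exact ⟨0, 0, by norm_num, by norm_num, by simp [he]⟩
    · have hK : IsCompact (tsupport η) := hη.2.1
      exact ⟨sInf (tsupport η), sSup (tsupport η), (hη.2.2 (hK.sInf_mem hne)).1,
        (hη.2.2 (hK.sSup_mem hne)).2,
        fun x hx => ⟨csInf_le hK.bddBelow hx, le_csSup hK.bddAbove hx⟩⟩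
  have hzero : ∀ x, x ∉ Set.Icc a b → η x = 0 := fun x hx => by
    by_contra h; exact hx (hab (subset_tsupport _ h))
  have hsupp : Function.support (fun x => ∫ t in (-1 : ℝ)..x, η t) ⊆ Set.Icc a b := by
    intro x hx
    by_contra hx'
    refine hx ?_
    rw [Set.mem_Icc, not_and_or, not_le, not_le] at hx'
    rcases hx' with h | h
    · refine (intervalIntegral.integral_congr (g := fun _ => 0) fun t ht => ?_).trans (by simp)
      refine hzero t fun h' => ?_
      rcases Set.mem_uIcc.1 ht with h2 | h2 <;> linarith [h'.1, h2.1, h2.2]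
    · have h2 : ∫ t in x..1, η t = 0 := by
        refine (intervalIntegral.integral_congr (g := fun _ => 0) fun t ht => ?_).trans (by simp)
        refine hzero t fun h' => ?_
        rcases Set.mem_uIcc.1 ht with h2 | h2 <;> linarith [h'.2, h2.1, h2.2]
      have h3 := intervalIntegral.integral_add_adjacent_intervals
        (hc.intervalIntegrable (-1) x) (hc.intervalIntegrable (μ := volume) x 1)
      rw [h0, h2, add_zero] at h3
      exact h3
  have hts : tsupport (fun x => ∫ t in (-1 : ℝ)..x, η t) ⊆ Set.Icc a b :=
    closure_minimal hsupp isClosed_Icc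
  refine ⟨fun x => ∫ t in (-1 : ℝ)..x, η t, ⟨?_, ?_, ?_⟩, hd⟩
  · exact contDiff_infty_iff_deriv.2 ⟨fun x => (hder x).differentiableAt, by rw [hd]; exact hη.1⟩
  · exact isCompact_Icc.of_isClosed_subset (isClosed_tsupport _) hts
  · exact hts.trans fun x hx => ⟨by linarith [hx.1], by linarith [hx.2]⟩

theorem exists_testFunction_integral_one :
    ∃ ψ, IsTestFunction ψ ∧ ∫ x in Omega, ψ x = 1 := by
  let b : ContDiffBump (0 : ℝ) := ⟨1 / 4, 1 / 2, by norm_num, by norm_num⟩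
  have ht : tsupport (b.normed volume) ⊆ Omega := by
    rw [b.tsupport_normed_eq, Real.closedBall_eq_Icc]
    intro x hx
    constructor <;> · have := hx.1; have := hx.2; simp only [b] at *; linarith
  have hT : IsTestFunction (b.normed volume) :=
    ⟨b.contDiff_normed, b.hasCompactSupport_normed, ht⟩
  refine ⟨_, hT, ?_⟩
  rw [setIntegral_eq_integral_of_forall_compl_eq_zero (fun x hx => hT.eq_zero_of_notMem hx)]
  exact b.integral_normed

/-- The du Bois-Reymond lemma: a function with an integrable weak derivative is a primitive of it
almost everywhere. -/
theorem HasWeakDeriv.exists_ae_eq {u v : ℝ → ℝ} (h : HasWeakDeriv 1 u v)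
    (hv : IntegrableOn v Omega) :
    ∃ c : ℝ, ∀ᵐ x ∂volume.restrict Omega, u x = c + ∫ t in (-1 : ℝ)..x, v t := by
  set F : ℝ → ℝ := fun x => 0 + ∫ t in (-1 : ℝ)..x, v t with hF
  have hFw : HasWeakDeriv 1 F v := hasWeakDeriv_of_eq_add_integral hv (fun x _ => rfl)
  have hdl : LocallyIntegrableOn (fun x => u x - F x) Omega := h.1.sub hFw.1
  have hd0 : ∀ φ, IsTestFunction φ → ∫ x in Omega, (u x - F x) * deriv φ x = 0 := by
    intro φ hφ
    have h1 := h.2.2 φ hφ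
    rw [← hFw.2.2 φ hφ, iteratedDeriv_one] at h1
    simp only [sub_mul]
    rw [integral_sub (integrable_mul_testFunction h.1 hφ.deriv_mem).restrict
      (integrable_mul_testFunction hFw.1 hφ.deriv_mem).restrict, h1, sub_self]
  obtain ⟨ψ, hψ, hψ1⟩ := exists_testFunction_integral_one
  set c := ∫ x in Omega, (u x - F x) * ψ x with hc
  refine ⟨c, ?_⟩
  have hc0 : LocallyIntegrableOn (fun _ : ℝ => c) Omega :=
    (continuous_const.locallyIntegrable).locallyIntegrableOn _
  have key := ae_eq_zero_of_integral_mul_testFunction (d := fun x => (u x - F x) - c)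
    (hdl.sub hc0) (fun φ hφ => by
      have hη : IsTestFunction (fun x => φ x - (∫ y in Omega, φ y) * ψ x) := by
        have hm : IsTestFunction (fun x => (∫ y in Omega, φ y) * ψ x) :=
          ⟨contDiff_const.mul hψ.1, hψ.2.1.mul_left, (tsupport_mul_subset_right).trans hψ.2.2⟩
        exact ⟨hφ.1.sub hm.1, hφ.2.1.sub hm.2.1,
          (tsupport_sub _ _).trans (Set.union_subset hφ.2.2 hm.2.2)⟩
      have hφi : IntegrableOn φ Omega :=
        (hφ.1.continuous.integrable_of_hasCompactSupport hφ.2.1).integrableOn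
      have hψi : IntegrableOn ψ Omega :=
        (hψ.1.continuous.integrable_of_hasCompactSupport hψ.2.1).integrableOn
      obtain ⟨χ, hχ, hχ'⟩ := hη.exists_deriv_eq (by
        rw [← setIntegral_Omega, integral_sub hφi (hψi.const_mul _), integral_const_mul, hψ1,
          mul_one, sub_self])
      have h2 := hd0 χ hχ
      rw [hχ'] at h2
      have i1 := (integrable_mul_testFunction hdl hφ).integrableOn (s := Omega)
      have i2 := (integrable_mul_testFunction hdl hψ).integrableOn (s := Omega)
      have e1 : ∀ x, (u x - F x) * (φ x - (∫ y in Omega, φ y) * ψ x) =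
          (u x - F x) * φ x - (∫ y in Omega, φ y) * ((u x - F x) * ψ x) := fun x => by ring
      simp only [e1] at h2
      rw [integral_sub i1 (i2.const_mul _), integral_const_mul, ← hc] at h2
      simp only [sub_mul _ c]
      rw [integral_sub i1 (hφi.const_mul _), integral_const_mul]
      linarith)
  filter_upwards [key] with x hx
  have hx' : u x - F x - c = 0 := hx
  simp only [hF] at hx'
  linarith

/-! ### The interpolation operator -/

/-- The interpolation points: the left endpoint and the Gauss points. -/
def interpNodes (N : ℕ) : Finset ℝ := insert (-1) (nodes N)

theorem neg_one_notMem_nodes (N : ℕ) : (-1 : ℝ) ∉ nodes N := fun h =>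
  lt_irrefl _ (nodes_mem_Ioo h).1

theorem card_interpNodes (N : ℕ) : (interpNodes N).card = N + 1 := by
  rw [interpNodes, Finset.card_insert_of_notMem (neg_one_notMem_nodes N), card_nodes]

/-- The interpolant of `f` at the points `interpNodes N`. -/
def gaussInterp (N : ℕ) (f : ℝ → ℝ) : ℝ[X] := Lagrange.interpolate (interpNodes N) id f

theorem degree_gaussInterp_le (N : ℕ) (f : ℝ → ℝ) : (gaussInterp N f).degree ≤ N := by
  have h := Lagrange.degree_interpolate_le (s := interpNodes N) (v := id) f (Set.injOn_id _)
  rwa [card_interpNodes, Nat.add_sub_cancel] at h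

theorem eval_gaussInterp {N : ℕ} (f : ℝ → ℝ) {x : ℝ} (hx : x ∈ interpNodes N) :
    (gaussInterp N f).eval x = f x :=
  Lagrange.eval_interpolate_at_node (v := id) f (Set.injOn_id _) hx

theorem eq_gaussInterp {N : ℕ} {f : ℝ → ℝ} {q : ℝ[X]} (hq : q.degree ≤ N)
    (h : ∀ x ∈ interpNodes N, q.eval x = f x) : q = gaussInterp N f :=
  Lagrange.eq_interpolate_of_eval_eq f (Set.injOn_id _)
    (by rw [card_interpNodes]; exact lt_of_le_of_lt hq (by exact_mod_cast N.lt_succ_self)) h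

theorem isGaussInterpolant_iff {N : ℕ} {u : ℝ → ℝ} {q : ℝ[X]} :
    IsGaussInterpolant N u q ↔ q = gaussInterp N u := by
  constructor
  · rintro ⟨h1, h2, h3⟩
    refine eq_gaussInterp (mem_degreeLE.1 h1) fun x hx => ?_
    rcases Finset.mem_insert.1 hx with rfl | hx
    · exact h2
    · exact h3 x (mem_nodes.1 hx)
  · rintro rfl
    refine ⟨mem_degreeLE.2 (degree_gaussInterp_le N u),
      eval_gaussInterp u (Finset.mem_insert_self _ _), fun τ hτ => ?_⟩
    exact eval_gaussInterp u (Finset.mem_insert_of_mem (mem_nodes.2 hτ))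

theorem interpNodes_subset (N : ℕ) {x : ℝ} (hx : x ∈ interpNodes N) : x ∈ Set.Icc (-1 : ℝ) 1 := by
  rcases Finset.mem_insert.1 hx with rfl | hx
  · norm_num
  · exact Set.Ioo_subset_Icc_self (nodes_mem_Ioo hx)

/-! ### Norms -/

theorem eLpNorm_two_sq (μ : Measure ℝ) (g : ℝ → ℝ) :
    eLpNorm g 2 μ ^ 2 = ∫⁻ x, ENNReal.ofReal (g x ^ 2) ∂μ := by
  have h := eLpNorm_nnreal_pow_eq_lintegral (μ := μ) (f := g) (p := 2) (by norm_num)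
  have e : ∀ a : ℝ≥0∞, a ^ (((2 : NNReal) : ℝ)) = a ^ 2 := fun a => by
    rw [← ENNReal.rpow_natCast]; norm_num
  rw [e] at h
  refine h.trans (lintegral_congr fun x => ?_)
  rw [e, Real.enorm_eq_ofReal_abs, ← ENNReal.ofReal_pow (abs_nonneg _), sq_abs]

theorem l2Norm_sq (g : ℝ → ℝ) : l2Norm g ^ 2 = ∫⁻ x in Omega, ENNReal.ofReal (g x ^ 2) :=
  eLpNorm_two_sq _ g

theorem l2Norm_eval (p : ℝ[X]) :
    l2Norm (fun x => p.eval x) = ENNReal.ofReal √(integ (p * p)) := by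
  have h : l2Norm (fun x => p.eval x) ^ 2 = ENNReal.ofReal √(integ (p * p)) ^ 2 := by
    rw [l2Norm_sq, ← ENNReal.ofReal_pow (Real.sqrt_nonneg _),
      Real.sq_sqrt (integ_mul_self_nonneg p), integ_apply, ← setIntegral_Omega,
      ← ofReal_integral_eq_lintegral_ofReal]
    · simp [sq]
    · exact ((p.continuous.pow 2).continuousOn.integrableOn_compact isCompact_Icc).mono_set
        Set.Ioo_subset_Icc_self
    · exact Filter.Eventually.of_forall fun x => sq_nonneg _
  exact (ENNReal.pow_right_strictMono two_ne_zero).injective h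

theorem aestronglyMeasurable_eval (p : ℝ[X]) :
    AEStronglyMeasurable (fun x => p.eval x) (volume.restrict Omega) :=
  p.continuous.aestronglyMeasurable

theorem memLp_eval (p : ℝ[X]) : MemLp (fun x => p.eval x) 2 (volume.restrict Omega) := by
  refine ⟨aestronglyMeasurable_eval p, ?_⟩
  have := l2Norm_eval p
  rw [l2Norm] at this
  rw [this]; exact ENNReal.ofReal_lt_top

theorem l2Norm_add_le {f g : ℝ → ℝ} (hf : AEStronglyMeasurable f (volume.restrict Omega))
    (hg : AEStronglyMeasurable g (volume.restrict Omega)) :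
    l2Norm (fun x => f x + g x) ≤ l2Norm f + l2Norm g :=
  eLpNorm_add_le hf hg (by norm_num)

theorem l2Norm_congr {f g : ℝ → ℝ} (h : f =ᵐ[volume.restrict Omega] g) : l2Norm f = l2Norm g :=
  eLpNorm_congr_ae h

theorem volume_Omega_rpow_le : (volume.restrict Omega Set.univ) ^ ((2 : ℝ≥0∞).toReal)⁻¹ ≤ 2 := by
  have h2 : volume.restrict Omega Set.univ = 2 := by
    simp [Omega]; norm_num
  rw [h2]
  calc (2 : ℝ≥0∞) ^ ((2 : ℝ≥0∞).toReal)⁻¹ ≤ 2 ^ (1 : ℝ) :=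
        ENNReal.rpow_le_rpow_of_exponent_le (by norm_num) (by norm_num)
    _ = 2 := ENNReal.rpow_one 2

theorem l2Norm_le_of_bound {f : ℝ → ℝ} {c : ℝ≥0∞} (h : ∀ x ∈ Omega, ‖f x‖ₑ ≤ c) :
    l2Norm f ≤ c * 2 := by
  refine (eLpNorm_le_of_ae_enorm_bound
    ((ae_restrict_iff' measurableSet_Omega).2 (Filter.Eventually.of_forall h))).trans ?_
  rw [smul_eq_mul]
  gcongr
  exact volume_Omega_rpow_le

/-- The sup norm of a primitive is bounded by the `L²` norm of the derivative. -/
theorem enorm_integral_le {g : ℝ → ℝ} (hg : AEStronglyMeasurable g (volume.restrict Omega))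
    {x : ℝ} (hx : x ∈ Set.Icc (-1 : ℝ) 1) :
    ‖∫ t in (-1 : ℝ)..x, g t‖ₑ ≤ l2Norm g * 2 := by
  rw [intervalIntegral.integral_of_le hx.1, integral_Ioc_eq_integral_Ioo]
  refine (enorm_integral_le_lintegral_enorm _).trans ?_
  refine (lintegral_mono_set (Set.Ioo_subset_Ioo_right hx.2)).trans ?_
  have h := eLpNorm_le_eLpNorm_mul_rpow_measure_univ (p := 1) (q := 2) (by norm_num) hg
  rw [eLpNorm_one_eq_lintegral_enorm] at h
  refine h.trans ?_
  rw [l2Norm]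
  gcongr
  have := volume_Omega_rpow_le
  norm_num at this ⊢
  exact this

/-- Polynomials are dense in `L²(Ω)`. -/
theorem exists_poly_l2Norm_sub_le {g : ℝ → ℝ} (hg : MemLp g 2 (volume.restrict Omega))
    {ε : ℝ} (hε : 0 < ε) :
    ∃ p : ℝ[X], l2Norm (fun x => g x - p.eval x) ≤ ENNReal.ofReal ε := by
  obtain ⟨f, hf, hf2⟩ := hg.exists_boundedContinuous_eLpNorm_sub_le (by norm_num)
    (ε := ENNReal.ofReal (ε / 2)) (by simpa using hε)
  obtain ⟨p, hp⟩ := exists_polynomial_near_of_continuousOn (-1) 1 f f.continuous.continuousOn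
    (ε / 4) (by positivity)
  refine ⟨p, ?_⟩
  have e : (fun x => g x - p.eval x) = fun x => (g - f) x + (f x - p.eval x) := by
    ext x; simp
  rw [e]
  refine (l2Norm_add_le (hg.1.sub hf2.1) (hf2.1.sub (aestronglyMeasurable_eval p))).trans ?_
  have h2 : l2Norm (fun x => f x - p.eval x) ≤ ENNReal.ofReal (ε / 4) * 2 := by
    refine l2Norm_le_of_bound fun x hx => ?_
    rw [Real.enorm_eq_ofReal_abs, abs_sub_comm]
    exact ENNReal.ofReal_le_ofReal (hp x (Set.Ioo_subset_Icc_self hx)).le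
  refine (add_le_add hf h2).trans ?_
  rw [show (2 : ℝ≥0∞) = ENNReal.ofReal 2 by simp, ← ENNReal.ofReal_mul (by positivity),
    ← ENNReal.ofReal_add (by positivity) (by positivity)]
  exact ENNReal.ofReal_le_ofReal (by linarith)

/-! ### Best approximation and stability in Sobolev spaces -/

theorem HasL2Deriv.sub_eval {f g : ℝ → ℝ} (h : HasL2Deriv f g) (P : ℝ[X]) :
    HasL2Deriv (fun x => f x - P.eval x) (fun x => g x - (derivative P).eval x) := by
  refine ⟨h.memLp.sub (memLp_eval _), fun x hx => ?_⟩
  have hi := intervalIntegrable_of_mem (integrableOn_of_memLp h.memLp)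
    (Set.left_mem_Icc.2 (by norm_num)) hx
  rw [intervalIntegral.integral_sub hi ((derivative P).continuous.intervalIntegrable _ _),
    intervalIntegral.integral_eq_sub_of_hasDerivAt (fun x _ => P.hasDerivAt x)
      ((derivative P).continuous.intervalIntegrable _ _), h.eq_add_integral x hx]
  ring

theorem HasL2Deriv.enorm_sub_le {f g : ℝ → ℝ} (h : HasL2Deriv f g) (h0 : f (-1) = 0) {x : ℝ}
    (hx : x ∈ Set.Icc (-1 : ℝ) 1) : ‖f x‖ₑ ≤ l2Norm g * 2 := by
  rw [h.eq_add_integral x hx, h0, zero_add]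
  exact enorm_integral_le h.memLp.1 hx

theorem HasL2Deriv.l2Norm_le {f g : ℝ → ℝ} (h : HasL2Deriv f g) (h0 : f (-1) = 0) :
    l2Norm f ≤ l2Norm g * 4 := by
  refine (l2Norm_le_of_bound fun x hx => h.enorm_sub_le h0 (Set.Ioo_subset_Icc_self hx)).trans ?_
  rw [mul_assoc]; norm_num

theorem HasL2Deriv.aestronglyMeasurable {f g : ℝ → ℝ} (h : HasL2Deriv f g) :
    AEStronglyMeasurable f (volume.restrict Omega) :=
  h.hasWeakDeriv.1.aestronglyMeasurable

/-- The distance in `L²(Ω)` of `f` to the polynomials of degree less than `n`. -/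
def bestApprox (n : ℕ) (f : ℝ → ℝ) : ℝ≥0∞ :=
  ⨅ q : degreeLT ℝ n, l2Norm (fun x => f x - (q : ℝ[X]).eval x)

theorem bestApprox_le {n : ℕ} {f : ℝ → ℝ} {q : ℝ[X]} (hq : q.degree < n) :
    bestApprox n f ≤ l2Norm (fun x => f x - q.eval x) :=
  iInf_le (fun q : degreeLT ℝ n => l2Norm (fun x => f x - (q : ℝ[X]).eval x))
    ⟨q, mem_degreeLT.2 hq⟩

theorem bestApprox_le_l2Norm (n : ℕ) (f : ℝ → ℝ) : bestApprox n f ≤ l2Norm f := by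
  have := bestApprox_le (n := n) (f := f) (q := 0) (by rw [degree_zero]; exact WithBot.bot_lt_coe _)
  simpa using this

theorem bestApprox_congr {n : ℕ} {f g : ℝ → ℝ} (h : f =ᵐ[volume.restrict Omega] g) :
    bestApprox n f = bestApprox n g := by
  unfold bestApprox
  congr 1
  ext q
  exact l2Norm_congr (by filter_upwards [h] with x hx; rw [hx])

theorem bestApprox_add_le (n : ℕ) {f g : ℝ → ℝ}
    (hf : AEStronglyMeasurable f (volume.restrict Omega))
    (hg : AEStronglyMeasurable g (volume.restrict Omega)) :
    bestApprox n (fun x => f x + g x) ≤ l2Norm f + bestApprox n g := by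
  unfold bestApprox
  rw [ENNReal.add_iInf]
  refine iInf_mono fun q => ?_
  simp only [add_sub_assoc]
  exact l2Norm_add_le hf (hg.sub (aestronglyMeasurable_eval _))

/-- Jackson's inequality: one derivative gains a factor `1 / (n + 1)`, and the degree drops by
one. -/
theorem HasL2Deriv.bestApprox_succ_le {f g : ℝ → ℝ} (h : HasL2Deriv f g) (n : ℕ) :
    ENNReal.ofReal (n + 1) * bestApprox (n + 1) f ≤ bestApprox n g := by
  refine le_iInf fun q => ?_
  obtain ⟨q, hq⟩ := q
  rw [mem_degreeLT] at hq
  simp only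
  refine ENNReal.le_of_forall_pos_le_add fun ε hε _ => ?_
  set δ : ℝ := ε / (4 * (n + 1) + 1) with hδ
  have hδ0 : 0 < δ := by positivity
  obtain ⟨Q, hQ, hQ1⟩ := exists_primitive q
  have hg1 : MemLp (fun x => g x - q.eval x) 2 (volume.restrict Omega) := h.memLp.sub (memLp_eval q)
  obtain ⟨p, hp⟩ := exists_poly_l2Norm_sub_le hg1 hδ0
  obtain ⟨P, hP, hP1⟩ := exists_primitive p
  obtain ⟨r, hr, hr'⟩ := exists_poly_approx n P
  have hPr : ENNReal.ofReal (n + 1) * l2Norm (fun x => (P - r).eval x) ≤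
      l2Norm (fun x => p.eval x) := by
    rw [l2Norm_eval, l2Norm_eval, ← ENNReal.ofReal_mul (by positivity)]
    refine ENNReal.ofReal_le_ofReal (Real.le_sqrt_of_sq_le ?_)
    rw [mul_pow, Real.sq_sqrt (integ_mul_self_nonneg _), ← hP]
    exact hr'
  have hpn : l2Norm (fun x => p.eval x) ≤ ENNReal.ofReal δ + l2Norm (fun x => g x - q.eval x) := by
    have e : (fun x => p.eval x) = fun x => -(g x - q.eval x - p.eval x) + (g x - q.eval x) := by
      ext x; ring
    rw [e]
    refine (l2Norm_add_le (hg1.sub (memLp_eval p)).1.neg hg1.1).trans ?_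
    gcongr
    have := eLpNorm_neg (f := fun x => g x - q.eval x - p.eval x) (p := 2)
      (μ := volume.restrict Omega)
    exact this.le.trans hp
  set R := Q + P + C (f (-1)) with hR
  have hfR := h.sub_eval R
  have hfR0 : f (-1) - R.eval (-1) = 0 := by simp [hR, hQ1, hP1]
  have hfRn := hfR.l2Norm_le hfR0
  have e1 : (fun x => g x - (derivative R).eval x) = fun x => g x - q.eval x - p.eval x := by
    ext x; simp [hR, hQ, hP]; ring
  rw [e1] at hfRn
  have hdeg : (Q + C (f (-1)) + r).degree < (n + 1 : ℕ) := by
    have hc : (C (f (-1))).degree ≤ n := degree_C_le.trans (by exact_mod_cast Nat.zero_le n)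
    have hQd := degree_le_of_derivative (q := Q) (N := n) (by rw [hQ]; exact hq)
    refine lt_of_le_of_lt (degree_add_le _ _) (max_lt ?_ hr)
    refine lt_of_le_of_lt ((degree_add_le _ _).trans (max_le hQd hc)) ?_
    exact_mod_cast n.lt_succ_self
  have hmain : bestApprox (n + 1) f ≤ ENNReal.ofReal δ * 4 + l2Norm (fun x => (P - r).eval x) := by
    refine (bestApprox_le hdeg).trans ?_
    have e2 : (fun x => f x - (Q + C (f (-1)) + r).eval x) =
        fun x => (f x - R.eval x) + (P - r).eval x := by
      ext x; simp [hR]; ring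
    rw [e2]
    refine (l2Norm_add_le hfR.aestronglyMeasurable (aestronglyMeasurable_eval _)).trans ?_
    gcongr
    exact hfRn.trans (by gcongr)
  calc ENNReal.ofReal (n + 1) * bestApprox (n + 1) f
      ≤ ENNReal.ofReal (n + 1) * (ENNReal.ofReal δ * 4 + l2Norm (fun x => (P - r).eval x)) := by
        gcongr
    _ ≤ ENNReal.ofReal (n + 1) * (ENNReal.ofReal δ * 4) +
        (ENNReal.ofReal δ + l2Norm (fun x => g x - q.eval x)) := by
        rw [mul_add]; gcongr; exact hPr.trans hpn
    _ = l2Norm (fun x => g x - q.eval x) + ENNReal.ofReal ε := by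
        rw [← add_assoc, add_comm, show (4 : ℝ≥0∞) = ENNReal.ofReal 4 by simp,
          ← ENNReal.ofReal_mul hδ0.le, ← ENNReal.ofReal_mul (by positivity),
          ← ENNReal.ofReal_add (by positivity) hδ0.le]
        congr 2
        rw [hδ]; field_simp
    _ = l2Norm (fun x => g x - q.eval x) + ε := by rw [ENNReal.ofReal_coe_nnreal]

theorem derivative_gaussInterp (N : ℕ) (f : ℝ → ℝ) : derivative (gaussInterp N f) =
    ∑ τ ∈ interpNodes N, C (f τ) * derivative (Lagrange.basis (interpNodes N) id τ) := by
  rw [gaussInterp, Lagrange.interpolate_apply, derivative_sum]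
  exact Finset.sum_congr rfl fun τ _ => by rw [derivative_C_mul]

/-- A crude stability bound, with an unspecified constant that depends on `N`. -/
theorem exists_l2Norm_derivative_gaussInterp_le (N : ℕ) : ∃ K : ℝ, 0 ≤ K ∧
    ∀ f g : ℝ → ℝ, HasL2Deriv f g → f (-1) = 0 →
      l2Norm (fun x => (derivative (gaussInterp N f)).eval x) ≤ ENNReal.ofReal K * l2Norm g := by
  refine ⟨2 * ∑ τ ∈ interpNodes N, √(integ (derivative (Lagrange.basis (interpNodes N) id τ) *
    derivative (Lagrange.basis (interpNodes N) id τ))), by positivity, fun f g h h0 => ?_⟩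
  rw [derivative_gaussInterp]
  have e : (fun x => (∑ τ ∈ interpNodes N, C (f τ) *
      derivative (Lagrange.basis (interpNodes N) id τ)).eval x) =
      ∑ τ ∈ interpNodes N, f τ • fun x =>
        (derivative (Lagrange.basis (interpNodes N) id τ)).eval x := by
    ext x
    simp [eval_finsetSum]
  rw [e, l2Norm]
  refine (eLpNorm_sum_le (fun τ _ => (aestronglyMeasurable_eval _).const_smul _)
    (by norm_num)).trans ?_
  have hτ : ∀ τ ∈ interpNodes N, eLpNorm (f τ • fun x =>
      (derivative (Lagrange.basis (interpNodes N) id τ)).eval x) 2 (volume.restrict Omega) ≤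
      l2Norm g * 2 * ENNReal.ofReal √(integ (derivative (Lagrange.basis (interpNodes N) id τ) *
    derivative (Lagrange.basis (interpNodes N) id τ))) := by
    intro τ hτ
    rw [eLpNorm_const_smul, ← l2Norm_eval]
    exact mul_le_mul_left (h.enorm_sub_le h0 (interpNodes_subset N hτ)) _
  refine (Finset.sum_le_sum hτ).trans ?_
  rw [← Finset.mul_sum, ENNReal.ofReal_mul (by norm_num), ENNReal.ofReal_sum_of_nonneg
    (fun _ _ => Real.sqrt_nonneg _), ENNReal.ofReal_ofNat]
  exact le_of_eq (by ring)

/-- Stability of the interpolation operator in the `H¹` seminorm, by density from the case of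
polynomials. -/
theorem HasL2Deriv.l2Norm_derivative_gaussInterp_le {N : ℕ} (hN : 0 < N) {f g : ℝ → ℝ}
    (h : HasL2Deriv f g) :
    l2Norm (fun x => (derivative (gaussInterp N f)).eval x) ≤
      ENNReal.ofReal √(3000 * N) * l2Norm g := by
  obtain ⟨K, hK, hKf⟩ := exists_l2Norm_derivative_gaussInterp_le N
  refine ENNReal.le_of_forall_pos_le_add fun ε hε _ => ?_
  set δ : ℝ := ε / (K + √(3000 * N) + 1) with hδ
  have hδ0 : 0 < δ := by positivity
  obtain ⟨p, hp⟩ := exists_poly_l2Norm_sub_le h.memLp hδ0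
  obtain ⟨P, hP, hP1⟩ := exists_primitive p
  set w := P + C (f (-1)) with hw
  have hw' : derivative w = p := by simp [hw, hP]
  have hfw := h.sub_eval w
  rw [hw'] at hfw
  have b1 := hKf _ _ hfw (by simp [hw, hP1])
  have e1 : gaussInterp N f = gaussInterp N (fun x => f x - w.eval x) +
      gaussInterp N (fun x => w.eval x) := by
    refine (eq_gaussInterp ((degree_add_le _ _).trans (max_le (degree_gaussInterp_le _ _)
      (degree_gaussInterp_le _ _))) fun x hx => ?_).symm
    rw [eval_add, eval_gaussInterp _ hx, eval_gaussInterp _ hx, sub_add_cancel]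
  have b2 := integ_derivative_interpolant_sq_le hN (w := w) (e := gaussInterp N fun x => w.eval x)
    (degree_gaussInterp_le _ _) (eval_gaussInterp _ (Finset.mem_insert_self _ _))
    (fun τ hτ => eval_gaussInterp (fun x => w.eval x) (Finset.mem_insert_of_mem hτ))
  rw [hw'] at b2
  have b3 : l2Norm (fun x => (derivative (gaussInterp N fun x => w.eval x)).eval x) ≤
      ENNReal.ofReal √(3000 * N) * l2Norm (fun x => p.eval x) := by
    rw [l2Norm_eval, l2Norm_eval, ← ENNReal.ofReal_mul (by positivity),
      ← Real.sqrt_mul (by positivity)]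
    exact ENNReal.ofReal_le_ofReal (Real.sqrt_le_sqrt b2)
  have hpn : l2Norm (fun x => p.eval x) ≤ ENNReal.ofReal δ + l2Norm g := by
    have e : (fun x => p.eval x) = fun x => -(g x - p.eval x) + g x := by
      ext x; ring
    rw [e]
    refine (l2Norm_add_le (h.memLp.sub (memLp_eval p)).1.neg h.memLp.1).trans ?_
    gcongr
    exact (eLpNorm_neg (f := fun x => g x - p.eval x) (p := 2)
      (μ := volume.restrict Omega)).le.trans hp
  have e2 : (fun x => (derivative (gaussInterp N f)).eval x) = fun x =>
      (derivative (gaussInterp N (fun x => f x - w.eval x))).eval x +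
      (derivative (gaussInterp N (fun x => w.eval x))).eval x := by
    ext x; rw [e1, derivative_add, eval_add]
  rw [e2]
  refine (l2Norm_add_le (aestronglyMeasurable_eval _) (aestronglyMeasurable_eval _)).trans ?_
  calc _ ≤ ENNReal.ofReal K * ENNReal.ofReal δ +
        ENNReal.ofReal √(3000 * N) * (ENNReal.ofReal δ + l2Norm g) := by
        refine add_le_add (b1.trans ?_) (b3.trans ?_) <;> gcongr
    _ = ENNReal.ofReal √(3000 * N) * l2Norm g +
        (ENNReal.ofReal K * ENNReal.ofReal δ + ENNReal.ofReal √(3000 * N) * ENNReal.ofReal δ) := by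
        ring
    _ ≤ ENNReal.ofReal √(3000 * N) * l2Norm g + ε := by
        gcongr
        rw [← ENNReal.ofReal_mul hK, ← ENNReal.ofReal_mul (by positivity),
          ← ENNReal.ofReal_add (by positivity) (by positivity), ← ENNReal.ofReal_coe_nnreal]
        refine ENNReal.ofReal_le_ofReal ?_
        rw [← add_mul, hδ, mul_div_assoc', div_le_iff₀ (by positivity)]
        have : (0 : ℝ) ≤ ε := ε.2
        nlinarith

/-- The interpolation error is controlled by the best approximation of the derivative. -/
theorem HasL2Deriv.l2Norm_sub_derivative_gaussInterp_le {N : ℕ} (hN : 0 < N) {f g : ℝ → ℝ}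
    (h : HasL2Deriv f g) :
    l2Norm (fun x => g x - (derivative (gaussInterp N f)).eval x) ≤
      ENNReal.ofReal (1 + √(3000 * N)) * bestApprox N g := by
  unfold bestApprox
  rw [ENNReal.mul_iInf_of_ne (by simp; positivity) ENNReal.ofReal_ne_top]
  refine le_iInf fun q => ?_
  obtain ⟨q, hq⟩ := q
  rw [mem_degreeLT] at hq
  simp only
  obtain ⟨Q, hQ, hQ1⟩ := exists_primitive q
  have hd := h.sub_eval Q
  rw [hQ] at hd
  have hQd := degree_le_of_derivative (q := Q) (N := N) (by rw [hQ]; exact hq)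
  have e1 : gaussInterp N f = gaussInterp N (fun x => f x - Q.eval x) + Q := by
    refine (eq_gaussInterp ((degree_add_le _ _).trans (max_le (degree_gaussInterp_le _ _)
      hQd)) fun x hx => ?_).symm
    rw [eval_add, eval_gaussInterp _ hx, sub_add_cancel]
  have e2 : (fun x => g x - (derivative (gaussInterp N f)).eval x) = fun x =>
      (g x - q.eval x) + -(derivative (gaussInterp N (fun x => f x - Q.eval x))).eval x := by
    ext x; rw [e1, derivative_add, eval_add, hQ]; ring
  rw [e2]
  refine (l2Norm_add_le hd.memLp.1 (aestronglyMeasurable_eval _).neg).trans ?_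
  rw [ENNReal.ofReal_add zero_le_one (by positivity), add_mul, ENNReal.ofReal_one, one_mul]
  gcongr
  exact (eLpNorm_neg (f := fun x => (derivative (gaussInterp N (fun x => f x - Q.eval x))).eval x)
    (p := 2) (μ := volume.restrict Omega)).le.trans (hd.l2Norm_derivative_gaussInterp_le hN)

/-! ### Approximation of functions of fractional smoothness -/

/-- A continuously differentiable bump supported in `[0, 1]`, with integral `1`. -/
def bump (t : ℝ) : ℝ := 30 * max 0 (t * (1 - t)) ^ 2

/-- The derivative of `bump`. -/
def bumpDeriv (t : ℝ) : ℝ := 60 * max 0 (t * (1 - t)) * (1 - 2 * t)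

theorem hasDerivAt_max_zero_sq (u : ℝ) :
    HasDerivAt (fun v : ℝ => max 0 v ^ 2) (2 * max 0 u) u := by
  rcases lt_trichotomy u 0 with h | rfl | h
  · rw [max_eq_left h.le, mul_zero]
    refine (hasDerivAt_const u (0 : ℝ)).congr_of_eventuallyEq ?_
    filter_upwards [Iio_mem_nhds h] with v hv
    rw [max_eq_left (le_of_lt hv)]; norm_num
  · have hO : (fun v : ℝ => max 0 v ^ 2) =O[nhds 0] fun v => ‖v - 0‖ ^ 2 := by
      refine Asymptotics.IsBigO.of_bound 1 (Filter.Eventually.of_forall fun v => ?_)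
      simp only [sub_zero, one_mul, norm_pow, norm_norm]
      gcongr
      rw [Real.norm_eq_abs, Real.norm_eq_abs, abs_of_nonneg (le_max_left 0 v)]
      exact max_le (abs_nonneg v) (le_abs_self v)
    have := (hO.hasFDerivAt (by norm_num)).hasDerivAt
    simpa using this
  · rw [max_eq_right h.le]
    have h2 : HasDerivAt (fun v : ℝ => v ^ 2) (2 * u) u := by simpa using hasDerivAt_pow 2 u
    refine h2.congr_of_eventuallyEq ?_
    filter_upwards [Ioi_mem_nhds h] with v hv
    rw [max_eq_right (le_of_lt hv)]

theorem hasDerivAt_bump (t : ℝ) : HasDerivAt bump (bumpDeriv t) t := by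
  have h1 : HasDerivAt (fun t : ℝ => t * (1 - t)) (1 - 2 * t) t := by
    have := (hasDerivAt_id t).mul ((hasDerivAt_id t).const_sub 1)
    refine this.congr_deriv ?_
    simp; ring
  have h2 := ((hasDerivAt_max_zero_sq (t * (1 - t))).comp t h1).const_mul 30
  refine HasDerivAt.congr_deriv (f := bump) h2 ?_
  unfold bumpDeriv; ring

theorem continuous_bump : Continuous bump := by unfold bump; fun_prop

theorem continuous_bumpDeriv : Continuous bumpDeriv := by unfold bumpDeriv; fun_prop

theorem max_zero_mul_one_sub_eq_zero {t : ℝ} (h : t ∉ Set.Icc (0 : ℝ) 1) :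
    max 0 (t * (1 - t)) = 0 := by
  rw [Set.mem_Icc, not_and_or, not_le, not_le] at h
  refine max_eq_left ?_
  rcases h with h | h <;> nlinarith

theorem bump_eq_zero {t : ℝ} (h : t ∉ Set.Icc (0 : ℝ) 1) : bump t = 0 := by
  rw [bump, max_zero_mul_one_sub_eq_zero h]; norm_num

theorem bumpDeriv_eq_zero {t : ℝ} (h : t ∉ Set.Icc (0 : ℝ) 1) : bumpDeriv t = 0 := by
  rw [bumpDeriv, max_zero_mul_one_sub_eq_zero h]; norm_num

theorem abs_bump_le (t : ℝ) : |bump t| ≤ 2 := by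
  have h0 : 0 ≤ max 0 (t * (1 - t)) := le_max_left _ _
  have h1 : max 0 (t * (1 - t)) ≤ 1 / 4 :=
    max_le (by norm_num) (by nlinarith [sq_nonneg (t - 1 / 2)])
  rw [bump, abs_of_nonneg (by positivity)]
  nlinarith

theorem abs_bumpDeriv_le (t : ℝ) : |bumpDeriv t| ≤ 15 := by
  by_cases ht : t ∈ Set.Icc (0 : ℝ) 1
  · have h0 : 0 ≤ max 0 (t * (1 - t)) := le_max_left _ _
    have h1 : max 0 (t * (1 - t)) ≤ 1 / 4 :=
      max_le (by norm_num) (by nlinarith [sq_nonneg (t - 1 / 2)])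
    have h2 : |1 - 2 * t| ≤ 1 := abs_le.2 ⟨by linarith [ht.2], by linarith [ht.1]⟩
    rw [bumpDeriv, abs_mul, abs_of_nonneg (by positivity)]
    nlinarith [abs_nonneg (1 - 2 * t)]
  · rw [bumpDeriv_eq_zero ht]; norm_num

theorem integral_bump {a b : ℝ} (ha : a ≤ 0) (hb : 1 ≤ b) : ∫ t in a..b, bump t = 1 := by
  have hi : ∀ c d, IntervalIntegrable bump volume c d :=
    fun c d => continuous_bump.intervalIntegrable c d
  rw [← intervalIntegral.integral_add_adjacent_intervals (hi a 0) (hi 0 b),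
    ← intervalIntegral.integral_add_adjacent_intervals (hi 0 1) (hi 1 b)]
  have h1 : ∫ t in a..0, bump t = 0 := by
    refine (intervalIntegral.integral_congr (g := fun _ => 0) fun t ht => ?_).trans (by simp)
    rw [Set.uIcc_of_le ha] at ht
    simp only [bump]
    rw [max_eq_left (by nlinarith [ht.1, ht.2])]; norm_num
  have h2 : ∫ t in (1 : ℝ)..b, bump t = 0 := by
    refine (intervalIntegral.integral_congr (g := fun _ => 0) fun t ht => ?_).trans (by simp)
    rw [Set.uIcc_of_le hb] at ht
    simp only [bump]
    rw [max_eq_left (by nlinarith [ht.1, ht.2])]; norm_num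
  have h3 : ∫ t in (0 : ℝ)..1, bump t = 1 := by
    have hd : ∀ t ∈ Set.uIcc (0 : ℝ) 1,
        HasDerivAt (fun t : ℝ => 10 * t ^ 3 - 15 * t ^ 4 + 6 * t ^ 5) (bump t) t := by
      intro t ht
      rw [Set.uIcc_of_le zero_le_one] at ht
      have h := (((hasDerivAt_pow 3 t).const_mul 10).sub ((hasDerivAt_pow 4 t).const_mul 15)).add
        ((hasDerivAt_pow 5 t).const_mul 6)
      refine h.congr_deriv ?_
      rw [bump, max_eq_right (mul_nonneg ht.1 (by linarith [ht.2]))]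
      norm_num
      ring
    rw [intervalIntegral.integral_eq_sub_of_hasDerivAt hd (hi 0 1)]
    norm_num
  rw [h1, h2, h3]; norm_num

/-- A smoothing kernel: `smoothKernel h x` is a bump supported in a window of length `h` that
contains `x` and lies in `[-1, 1]`. The left end of the window is the affine function of `x` with
the values `-1` at `-1` and `1 - h` at `1`. -/
def smoothKernel (h x y : ℝ) : ℝ := bump ((y - (x * (1 - h / 2) - h / 2)) / h) / h

/-- The derivative of `smoothKernel h x y` with respect to `x`. -/
def smoothKernelDeriv (h x y : ℝ) : ℝ :=
  bumpDeriv ((y - (x * (1 - h / 2) - h / 2)) / h) * (-(1 - h / 2) / h) / h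

theorem hasDerivAt_smoothKernel (h x y : ℝ) :
    HasDerivAt (fun x => smoothKernel h x y) (smoothKernelDeriv h x y) x := by
  have h1 : HasDerivAt (fun x : ℝ => (y - (x * (1 - h / 2) - h / 2)) / h) (-(1 - h / 2) / h) x := by
    have := ((((hasDerivAt_id x).mul_const (1 - h / 2)).sub_const (h / 2)).const_sub y).div_const h
    simpa using this
  exact ((hasDerivAt_bump _).comp x h1).div_const h

theorem window_subset {h x y : ℝ} (hh : 0 < h) (hx : x ∈ Set.Icc (-1 : ℝ) 1)
    (hy : (y - (x * (1 - h / 2) - h / 2)) / h ∈ Set.Icc (0 : ℝ) 1) : |y - x| ≤ h := by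
  have h1 := hy.1
  have h2 := hy.2
  rw [le_div_iff₀ hh] at h1
  rw [div_le_iff₀ hh] at h2
  rw [abs_le]
  constructor <;> nlinarith [hx.1, hx.2]

theorem smoothKernel_eq_zero {h x y : ℝ} (hh : 0 < h) (hx : x ∈ Set.Icc (-1 : ℝ) 1)
    (hy : h < |y - x|) : smoothKernel h x y = 0 := by
  rw [smoothKernel, bump_eq_zero fun h' => absurd (window_subset hh hx h') (not_le.2 hy), zero_div]

theorem smoothKernelDeriv_eq_zero {h x y : ℝ} (hh : 0 < h) (hx : x ∈ Set.Icc (-1 : ℝ) 1)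
    (hy : h < |y - x|) : smoothKernelDeriv h x y = 0 := by
  rw [smoothKernelDeriv,
    bumpDeriv_eq_zero fun h' => absurd (window_subset hh hx h') (not_le.2 hy), zero_mul, zero_div]

theorem abs_smoothKernel_le {h : ℝ} (hh : 0 < h) (x y : ℝ) : |smoothKernel h x y| ≤ 2 / h := by
  rw [smoothKernel, abs_div, abs_of_pos hh]
  exact div_le_div_of_nonneg_right (abs_bump_le _) hh.le

theorem abs_smoothKernelDeriv_le {h : ℝ} (hh : 0 < h) (hh1 : h ≤ 1) (x y : ℝ) :
    |smoothKernelDeriv h x y| ≤ 15 / h ^ 2 := by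
  rw [smoothKernelDeriv, abs_div, abs_mul, abs_div, abs_neg, abs_of_pos hh,
    abs_of_pos (by linarith : 0 < 1 - h / 2), mul_div_assoc', div_div, ← sq]
  refine div_le_div_of_nonneg_right ?_ (by positivity)
  nlinarith [abs_bumpDeriv_le ((y - (x * (1 - h / 2) - h / 2)) / h),
    abs_nonneg (bumpDeriv ((y - (x * (1 - h / 2) - h / 2)) / h))]

theorem continuous_smoothKernel (h x : ℝ) : Continuous (smoothKernel h x) := by
  unfold smoothKernel
  exact (continuous_bump.comp (by fun_prop)).div_const _

theorem continuous_smoothKernelDeriv (h x : ℝ) : Continuous (smoothKernelDeriv h x) := by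
  unfold smoothKernelDeriv
  exact ((continuous_bumpDeriv.comp (by fun_prop)).mul_const _).div_const _

theorem integral_smoothKernel {h x : ℝ} (hh : 0 < h) (hh1 : h ≤ 1)
    (hx : x ∈ Set.Icc (-1 : ℝ) 1) : ∫ y in Omega, smoothKernel h x y = 1 := by
  rw [setIntegral_Omega]
  simp only [smoothKernel]
  have e : ∀ y, bump ((y - (x * (1 - h / 2) - h / 2)) / h) / h =
      h⁻¹ * bump (y / h - (x * (1 - h / 2) - h / 2) / h) := fun y => by rw [sub_div]; ring
  simp only [e]
  rw [intervalIntegral.integral_const_mul,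
    intervalIntegral.integral_comp_div_sub (fun t => bump t) hh.ne', smul_eq_mul, ← mul_assoc,
    inv_mul_cancel₀ hh.ne', one_mul]
  refine integral_bump ?_ ?_
  · rw [← sub_div]; exact div_nonpos_of_nonpos_of_nonneg (by nlinarith [hx.1]) hh.le
  · rw [← sub_div, le_div_iff₀ hh]; nlinarith [hx.2]

theorem hasDerivAt_integral_smoothKernel {h : ℝ} (hh : 0 < h) (hh1 : h ≤ 1) {g : ℝ → ℝ}
    (hg : IntegrableOn g Omega) (x : ℝ) :
    HasDerivAt (fun x => ∫ y in Omega, smoothKernel h x y * g y)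
      (∫ y in Omega, smoothKernelDeriv h x y * g y) x := by
  refine (hasDerivAt_integral_of_dominated_loc_of_deriv_le (μ := volume.restrict Omega)
    (F := fun x y => smoothKernel h x y * g y) (F' := fun x y => smoothKernelDeriv h x y * g y)
    (bound := fun y => 15 / h ^ 2 * |g y|) (x₀ := x) (s := Set.univ) Filter.univ_mem ?_ ?_ ?_ ?_ ?_
    ?_).2
  · exact Filter.Eventually.of_forall fun x =>
      (continuous_smoothKernel h x).aestronglyMeasurable.mul hg.1
  · exact hg.bdd_mul (continuous_smoothKernel h x).aestronglyMeasurable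
      (c := 2 / h) (Filter.Eventually.of_forall fun y => abs_smoothKernel_le hh x y)
  · exact (continuous_smoothKernelDeriv h x).aestronglyMeasurable.mul hg.1
  · refine Filter.Eventually.of_forall fun y x _ => ?_
    rw [norm_mul]
    exact mul_le_mul_of_nonneg_right (abs_smoothKernelDeriv_le hh hh1 x y) (abs_nonneg _)
  · exact hg.abs.const_mul _
  · exact Filter.Eventually.of_forall fun y x _ => (hasDerivAt_smoothKernel h x y).mul_const _

theorem integral_smoothKernelDeriv {h x : ℝ} (hh : 0 < h) (hh1 : h ≤ 1)
    (hx : x ∈ Omega) : ∫ y in Omega, smoothKernelDeriv h x y = 0 := by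
  have h1 := hasDerivAt_integral_smoothKernel hh hh1 (g := fun _ => 1)
    (integrable_const (μ := volume.restrict Omega) 1) x
  simp only [mul_one] at h1
  have h2 : HasDerivAt (fun x => ∫ y in Omega, smoothKernel h x y) 0 x := by
    refine (hasDerivAt_const x (1 : ℝ)).congr_of_eventuallyEq ?_
    filter_upwards [isOpen_Omega.mem_nhds hx] with z hz
    exact integral_smoothKernel hh hh1 (Set.Ioo_subset_Icc_self hz)
  exact h1.unique h2

/-- The inner integral of the Slobodeckij seminorm controls averages of `g - g x` over windows of
size `h` around `x`. -/
theorem integral_mul_sub_sq_le {g k : ℝ → ℝ} {h s B x : ℝ} (hh : 0 < h) (hs : 0 ≤ s)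
    (hg : AEStronglyMeasurable g (volume.restrict Omega))
    (hB : ∀ y, |k y| ≤ B) (hk : ∀ y, h < |y - x| → k y = 0) :
    ENNReal.ofReal ((∫ y in Omega, k y * (g y - g x)) ^ 2) ≤
      ENNReal.ofReal (2 * B ^ 2 * h ^ (2 + 2 * s)) *
        ∫⁻ y in Omega, ENNReal.ofReal (|g x - g y| ^ 2 / |x - y| ^ (1 + 2 * s)) := by
  have hB0 : 0 ≤ B := (abs_nonneg _).trans (hB x)
  set W := Set.Icc (x - h) (x + h) with hW
  have hgd : AEStronglyMeasurable (fun y => g y - g x) (volume.restrict (W ∩ Omega)) :=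
    (hg.mono_measure (Measure.restrict_mono Set.inter_subset_right le_rfl)).sub
      aestronglyMeasurable_const
  have h1 : ‖∫ y in Omega, k y * (g y - g x)‖ₑ ≤
      ENNReal.ofReal B * eLpNorm (fun y => g y - g x) 1 (volume.restrict (W ∩ Omega)) := by
    refine (enorm_integral_le_lintegral_enorm _).trans ?_
    rw [eLpNorm_one_eq_lintegral_enorm, ← lintegral_const_mul' _ _ ENNReal.ofReal_ne_top,
      ← Measure.restrict_restrict measurableSet_Icc, ← lintegral_indicator measurableSet_Icc]
    refine lintegral_mono fun y => ?_
    by_cases hy : y ∈ W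
    · rw [Set.indicator_of_mem hy, enorm_mul]
      gcongr
      rw [Real.enorm_eq_ofReal_abs]
      exact ENNReal.ofReal_le_ofReal (hB y)
    · have : k y = 0 := hk y (by
        by_contra hc
        rw [not_lt, abs_le] at hc
        exact hy ⟨by linarith [hc.1], by linarith [hc.2]⟩)
      simp [this]
  have h2 := eLpNorm_le_eLpNorm_mul_rpow_measure_univ (p := 1) (q := 2) (by norm_num) hgd
  have h3 : ((volume.restrict (W ∩ Omega)) Set.univ) ≤ ENNReal.ofReal (2 * h) := by
    rw [Measure.restrict_apply_univ]
    refine (measure_mono Set.inter_subset_left).trans ?_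
    rw [hW, Real.volume_Icc]
    exact ENNReal.ofReal_le_ofReal (by linarith)
  have h4 : eLpNorm (fun y => g y - g x) 2 (volume.restrict (W ∩ Omega)) ^ 2 ≤
      ENNReal.ofReal (h ^ (1 + 2 * s)) *
        ∫⁻ y in Omega, ENNReal.ofReal (|g x - g y| ^ 2 / |x - y| ^ (1 + 2 * s)) := by
    rw [eLpNorm_two_sq, ← lintegral_const_mul' _ _ ENNReal.ofReal_ne_top]
    refine (setLIntegral_mono' (measurableSet_Icc.inter measurableSet_Omega) fun y hy => ?_).trans
      (lintegral_mono_set Set.inter_subset_right)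
    rw [← ENNReal.ofReal_mul (by positivity)]
    refine ENNReal.ofReal_le_ofReal ?_
    rw [abs_sub_comm, sq_abs]
    rcases eq_or_ne x y with rfl | hxy
    · simp
    · have hpos : 0 < |x - y| := abs_pos.2 (sub_ne_zero.2 hxy)
      have hle : |x - y| ≤ h := abs_le.2 ⟨by linarith [hy.1.2], by linarith [hy.1.1]⟩
      rw [mul_div_assoc', le_div_iff₀ (by positivity), mul_comm]
      exact mul_le_mul_of_nonneg_right (Real.rpow_le_rpow hpos.le hle (by linarith)) (sq_nonneg _)
  have h5 : ENNReal.ofReal ((∫ y in Omega, k y * (g y - g x)) ^ 2) =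
      ‖∫ y in Omega, k y * (g y - g x)‖ₑ ^ 2 := by
    rw [Real.enorm_eq_ofReal_abs, ← ENNReal.ofReal_pow (abs_nonneg _), sq_abs]
  rw [h5]
  have h6 : ((volume.restrict (W ∩ Omega)) Set.univ ^
      (1 / (1 : ℝ≥0∞).toReal - 1 / (2 : ℝ≥0∞).toReal)) ^ 2 ≤ ENNReal.ofReal (2 * h) := by
    have e : (1 / (1 : ℝ≥0∞).toReal - 1 / (2 : ℝ≥0∞).toReal) * ((2 : ℕ) : ℝ) = 1 := by norm_num
    rw [← ENNReal.rpow_natCast, ← ENNReal.rpow_mul, e, ENNReal.rpow_one]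
    exact h3
  calc ‖∫ y in Omega, k y * (g y - g x)‖ₑ ^ 2
      ≤ (ENNReal.ofReal B * (eLpNorm (fun y => g y - g x) 2 (volume.restrict (W ∩ Omega)) *
        (volume.restrict (W ∩ Omega)) Set.univ ^
          (1 / (1 : ℝ≥0∞).toReal - 1 / (2 : ℝ≥0∞).toReal))) ^ 2 := by
        gcongr
        exact h1.trans (by gcongr)
    _ ≤ ENNReal.ofReal B ^ 2 * ((ENNReal.ofReal (h ^ (1 + 2 * s)) *
        ∫⁻ y in Omega, ENNReal.ofReal (|g x - g y| ^ 2 / |x - y| ^ (1 + 2 * s))) *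
          ENNReal.ofReal (2 * h)) := by
        rw [mul_pow, mul_pow]
        gcongr
    _ = (ENNReal.ofReal B ^ 2 * ENNReal.ofReal (h ^ (1 + 2 * s)) * ENNReal.ofReal (2 * h)) *
        ∫⁻ y in Omega, ENNReal.ofReal (|g x - g y| ^ 2 / |x - y| ^ (1 + 2 * s)) := by ring
    _ = _ := by
        rw [← ENNReal.ofReal_pow hB0, ← ENNReal.ofReal_mul (by positivity),
          ← ENNReal.ofReal_mul (by positivity)]
        congr 2
        rw [show 2 + 2 * s = (1 + 2 * s) + 1 by ring, Real.rpow_add_one hh.ne']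
        ring

theorem l2Norm_le_of_sq_le {f g : ℝ → ℝ} {s c : ℝ} (hc : 0 ≤ c)
    (h : ∀ x ∈ Omega, ENNReal.ofReal (f x ^ 2) ≤ ENNReal.ofReal (c ^ 2) *
      ∫⁻ y in Omega, ENNReal.ofReal (|g x - g y| ^ 2 / |x - y| ^ (1 + 2 * s))) :
    l2Norm f ≤ ENNReal.ofReal c * slobodeckijSq s g ^ (1 / 2 : ℝ) := by
  refine (ENNReal.pow_le_pow_left_iff two_ne_zero).1 ?_
  rw [l2Norm_sq, mul_pow, ← ENNReal.ofReal_pow hc, ← ENNReal.rpow_natCast (slobodeckijSq s g ^ _),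
    ← ENNReal.rpow_mul]
  norm_num
  rw [slobodeckijSq, ← lintegral_const_mul' _ _ (by simp)]
  refine setLIntegral_mono' measurableSet_Omega fun x hx => ?_
  exact h x hx

/-- The rate of best approximation of a function with finite Slobodeckij seminorm. The function is
smoothed at scale `1 / n`; the smoothed function is approximated by Jackson's inequality. -/
theorem bestApprox_le_slobodeckij {n : ℕ} (hn : 0 < n) {s : ℝ} (hs : 0 ≤ s) {g : ℝ → ℝ}
    (hg : MemLp g 2 (volume.restrict Omega)) :
    bestApprox n g ≤ ENNReal.ofReal (25 * (n : ℝ) ^ (-s)) * slobodeckijSq s g ^ (1 / 2 : ℝ) := by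
  obtain ⟨m, rfl⟩ : ∃ m, n = m + 1 := ⟨n - 1, by omega⟩
  have hgi := integrableOn_of_memLp hg
  set h : ℝ := 1 / ((m + 1 : ℕ) : ℝ) with hh
  have hn0 : (0 : ℝ) < ((m + 1 : ℕ) : ℝ) := by positivity
  have h0 : 0 < h := by positivity
  have h1 : h ≤ 1 := by
    rw [hh, div_le_one hn0]; exact_mod_cast Nat.succ_pos m
  set G : ℝ → ℝ := fun x => ∫ y in Omega, smoothKernel h x y * g y with hG
  set G' : ℝ → ℝ := fun x => ∫ y in Omega, smoothKernelDeriv h x y * g y with hG'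
  have hder : ∀ x, HasDerivAt G (G' x) x := hasDerivAt_integral_smoothKernel h0 h1 hgi
  have hGc : Continuous G := continuous_iff_continuousAt.2 fun x => (hder x).continuousAt
  have hG'm : Measurable G' := by
    have : G' = deriv G := funext fun x => (hder x).deriv.symm
    rw [this]; exact measurable_deriv G
  have hki : ∀ x, IntegrableOn (fun y => smoothKernel h x y * g y) Omega := fun x =>
    hgi.bdd_mul (continuous_smoothKernel h x).aestronglyMeasurable
      (c := 2 / h) (Filter.Eventually.of_forall fun y => abs_smoothKernel_le h0 x y)
  have hki' : ∀ x, IntegrableOn (fun y => smoothKernelDeriv h x y * g y) Omega := fun x =>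
    hgi.bdd_mul (continuous_smoothKernelDeriv h x).aestronglyMeasurable
      (c := 15 / h ^ 2) (Filter.Eventually.of_forall fun y => abs_smoothKernelDeriv_le h0 h1 x y)
  have hki1 : ∀ x, IntegrableOn (fun y => smoothKernel h x y) Omega := fun x =>
    ((continuous_smoothKernel h x).continuousOn.integrableOn_compact isCompact_Icc).mono_set
      Set.Ioo_subset_Icc_self
  have hki1' : ∀ x, IntegrableOn (fun y => smoothKernelDeriv h x y) Omega := fun x =>
    ((continuous_smoothKernelDeriv h x).continuousOn.integrableOn_compact isCompact_Icc).mono_set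
      Set.Ioo_subset_Icc_self
  have hG'b : ∀ x, |G' x| ≤ 15 / h ^ 2 * ∫ y in Omega, |g y| := fun x => by
    rw [← integral_const_mul]
    refine norm_integral_le_of_norm_le (μ := volume.restrict Omega)
      (f := fun y => smoothKernelDeriv h x y * g y) (g := fun y => 15 / h ^ 2 * |g y|)
      (hgi.abs.const_mul _) (Filter.Eventually.of_forall fun y => ?_)
    rw [norm_mul]
    exact mul_le_mul_of_nonneg_right (abs_smoothKernelDeriv_le h0 h1 x y) (abs_nonneg _)
  have hG'L : MemLp G' 2 (volume.restrict Omega) :=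
    MemLp.of_bound hG'm.aestronglyMeasurable _ (Filter.Eventually.of_forall hG'b)
  have hL2 : HasL2Deriv G G' := by
    refine ⟨hG'L, fun x hx => ?_⟩
    rw [intervalIntegral.integral_eq_sub_of_hasDerivAt (fun t _ => hder t)
      (intervalIntegrable_of_mem (integrableOn_of_memLp hG'L)
        (Set.left_mem_Icc.2 (by norm_num)) hx)]
    ring
  have hp : ∀ a : ℝ, (h ^ a) ^ 2 = h ^ (2 * a) := fun a => by
    rw [← Real.rpow_natCast, ← Real.rpow_mul h0.le, mul_comm]; norm_num
  have b1 : l2Norm (fun x => g x - G x) ≤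
      ENNReal.ofReal (3 * h ^ s) * slobodeckijSq s g ^ (1 / 2 : ℝ) := by
    refine l2Norm_le_of_sq_le (by positivity) fun x hx => ?_
    have hx' := Set.Ioo_subset_Icc_self hx
    have e : g x - G x = -∫ y in Omega, smoothKernel h x y * (g y - g x) := by
      simp only [mul_sub]
      rw [integral_sub (hki x) ((hki1 x).mul_const _), integral_mul_const,
        integral_smoothKernel h0 h1 hx']
      ring
    rw [e, neg_sq]
    refine (integral_mul_sub_sq_le h0 hs hg.1 (abs_smoothKernel_le h0 x)
      (fun y hy => smoothKernel_eq_zero h0 hx' hy)).trans ?_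
    gcongr
    rw [mul_pow, hp, Real.rpow_add h0, Real.rpow_two]
    have : 0 ≤ h ^ (2 * s) := by positivity
    field_simp
    linarith
  have b2 : l2Norm G' ≤
      ENNReal.ofReal (22 * h ^ (s - 1)) * slobodeckijSq s g ^ (1 / 2 : ℝ) := by
    refine l2Norm_le_of_sq_le (by positivity) fun x hx => ?_
    have hx' := Set.Ioo_subset_Icc_self hx
    have e : G' x = ∫ y in Omega, smoothKernelDeriv h x y * (g y - g x) := by
      simp only [mul_sub]
      rw [integral_sub (hki' x) ((hki1' x).mul_const _), integral_mul_const,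
        integral_smoothKernelDeriv h0 h1 hx]
      ring
    rw [e]
    refine (integral_mul_sub_sq_le h0 hs hg.1 (abs_smoothKernelDeriv_le h0 h1 x)
      (fun y hy => smoothKernelDeriv_eq_zero h0 hx' hy)).trans ?_
    gcongr
    rw [mul_pow, hp, show 2 + 2 * s = 2 * (s - 1) + 4 by ring, Real.rpow_add h0,
      show (4 : ℝ) = ((4 : ℕ) : ℝ) by norm_num, Real.rpow_natCast]
    have : 0 ≤ h ^ (2 * (s - 1)) := by positivity
    field_simp
    linarith
  have b3 : bestApprox (m + 1) G ≤
      ENNReal.ofReal (22 * h ^ s) * slobodeckijSq s g ^ (1 / 2 : ℝ) := by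
    have c1 := (hL2.bestApprox_succ_le m).trans ((bestApprox_le_l2Norm m G').trans b2)
    have c2 : ENNReal.ofReal h * ENNReal.ofReal (m + 1) = 1 := by
      rw [← ENNReal.ofReal_mul h0.le, hh]
      push_cast
      rw [one_div_mul_cancel (by positivity), ENNReal.ofReal_one]
    calc bestApprox (m + 1) G
        = ENNReal.ofReal h * (ENNReal.ofReal (m + 1) * bestApprox (m + 1) G) := by
          rw [← mul_assoc, c2, one_mul]
      _ ≤ ENNReal.ofReal h * (ENNReal.ofReal (22 * h ^ (s - 1)) *
          slobodeckijSq s g ^ (1 / 2 : ℝ)) := by gcongr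
      _ = _ := by
          rw [← mul_assoc, ← ENNReal.ofReal_mul h0.le, Real.rpow_sub_one h0.ne']
          congr 2
          field_simp
  have e : g = fun x => (g x - G x) + G x := by ext x; ring
  conv_lhs => rw [e]
  refine (bestApprox_add_le _ (hg.1.sub hGc.aestronglyMeasurable)
    hGc.aestronglyMeasurable).trans ?_
  refine (add_le_add b1 b3).trans ?_
  rw [← add_mul, ← ENNReal.ofReal_add (by positivity) (by positivity)]
  have e2 : ((m + 1 : ℕ) : ℝ) ^ (-s) = h ^ s := by
    rw [hh, one_div, Real.inv_rpow hn0.le, Real.rpow_neg hn0.le]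
  rw [e2]
  gcongr
  exact le_of_eq (by ring)

/-! ### The Sobolev scale -/

theorem l2Norm_weakDeriv_le_sobolevNorm {r : ℝ} {u : ℝ → ℝ} {j : ℕ} (hj : j ≤ ⌊r⌋₊) :
    l2Norm (weakDeriv j u) ≤ sobolevNorm r u := by
  have h : l2Norm (weakDeriv j u) ^ 2 ≤
      ∑ j ∈ Finset.range (⌊r⌋₊ + 1), l2Norm (weakDeriv j u) ^ 2 :=
    Finset.single_le_sum (f := fun j => l2Norm (weakDeriv j u) ^ 2) (fun _ _ => zero_le)
      (Finset.mem_range.2 (by omega))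
  calc l2Norm (weakDeriv j u) = (l2Norm (weakDeriv j u) ^ 2) ^ (1 / 2 : ℝ) := by
        rw [← ENNReal.rpow_natCast, ← ENNReal.rpow_mul]; norm_num
    _ ≤ _ := ENNReal.rpow_le_rpow (h.trans le_self_add) (by norm_num)

theorem slobodeckijSq_le_sobolevNorm {r : ℝ} {u : ℝ → ℝ} (hr : Int.fract r ≠ 0) :
    slobodeckijSq (Int.fract r) (weakDeriv ⌊r⌋₊ u) ^ (1 / 2 : ℝ) ≤ sobolevNorm r u := by
  rw [sobolevNorm, if_neg hr]
  exact ENNReal.rpow_le_rpow le_add_self (by norm_num)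

theorem MemSobolev.memLp {η : ℝ} {u : ℝ → ℝ} (hu : MemSobolev η u) {j : ℕ} (hj : j ≤ ⌊η⌋₊) :
    MemLp (weakDeriv j u) 2 (volume.restrict Omega) :=
  ⟨(hasWeakDeriv_weakDeriv (hu.1 j hj)).2.1.aestronglyMeasurable,
    (l2Norm_weakDeriv_le_sobolevNorm hj).trans_lt hu.2⟩

/-- Below the top order, each weak derivative has an absolutely continuous representative. -/
theorem MemSobolev.exists_hasL2Deriv {η : ℝ} {u : ℝ → ℝ} (hu : MemSobolev η u) {j : ℕ}
    (hj : j + 1 ≤ ⌊η⌋₊) : ∃ F, weakDeriv j u =ᵐ[volume.restrict Omega] F ∧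
      HasL2Deriv F (weakDeriv (j + 1) u) := by
  have h := (hasWeakDeriv_weakDeriv (hu.1 j (by omega))).succ
    (hasWeakDeriv_weakDeriv (hu.1 (j + 1) hj))
  have hL := hu.memLp hj
  obtain ⟨c, hc⟩ := h.exists_ae_eq (integrableOn_of_memLp hL)
  exact ⟨fun x => c + ∫ t in (-1 : ℝ)..x, weakDeriv (j + 1) u t, hc, hL, fun x _ => by simp⟩

theorem HasL2Deriv.continuousOn {f g : ℝ → ℝ} (h : HasL2Deriv f g) :
    ContinuousOn f (Set.Icc (-1) 1) :=
  (continuousOn_const.add (continuousOn_primitive (integrableOn_of_memLp h.memLp))).congr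
    h.eq_add_integral

theorem eqOn_Icc_of_ae_eq {f g : ℝ → ℝ} (hf : ContinuousOn f (Set.Icc (-1) 1))
    (hg : ContinuousOn g (Set.Icc (-1) 1)) (h : f =ᵐ[volume.restrict Omega] g) :
    Set.EqOn f g (Set.Icc (-1) 1) :=
  Measure.eqOn_Icc_of_ae_eq volume (by norm_num)
    (by rwa [Omega, restrict_Ioo_eq_restrict_Icc] at h) hf hg

/-- The continuous representative of a function of order at least `1` is absolutely continuous. -/
theorem MemSobolev.hasL2Deriv {η : ℝ} {u : ℝ → ℝ} (hη : 1 ≤ η) (hu : MemSobolev η u)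
    (hc : ContinuousOn u (Set.Icc (-1) 1)) : HasL2Deriv u (weakDeriv 1 u) := by
  have h1 : 0 + 1 ≤ ⌊η⌋₊ := (Nat.one_le_floor_iff η).2 hη
  obtain ⟨F, hF, hF'⟩ := hu.exists_hasL2Deriv h1
  have hui : LocallyIntegrableOn u Omega := (hu.1 0 (by omega)).choose_spec.1
  have h0 : weakDeriv 0 u =ᵐ[volume.restrict Omega] u :=
    HasWeakDeriv.weakDeriv_ae_eq ⟨hui, hui, fun φ _ => by simp⟩
  have he := eqOn_Icc_of_ae_eq hc hF'.continuousOn (h0.symm.trans hF)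
  refine ⟨hF'.memLp, fun x hx => ?_⟩
  rw [he hx, he (Set.left_mem_Icc.2 (by norm_num)), hF'.eq_add_integral x hx]

/-- Jackson's inequality, iterated. -/
theorem MemSobolev.descFactorial_mul_bestApprox_le {η : ℝ} {u : ℝ → ℝ} (hu : MemSobolev η u)
    (N : ℕ) : ∀ m : ℕ, m ≤ N → m + 1 ≤ ⌊η⌋₊ →
      ENNReal.ofReal (N.descFactorial m) * bestApprox N (weakDeriv 1 u) ≤
        bestApprox (N - m) (weakDeriv (m + 1) u)
  | 0, _, _ => by simp
  | m + 1, hm, hη => by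
    obtain ⟨F, hF, hF'⟩ := hu.exists_hasL2Deriv hη
    have h := hF'.bestApprox_succ_le (N - (m + 1))
    rw [show N - (m + 1) + 1 = N - m by omega, ← bestApprox_congr hF] at h
    refine le_trans ?_ h
    rw [Nat.descFactorial_succ, Nat.cast_mul, ENNReal.ofReal_mul (by positivity), mul_assoc,
      show ((N - (m + 1) : ℕ) : ℝ) + 1 = ((N - m : ℕ) : ℝ) by
        rw [← Nat.cast_add_one]; congr 1; omega]
    gcongr
    exact hu.descFactorial_mul_bestApprox_le N m (by omega) (by omega)

/-! ### Growth of the constants with the order -/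

/-- Comparing factors, `N (m - j) ≤ (N - j) m`, gives `N ^ m * m ! ≤ N.descFactorial m * m ^ m`, and
`m ^ m ≤ exp m * m !`. -/
theorem pow_le_three_pow_mul_descFactorial (N m : ℕ) (hm : m ≤ N) :
    (N : ℝ) ^ m ≤ 3 ^ m * N.descFactorial m := by
  have h1 : ∀ m, m ≤ N → ∀ j, j ≤ m →
      N ^ j * m.descFactorial j ≤ N.descFactorial j * m ^ j := by
    intro m hm j
    induction j with
    | zero => simp
    | succ j ih =>
      intro hj
      have h2 : N * (m - j) ≤ (N - j) * m := by
        rw [Nat.mul_sub, Nat.sub_mul]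
        have : j * m ≤ N * j := by rw [mul_comm]; exact Nat.mul_le_mul_right _ hm
        omega
      calc N ^ (j + 1) * m.descFactorial (j + 1)
          = (N ^ j * m.descFactorial j) * (N * (m - j)) := by
            rw [Nat.descFactorial_succ]; ring
        _ ≤ (N.descFactorial j * m ^ j) * ((N - j) * m) := Nat.mul_le_mul (ih (by omega)) h2
        _ = _ := by rw [Nat.descFactorial_succ]; ring
  have h2 := h1 m hm m le_rfl
  rw [Nat.descFactorial_self] at h2
  have h3 : (N : ℝ) ^ m * m.factorial ≤ N.descFactorial m * (m : ℝ) ^ m := by exact_mod_cast h2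
  have h4 : (m : ℝ) ^ m ≤ 3 ^ m * m.factorial := by
    have h5 := Real.pow_div_factorial_le_exp (m : ℝ) (by positivity) m
    have h6 : Real.exp m ≤ 3 ^ m := by
      rw [← Real.exp_one_pow]
      exact pow_le_pow_left₀ (Real.exp_pos _).le (Real.exp_one_lt_d9.le.trans (by norm_num)) _
    rw [div_le_iff₀ (by positivity)] at h5
    exact h5.trans (by gcongr)
  have hm0 : (0 : ℝ) < m.factorial := by exact_mod_cast m.factorial_pos
  refine le_of_mul_le_mul_right ?_ hm0
  calc (N : ℝ) ^ m * m.factorial ≤ N.descFactorial m * (m : ℝ) ^ m := h3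
    _ ≤ N.descFactorial m * (3 ^ m * m.factorial) := by gcongr
    _ = _ := by ring

/-- Here `N ≤ (m + 1) (N - m)`, and `m + 1 ≤ 2 ^ m`. -/
theorem rpow_neg_sub_le {N m : ℕ} (hm : m < N) {s : ℝ} (hs : 0 ≤ s) (hs1 : s ≤ 1) :
    ((N - m : ℕ) : ℝ) ^ (-s) ≤ 2 ^ m * (N : ℝ) ^ (-s) := by
  obtain ⟨k, rfl⟩ : ∃ k, N = m + (k + 1) := ⟨N - m - 1, by omega⟩
  rw [Nat.add_sub_cancel_left]
  have hk : (0 : ℝ) < ((k + 1 : ℕ) : ℝ) := by positivity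
  have hN : (0 : ℝ) < ((m + (k + 1) : ℕ) : ℝ) := by positivity
  have h2 : ((m : ℝ) + 1) ≤ 2 ^ m := by exact_mod_cast Nat.lt_two_pow_self (n := m)
  have h1 : ((m + (k + 1) : ℕ) : ℝ) ≤ 2 ^ m * ((k + 1 : ℕ) : ℝ) := by
    refine le_trans ?_ (mul_le_mul_of_nonneg_right h2 hk.le)
    push_cast
    nlinarith [mul_nonneg (Nat.cast_nonneg (α := ℝ) m) (Nat.cast_nonneg (α := ℝ) k)]
  rw [Real.rpow_neg hk.le, Real.rpow_neg hN.le, ← div_eq_mul_inv, inv_eq_one_div,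
    div_le_div_iff₀ (by positivity) (by positivity), one_mul]
  calc ((m + (k + 1) : ℕ) : ℝ) ^ s ≤ (2 ^ m * ((k + 1 : ℕ) : ℝ)) ^ s := by gcongr
    _ = (2 ^ m) ^ s * ((k + 1 : ℕ) : ℝ) ^ s := by rw [Real.mul_rpow (by positivity) hk.le]
    _ ≤ 2 ^ m * ((k + 1 : ℕ) : ℝ) ^ s := by
      gcongr
      exact Real.rpow_le_self_of_one_le (one_le_pow₀ (by norm_num)) hs1

/-- Best approximation of the derivative of a function of fractional order, with a constant that
is geometric in the order. -/
theorem MemSobolev.bestApprox_weakDeriv_one_le {η : ℝ} {u : ℝ → ℝ} (hu : MemSobolev η u)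
    {N : ℕ} (hN : 0 < N) {p : ℝ} (hp1 : 1 ≤ p) (hpη : p ≤ η) (hpN : p ≤ N + 1) :
    bestApprox N (weakDeriv 1 u) ≤
      ENNReal.ofReal (25 * 6 ^ (⌊p⌋₊ - 1) * (N : ℝ) ^ (1 - p)) * sobolevNorm p u := by
  obtain ⟨m, hm⟩ : ∃ m, ⌊p⌋₊ = m + 1 :=
    ⟨⌊p⌋₊ - 1, by have := (Nat.one_le_floor_iff p).2 hp1; omega⟩
  set s := Int.fract p with hs
  have hs0 : 0 ≤ s := Int.fract_nonneg p
  have hs1 : s < 1 := Int.fract_lt_one p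
  have hps : p = m + 1 + s := by
    have h1 := Int.floor_add_fract p
    have h2 := natCast_floor_eq_intCast_floor (R := ℝ) (a := p) (by linarith)
    rw [hm] at h2
    push_cast at h2
    rw [← h1, ← h2]
  have hmN : m ≤ N := by
    have : (m : ℝ) ≤ N := by linarith
    exact_mod_cast this
  have hN0 : (0 : ℝ) < N := by exact_mod_cast hN
  have hmη : m + 1 ≤ ⌊η⌋₊ := hm ▸ Nat.floor_mono hpη
  have h1 := hu.descFactorial_mul_bestApprox_le N m hmN hmη
  have h2 : bestApprox (N - m) (weakDeriv (m + 1) u) ≤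
      ENNReal.ofReal (25 * 2 ^ m * (N : ℝ) ^ (-s)) * sobolevNorm p u := by
    by_cases h0 : s = 0
    · refine (bestApprox_le_l2Norm _ _).trans ((l2Norm_weakDeriv_le_sobolevNorm hm.ge).trans ?_)
      refine le_mul_of_one_le_left zero_le ?_
      rw [h0, ENNReal.one_le_ofReal]
      have : (1 : ℝ) ≤ 2 ^ m := one_le_pow₀ (by norm_num)
      simp; linarith
    · have hlt : m < N := by
        have : (m : ℝ) < N := by
          have := lt_of_le_of_ne hs0 (Ne.symm h0)
          linarith
        exact_mod_cast this
      refine (bestApprox_le_slobodeckij (by omega) hs0 (hu.memLp hmη)).trans ?_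
      have h3 := slobodeckijSq_le_sobolevNorm (u := u) h0
      rw [hm] at h3
      refine mul_le_mul' (ENNReal.ofReal_le_ofReal ?_) h3
      rw [mul_assoc]
      exact mul_le_mul_of_nonneg_left (rpow_neg_sub_le hlt hs0 hs1.le) (by norm_num)
  have hd : (0 : ℝ) < N.descFactorial m := by
    exact_mod_cast Nat.pos_of_ne_zero (by rw [Ne, Nat.descFactorial_eq_zero_iff_lt]; omega)
  have h3 := h1.trans h2
  have h4 : ENNReal.ofReal (N.descFactorial m : ℝ)⁻¹ * ENNReal.ofReal (N.descFactorial m) = 1 := by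
    rw [← ENNReal.ofReal_mul (by positivity), inv_mul_cancel₀ hd.ne', ENNReal.ofReal_one]
  calc bestApprox N (weakDeriv 1 u)
      = ENNReal.ofReal (N.descFactorial m : ℝ)⁻¹ *
          (ENNReal.ofReal (N.descFactorial m) * bestApprox N (weakDeriv 1 u)) := by
        rw [← mul_assoc, h4, one_mul]
    _ ≤ ENNReal.ofReal (N.descFactorial m : ℝ)⁻¹ *
          (ENNReal.ofReal (25 * 2 ^ m * (N : ℝ) ^ (-s)) * sobolevNorm p u) := by gcongr
    _ ≤ _ := by
      rw [← mul_assoc, ← ENNReal.ofReal_mul (by positivity)]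
      refine mul_le_mul' (ENNReal.ofReal_le_ofReal ?_) le_rfl
      rw [hm, Nat.add_sub_cancel, hps, show 1 - ((m : ℝ) + 1 + s) = -s - (m : ℕ) by ring,
        Real.rpow_sub hN0, Real.rpow_natCast, show (6 : ℝ) = 2 * 3 by norm_num, mul_pow]
      rw [inv_mul_le_iff₀ hd, ← mul_div_assoc, ← mul_div_assoc, le_div_iff₀ (by positivity)]
      have h5 := mul_le_mul_of_nonneg_left (pow_le_three_pow_mul_descFactorial N m hmN)
        (show 0 ≤ 25 * 2 ^ m * (N : ℝ) ^ (-s) by positivity)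
      linarith

/-- The interpolation error, with an explicit constant that is geometric in the order: the stability
constant of the interpolation is at most `56 √N`, and `56 * 25 = 1400`. -/
theorem MemSobolev.h1Seminorm_sub_gaussInterp_le {η : ℝ} {u : ℝ → ℝ} (hη : 1 ≤ η)
    (hu : MemSobolev η u) (hc : ContinuousOn u (Set.Icc (-1) 1)) {N : ℕ} (hN : 0 < N)
    {p : ℝ} (hp1 : 1 ≤ p) (hpη : p ≤ η) (hpN : p ≤ N + 1) :
    h1Seminorm (fun x => u x - (gaussInterp N u).eval x) ≤
      ENNReal.ofReal (1400 * 6 ^ (⌊p⌋₊ - 1) * (N : ℝ) ^ (3 / 2 - p)) * sobolevNorm p u := by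
  have h := hu.hasL2Deriv hη hc
  have hN0 : (0 : ℝ) < N := by exact_mod_cast hN
  have hN1 : (1 : ℝ) ≤ N := by exact_mod_cast hN
  rw [h1Seminorm, l2Norm_congr (h.sub_eval (gaussInterp N u)).hasWeakDeriv.weakDeriv_ae_eq]
  refine (h.l2Norm_sub_derivative_gaussInterp_le hN).trans ?_
  refine (mul_le_mul' le_rfl (hu.bestApprox_weakDeriv_one_le hN hp1 hpη hpN)).trans ?_
  rw [← mul_assoc, ← ENNReal.ofReal_mul (by positivity)]
  refine mul_le_mul' (ENNReal.ofReal_le_ofReal ?_) le_rfl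
  have h1 : 1 + √(3000 * N) ≤ 56 * √N := by
    have h3 : (1 : ℝ) ≤ √N := Real.one_le_sqrt.2 hN1
    have h4 : √(3000 : ℝ) ≤ 55 := (Real.sqrt_le_left (by norm_num)).2 (by norm_num)
    rw [Real.sqrt_mul (by norm_num)]
    nlinarith
  rw [show 3 / 2 - p = 1 / 2 + (1 - p) by ring, Real.rpow_add hN0, ← Real.sqrt_eq_rpow]
  calc (1 + √(3000 * N)) * (25 * 6 ^ (⌊p⌋₊ - 1) * (N : ℝ) ^ (1 - p))
      ≤ (56 * √N) * (25 * 6 ^ (⌊p⌋₊ - 1) * (N : ℝ) ^ (1 - p)) := by gcongr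
    _ = _ := by ring

theorem geometric_le_rpow {p : ℝ} (hp1 : 1 ≤ p) :
    1400 * 6 ^ (⌊p⌋₊ - 1) ≤ ((8400 : ℝ) ^ 2) ^ (p - 1 / 2) := by
  have hf : ((⌊p⌋₊ - 1 : ℕ) : ℝ) ≤ p - 1 := by
    rw [Nat.cast_sub ((Nat.one_le_floor_iff p).2 hp1)]
    have := Nat.floor_le (by linarith : 0 ≤ p)
    push_cast; linarith
  calc (1400 : ℝ) * 6 ^ (⌊p⌋₊ - 1) ≤ 8400 * 8400 ^ (⌊p⌋₊ - 1) := by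
        gcongr <;> norm_num
    _ = (8400 : ℝ) ^ (1 + ((⌊p⌋₊ - 1 : ℕ) : ℝ)) := by
        rw [Real.rpow_add (by norm_num), Real.rpow_one, Real.rpow_natCast]
    _ ≤ (8400 : ℝ) ^ (2 * (p - 1 / 2)) := by
        apply Real.rpow_le_rpow_of_exponent_le (by norm_num)
        linarith
    _ = _ := by
        rw [Real.rpow_mul (by norm_num)]; norm_num

/-- For order at least `2`, the geometric factor absorbs the leading constant. -/
theorem geometric_le_rpow_of_two_le {p : ℝ} (hp2 : 2 ≤ p) :
    1400 * 6 ^ (⌊p⌋₊ - 1) ≤ ((8400 : ℝ) ^ 2) ^ (p - 3 / 2) := by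
  have h2 : 2 ≤ ⌊p⌋₊ := Nat.le_floor (by exact_mod_cast hp2)
  have hf := Nat.floor_le (by linarith : 0 ≤ p)
  obtain ⟨m, hm⟩ : ∃ m, ⌊p⌋₊ = m + 2 := ⟨⌊p⌋₊ - 2, by omega⟩
  rw [hm] at hf ⊢
  push_cast at hf
  calc (1400 : ℝ) * 6 ^ (m + 2 - 1) = 8400 * 6 ^ m := by
        rw [show m + 2 - 1 = m + 1 by omega]; ring
    _ ≤ 8400 * 8400 ^ m := by gcongr; norm_num
    _ = (8400 : ℝ) ^ (1 + (m : ℝ)) := by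
        rw [Real.rpow_add (by norm_num), Real.rpow_one, Real.rpow_natCast]
    _ ≤ (8400 : ℝ) ^ (2 * (p - 3 / 2)) := by
        apply Real.rpow_le_rpow_of_exponent_le (by norm_num)
        have : (0 : ℝ) ≤ m := by positivity
        linarith
    _ = _ := by
        rw [Real.rpow_mul (by norm_num)]; norm_num

end GaussInterp

end

theorem lemma3p1 :
    ∃ c : ℝ, 0 < c ∧
      ∀ (N : ℕ) (η : ℝ) (u : ℝ → ℝ), 0 < N → 1 ≤ η →
        GaussInterp.MemSobolev η u → ContinuousOn u (Set.Icc (-1) 1) →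
        (∃! q : Polynomial ℝ, GaussInterp.IsGaussInterpolant N u q) ∧
        ∀ uI : Polynomial ℝ, GaussInterp.IsGaussInterpolant N u uI →
          (GaussInterp.h1Seminorm (fun x => u x - uI.eval x) ≤
            ENNReal.ofReal (c * (c / (N : ℝ)) ^ (min η ((N : ℝ) + 1) - 3 / 2)) *
              GaussInterp.sobolevNorm (min η ((N : ℝ) + 1)) u) ∧
          (2 ≤ η →
            GaussInterp.h1Seminorm (fun x => u x - uI.eval x) ≤
              ENNReal.ofReal ((c / (N : ℝ)) ^ (min η ((N : ℝ) + 1) - 3 / 2)) *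
                GaussInterp.sobolevNorm (min η ((N : ℝ) + 1)) u) := by
  -- `8400 = 1400 * 6` exceeds both the constant `1400` and the ratio `6` of the geometric growth;
  -- it is squared since, for `p ≥ 2`, the exponent `p - 3 / 2` may be as small as `(p - 1) / 2`
  refine ⟨8400 ^ 2, by norm_num, fun N η u hN hη hu hc => ⟨?_, fun uI hI => ?_⟩⟩
  · exact ⟨GaussInterp.gaussInterp N u, GaussInterp.isGaussInterpolant_iff.2 rfl,
      fun q hq => GaussInterp.isGaussInterpolant_iff.1 hq⟩
  rw [GaussInterp.isGaussInterpolant_iff.1 hI]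
  have hN1 : (1 : ℝ) ≤ N := by exact_mod_cast hN
  have hN0 : (0 : ℝ) < N := by linarith
  set p := min η ((N : ℝ) + 1) with hp
  have hp1 : 1 ≤ p := le_min hη (by linarith)
  have h := hu.h1Seminorm_sub_gaussInterp_le hη hc hN hp1 (min_le_left _ _) (min_le_right _ _)
  have hdiv : ((8400 : ℝ) ^ 2 / N) ^ (p - 3 / 2) =
      ((8400 : ℝ) ^ 2) ^ (p - 3 / 2) * (N : ℝ) ^ (3 / 2 - p) := by
    rw [Real.div_rpow (by norm_num) hN0.le, div_eq_mul_inv, ← Real.rpow_neg hN0.le, neg_sub]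
  refine ⟨h.trans ?_, fun h2 => h.trans ?_⟩
  · refine mul_le_mul' (ENNReal.ofReal_le_ofReal ?_) le_rfl
    rw [hdiv, ← mul_assoc]
    refine mul_le_mul_of_nonneg_right ?_ (by positivity)
    refine (GaussInterp.geometric_le_rpow hp1).trans (le_of_eq ?_)
    rw [show p - 1 / 2 = 1 + (p - 3 / 2) by ring, Real.rpow_add (by norm_num), Real.rpow_one]
  · refine mul_le_mul' (ENNReal.ofReal_le_ofReal ?_) le_rfl
    rw [hdiv]
    gcongr
    exact GaussInterp.geometric_le_rpow_of_two_le (le_min h2 (by linarith))
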